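/- **The Kepler–Euler flow.** Let $c\in\mathbb R$. Let $M_c$ be the sphere of radius $1/\sqrt{-2c}$ in Euclidean $\mathbb R^3$ if $c<0$, the plane $\mathbb R^2$ if $c=0$, and the hyperbolic plane $\{|u|^2-h^2=-1/(2c),\ h>0\}$ in Minkowski space $\{(u,h)\in\mathbb R^2\times\mathbb R\}$ if $c>0$, with the induced metric $g_c$. Then $g_c$ is a Riemannian metric of constant curvature $-2c$. Let $o_c\in M_c$ be the north pole $(0,1/\sqrt{-2c})$, the origin, or the vertex $(0,1/\sqrt{2c})$, respectively, and let $\Phi_c:\{x\in\mathbb R^2:|x|^2>2c\}\to M_c\setminus\{o_c\}$ be the inverse stereographic projection from $o_c$, $\Phi_c(x)=o_c+\frac{2}{|x|^2-2c}\,(x,\operatorname{sign}(c)\sqrt{|2c|})$ if $c\ne0$, and $\Phi_0(x)=\frac{2x}{|x|^2}$. Let $S^*M_c$ be the unit cotangent bundle, a smooth 3-manifold, and let $S^*g_c$ be the restriction to it of the cotangent (Sasaki–Mok) lift $T^*g_c(V,W)=g_c(T\pi V,T\pi W)+g_c^*(\nabla V,\nabla W)$ of $g_c$. Consider the Kepler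 Hamiltonian $H(q,p)=\frac{|p|^2}2-\frac1{|q|}$ on $(\mathbb R^2\setminus\{0\})\times\mathbb R^2$ with $\omega=dp\wedge dq$, $\iota_{X_H}\omega=-dH$, the energy level $\Sigma_c=\{H=c\}$, and the regularized Hamiltonian $K_c(q,p)=\frac{|q|^2}2\big(\frac{|p|^2-2c}2\big)^2$. Let $\Psi_c$ be the symplectic switch $(q,p)=(y,-x)$ followed by the cotangent lift of $\Phi_c$. Then $\Psi_c$ maps $\Sigma_c$ diffeomorphically onto $S^*M_c$ minus the fibre over $o_c$, and $(\Psi_c)_*X_{K_c}$ extends to a smooth complete vector field $X_c$ on $S^*M_c$ (the regularized Kepler flow) with the following properties. 1. With respect to $S^*g_c$ and its Riemannian volume form $\mu$ (for a suitable orientation), $X_c$ is divergence-free and $\operatorname{curl}X_c=X_c$ (i.e. $\iota_{X_c}\mu=d\,\iota_{X_c}S^*g_c$), so it is a Beltrami field with eigenvalue $1$; and it solves the stationary Euler equations $\nabla_{X_c}X_c=-\nabla P$, $\mathcal L_{X_c}\mu=0$ for some smooth pressure $P$. 2. The flow lines of $X_c$ are exactly the lifted geodesics $t\mapsto(m(t),g_c(m'(t),\cdot))$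 of $M_c$ of unit speed. 3. The Kepler flow is recovered: under $\Psi_c$ and the time change $dt/d\tau=|q|$, the solutions of the Kepler problem of energy $c$ on open time intervals correspond to the integral curves of $X_c$ on open intervals that avoid the fibre over $o_c$. 4. Symmetries correspond to isometries: for every $A\in O(2)$ the map $(q,p)\mapsto(Aq,Ap)$ of $\Sigma_c$ corresponds under $\Psi_c$ to an isometry of $(S^*M_c,S^*g_c)$ preserving $X_c$; every diffeomorphism of $S^*M_c$ that preserves $X_c$ and covers a diffeomorphism $f$ of $M_c$ is an isometry of $S^*g_c$, and $f$ is an isometry of $g_c$; and every isometry of $(M_c,g_c)$ is covered by such a diffeomorphism. -/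

import Mathlib

open Set Topology
open scoped ContDiff RealInnerProductSpace

set_option maxSynthPendingDepth 3

noncomputable section

namespace KeplerEuler

/-! ### Riemannian geometry in coordinates -/

section Coordinates

variable {E : Type*} [NormedAddCommGroup E] [NormedSpace ℝ E]

/-- Levi-Civita connection coefficients of a metric `g` on an open subset of `E`: writing `∂_a`
for the derivative in direction `a`, `christoffel g x a b` is the vector `Γ` determined by
`g(Γ, d) = (1/2) (∂_a g(b,d) + ∂_b g(a,d) - ∂_d g(a,b))`. -/
def christoffel (g : E → E →L[ℝ] E →L[ℝ] ℝ) (x : E) : E →L[ℝ] E →L[ℝ] E :=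
  (1 / 2 : ℝ) • (ContinuousLinearMap.compL ℝ E (E →L[ℝ] ℝ) E (g x).inverse) ∘L
    (fderiv ℝ g x + (fderiv ℝ g x).flip
      - ((ContinuousLinearMap.flipₗᵢ ℝ E E ℝ).toContinuousLinearEquiv :
          (E →L[ℝ] E →L[ℝ] ℝ) →L[ℝ] (E →L[ℝ] E →L[ℝ] ℝ)) ∘L (fderiv ℝ g x).flip)

/-- The formula for `christoffel`, spelled out. -/
theorem christoffel_apply (g : E → E →L[ℝ] E →L[ℝ] ℝ) (x a b : E) :
    christoffel g x a b = (1 / 2 : ℝ) • (g x).inverse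
      (fderiv ℝ g x a b + fderiv ℝ g x b a - ((fderiv ℝ g x).flip a).flip b) := rfl

/-- The covariant derivative `∇_Y X` at `x` of vector fields on an open subset of `E`. -/
def covariantDeriv (g : E → E →L[ℝ] E →L[ℝ] ℝ) (Y X : E → E) (x : E) : E :=
  fderiv ℝ X x (Y x) + christoffel g x (Y x) (X x)

/-- The Riemann curvature tensor `R(a,b)d = ∇_a ∇_b d - ∇_b ∇_a d` (`a b d` constant fields). -/
def riemann (g : E → E →L[ℝ] E →L[ℝ] ℝ) (x a b d : E) : E :=
  fderiv ℝ (fun z => christoffel g z b d) x a - fderiv ℝ (fun z => christoffel g z a d) x b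
    + christoffel g x a (christoffel g x b d) - christoffel g x b (christoffel g x a d)

/-- The gradient of a function with respect to the metric `g`. -/
def grad (g : E → E →L[ℝ] E →L[ℝ] ℝ) (f : E → ℝ) (x : E) : E :=
  (g x).inverse (fderiv ℝ f x)

/-- Covariant derivative of a covector along a curve: if `(x(t), y(t))` is a curve in the cotangent
bundle in canonical coordinates with velocity `(a, b)`, then `∇_a y = b - y(Γ(a, ·))`. -/
def covectorDeriv (g : E → E →L[ℝ] E →L[ℝ] ℝ) (x : E) (y : E →L[ℝ] ℝ) (V : E × (E →L[ℝ] ℝ)) :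
    E →L[ℝ] ℝ :=
  V.2 - y.comp (christoffel g x V.1)

/-- The cotangent (Sasaki-Mok) lift `T^*g` of the metric `g` in canonical coordinates `(x, y)` of
the cotangent bundle: `T^*g(V,W) = g(Tπ V, Tπ W) + g^*(∇ V, ∇ W)`. -/
def sasakiMok (g : E → E →L[ℝ] E →L[ℝ] ℝ) (z V W : E × (E →L[ℝ] ℝ)) : ℝ :=
  g z.1 V.1 W.1
    + covectorDeriv g z.1 z.2 V ((g z.1).inverse (covectorDeriv g z.1 z.2 W))

/-- The one-form `ι_X g`. -/
def flat (g : E → E →L[ℝ] E →L[ℝ] ℝ) (X : E → E) (x : E) : E [⋀^Fin 1]→L[ℝ] ℝ :=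
  ContinuousAlternatingMap.ofSubsingleton ℝ E ℝ (0 : Fin 1) (g x (X x))

/-- The contraction `ι_X μ`. -/
def contract {k : ℕ} (X : E → E) (μ : E → E [⋀^Fin (k + 1)]→L[ℝ] ℝ) (x : E) :
    E [⋀^Fin k]→L[ℝ] ℝ :=
  (μ x).curryLeft (X x)

/-- The Lie derivative `L_X μ = d ι_X μ + ι_X d μ` of a differential form. -/
def lieDeriv {k : ℕ} (X : E → E) (μ : E → E [⋀^Fin (k + 1)]→L[ℝ] ℝ) (x : E) :
    E [⋀^Fin (k + 1)]→L[ℝ] ℝ :=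
  extDeriv (contract X μ) x + contract X (extDeriv μ) x

end Coordinates

/-! ### Embedded submanifolds of a normed space -/

section Submanifolds

variable {V : Type*} [NormedAddCommGroup V] [NormedSpace ℝ V]

/-- The coordinate space `ℝⁿ`. -/
abbrev Coord (n : ℕ) := EuclideanSpace ℝ (Fin n)

/-- A local parametrization of a subset `S` of `V`: a smooth bijection `toFun` from an open
`source ⊆ ℝⁿ` onto the relatively open piece `S ∩ target` of `S`, whose inverse is the restriction
of a smooth map `invFun` on the open set `target ⊆ V`. -/
structure Chart (S : Set V) (n : ℕ) where
  toFun : Coord n → V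
  invFun : V → Coord n
  source : Set (Coord n)
  target : Set V
  isOpen_source : IsOpen source
  isOpen_target : IsOpen target
  contDiffOn_toFun : ContDiffOn ℝ ∞ toFun source
  contDiffOn_invFun : ContDiffOn ℝ ∞ invFun target
  toFun_mem : ∀ x ∈ source, toFun x ∈ S ∩ target
  invFun_mem : ∀ q ∈ S ∩ target, invFun q ∈ source
  left_inv : ∀ x ∈ source, invFun (toFun x) = x
  right_inv : ∀ q ∈ S ∩ target, toFun (invFun q) = q

/-- `S` is a smooth embedded `n`-dimensional submanifold of `V`. -/
def IsSubmanifold (S : Set V) (n : ℕ) : Prop :=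
  ∀ q ∈ S, ∃ φ : Chart S n, q ∈ φ.target

/-- The tangent vectors of `S` at `q`: velocities of curves in `S`. -/
def tangentVectors (S : Set V) (q : V) : Set V :=
  {v | ∃ γ : ℝ → V, γ 0 = q ∧ (∀ᶠ t in 𝓝 0, γ t ∈ S) ∧ HasDerivAt γ v 0}

/-- A map on `S` is smooth if it is so in all charts of `S`. -/
def SmoothOn (S : Set V) (n : ℕ) {F : Type*} [NormedAddCommGroup F] [NormedSpace ℝ F]
    (f : V → F) : Prop :=
  ∀ φ : Chart S n, ContDiffOn ℝ ∞ (f ∘ φ.toFun) φ.source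

/-- A smooth tangent vector field on `S`. -/
def IsVectorField (S : Set V) (n : ℕ) (X : V → V) : Prop :=
  SmoothOn S n X ∧ ∀ q ∈ S, X q ∈ tangentVectors S q

namespace Chart

variable {S : Set V} {n : ℕ}

/-- The expression in the chart of a (field of) bilinear form(s) `G`. -/
def metric (φ : Chart S n) (G : V → V →L[ℝ] V →L[ℝ] ℝ) (x : Coord n) :
    Coord n →L[ℝ] Coord n →L[ℝ] ℝ :=
  (G (φ.toFun x)).bilinearComp (fderiv ℝ φ.toFun x) (fderiv ℝ φ.toFun x)

/-- The expression in the chart of a tangent vector field `X`. -/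
def field (φ : Chart S n) (X : V → V) (x : Coord n) : Coord n :=
  fderiv ℝ φ.invFun (φ.toFun x) (X (φ.toFun x))

/-- The expression in the chart of a differential form `μ`, that is, its pullback. -/
def form {k : ℕ} (φ : Chart S n) (μ : V → V [⋀^Fin k]→L[ℝ] ℝ) (x : Coord n) :
    Coord n [⋀^Fin k]→L[ℝ] ℝ :=
  (μ (φ.toFun x)).compContinuousLinearMap (fderiv ℝ φ.toFun x)

/-- Canonical coordinates `(x, y)` of the cotangent bundle induced by the chart: `x` are the
coordinates of the base point `q`, and `y` is the covector `ξ` read in the chart, `y = ξ ∘ Dφ`. -/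
def cotangentCoord (φ : Chart S n) (w : V × (V →L[ℝ] ℝ)) : Coord n × (Coord n →L[ℝ] ℝ) :=
  (φ.invFun w.1, w.2.comp (fderiv ℝ φ.toFun (φ.invFun w.1)))

end Chart

/-- `G` restricts to a smooth Riemannian metric on `S`. -/
def IsRiemannian (S : Set V) (n : ℕ) (G : V → V →L[ℝ] V →L[ℝ] ℝ) : Prop :=
  ∀ φ : Chart S n, ContDiffOn ℝ ∞ (φ.metric G) φ.source ∧ ∀ x ∈ φ.source,
    (∀ a b, φ.metric G x a b = φ.metric G x b a) ∧ ∀ a, a ≠ 0 → 0 < φ.metric G x a a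

/-- The Riemannian manifold `(S, G)` has constant sectional curvature `k`. -/
def HasConstantCurvature (S : Set V) (n : ℕ) (G : V → V →L[ℝ] V →L[ℝ] ℝ) (k : ℝ) : Prop :=
  ∀ φ : Chart S n, ∀ x ∈ φ.source, ∀ a b d, riemann (φ.metric G) x a b d =
    k • (φ.metric G x b d • a - φ.metric G x a d • b)

/-- `m` is a (parametrized) geodesic of `(S, G)` on the open set of times `J`. -/
def IsGeodesicOn (S : Set V) (n : ℕ) (G : V → V →L[ℝ] V →L[ℝ] ℝ) (m : ℝ → V) (J : Set ℝ) : Prop :=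
  ContDiffOn ℝ 2 m J ∧ (∀ t ∈ J, m t ∈ S) ∧
    ∀ φ : Chart S n, ∀ t ∈ J, m t ∈ φ.target →
      deriv (deriv (φ.invFun ∘ m)) t + christoffel (φ.metric G) (φ.invFun (m t))
        (deriv (φ.invFun ∘ m) t) (deriv (φ.invFun ∘ m) t) = 0

/-- `γ` is an integral curve of `X` on `J`. -/
def IntegralOn (X : V → V) (γ : ℝ → V) (J : Set ℝ) : Prop :=
  ∀ t ∈ J, HasDerivAt γ (X (γ t)) t

/-- `F` restricts to a diffeomorphism of `S` onto itself. -/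
def IsDiffeo (S : Set V) (n : ℕ) (F : V → V) : Prop :=
  ∃ F' : V → V, MapsTo F S S ∧ MapsTo F' S S ∧ LeftInvOn F' F S ∧ LeftInvOn F F' S ∧
    SmoothOn S n F ∧ SmoothOn S n F'

/-- `F` restricts to an isometry of the Riemannian manifold `(S, G)`. -/
def IsIsometry (S : Set V) (n : ℕ) (G : V → V →L[ℝ] V →L[ℝ] ℝ) (F : V → V) : Prop :=
  IsDiffeo S n F ∧ ∀ φ : Chart S n, ∀ x ∈ φ.source, ∀ a b,
    G (F (φ.toFun x)) (fderiv ℝ (F ∘ φ.toFun) x a) (fderiv ℝ (F ∘ φ.toFun) x b) =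
      φ.metric G x a b

/-- `F_* X = X` on `S`. -/
def PreservesField (S : Set V) (n : ℕ) (X F : V → V) : Prop :=
  ∀ φ : Chart S n, ∀ x ∈ φ.source,
    fderiv ℝ (F ∘ φ.toFun) x (φ.field X x) = X (F (φ.toFun x))

/-! ### Stationary fluid flows on Riemannian three-manifolds -/

/-- `μ` is a Riemannian volume form of the three-manifold `(S, G)`: it is smooth and has values
`±1` on orthonormal bases of the tangent spaces. -/
def IsRiemannianVolume (S : Set V) (G : V → V →L[ℝ] V →L[ℝ] ℝ) (μ : V → V [⋀^Fin 3]→L[ℝ] ℝ) :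
    Prop :=
  ∀ φ : Chart S 3, ContDiffOn ℝ ∞ (φ.form μ) φ.source ∧
    ∀ x ∈ φ.source, ∀ e : Fin 3 → Coord 3,
      (∀ i j, φ.metric G x (e i) (e j) = if i = j then 1 else 0) → |φ.form μ x e| = 1

/-- `L_X μ = 0`. -/
def IsDivergenceFree (S : Set V) (μ : V → V [⋀^Fin 3]→L[ℝ] ℝ) (X : V → V) : Prop :=
  ∀ φ : Chart S 3, ∀ x ∈ φ.source, lieDeriv (φ.field X) (φ.form μ) x = 0

/-- `curl X = Y` on the three-manifold `S` with metric `G` and volume form `μ`: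
`ι_Y μ = d (ι_X G)`. -/
def HasCurl (S : Set V) (G : V → V →L[ℝ] V →L[ℝ] ℝ) (μ : V → V [⋀^Fin 3]→L[ℝ] ℝ)
    (X Y : V → V) : Prop :=
  ∀ φ : Chart S 3, ∀ x ∈ φ.source,
    contract (φ.field Y) (φ.form μ) x = extDeriv (flat (φ.metric G) (φ.field X)) x

/-- `X` is a Beltrami field with proportionality factor `f`: it is divergence-free and
`curl X = f X`. -/
def IsBeltrami (S : Set V) (G : V → V →L[ℝ] V →L[ℝ] ℝ) (μ : V → V [⋀^Fin 3]→L[ℝ] ℝ)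
    (X : V → V) (f : V → ℝ) : Prop :=
  IsDivergenceFree S μ X ∧ HasCurl S G μ X (fun q => f q • X q)

/-- `X` is a solution of the stationary incompressible Euler equations `∇_X X = -∇P`, `L_X μ = 0`
for some smooth pressure function `P`. -/
def IsStationaryEuler (S : Set V) (G : V → V →L[ℝ] V →L[ℝ] ℝ) (μ : V → V [⋀^Fin 3]→L[ℝ] ℝ)
    (X : V → V) : Prop :=
  IsDivergenceFree S μ X ∧ ∃ P : V → ℝ, SmoothOn S 3 P ∧ ∀ φ : Chart S 3, ∀ x ∈ φ.source,
    covariantDeriv (φ.metric G) (φ.field X) (φ.field X) x = -grad (φ.metric G) (P ∘ φ.toFun) x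

/-! ### Cotangent bundles

Let `B` be a symmetric bilinear form on `V` which is nondegenerate on `V` and on the tangent spaces
of `S ⊆ V`, so that `V` is the orthogonal direct sum of `T_q S` and its normal space. A covector on
`T_q S` is represented by the functional on `V` that extends it by zero on the normal space. -/

/-- The cotangent bundle of `S`. -/
def cotangentBundle (B : V →L[ℝ] V →L[ℝ] ℝ) (S : Set V) : Set (V × (V →L[ℝ] ℝ)) :=
  {w | w.1 ∈ S ∧ ∀ ν, (∀ v ∈ tangentVectors S w.1, B ν v = 0) → w.2 ν = 0}

/-- `v` is the tangent vector metrically dual to the covector `ξ` at `q`, that is, `ξ = B(v, ·)` on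
`T_q S`. -/
def IsDual (B : V →L[ℝ] V →L[ℝ] ℝ) (S : Set V) (q : V) (ξ : V →L[ℝ] ℝ) (v : V) : Prop :=
  v ∈ tangentVectors S q ∧ ∀ u ∈ tangentVectors S q, ξ u = B v u

/-- The spherical cotangent bundle: covectors of dual norm one. -/
def sphereBundle (B : V →L[ℝ] V →L[ℝ] ℝ) (S : Set V) : Set (V × (V →L[ℝ] ℝ)) :=
  {w | w ∈ cotangentBundle B S ∧ ∃ v, IsDual B S w.1 w.2 v ∧ B v v = 1}

/-- The cotangent lift of a parametrization `f : E → S ⊆ V`. It maps a covector `y` at `x` to the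
covector `ξ` at `f x` (zero on the normal space) with `ξ ∘ Df_x = y`. If `h = f^*B` and `u` is the
vector with `h(u, ·) = y`, this is `ξ = B(Df_x u, ·)`. -/
def cotangentLift {E : Type*} [NormedAddCommGroup E] [NormedSpace ℝ E]
    (B : V →L[ℝ] V →L[ℝ] ℝ) (f : E → V) (z : E × (E →L[ℝ] ℝ)) : V × (V →L[ℝ] ℝ) :=
  (f z.1, B (fderiv ℝ f z.1
    ((B.bilinearComp (fderiv ℝ f z.1) (fderiv ℝ f z.1)).inverse z.2)))

/-- `G` is, on the spherical cotangent bundle of the surface `S` with metric `B`, the restriction of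
the cotangent (Sasaki-Mok) lift of that metric. -/
def IsSasakiMokLift (B : V →L[ℝ] V →L[ℝ] ℝ) (S : Set V)
    (G : V × (V →L[ℝ] ℝ) → V × (V →L[ℝ] ℝ) →L[ℝ] V × (V →L[ℝ] ℝ) →L[ℝ] ℝ) : Prop :=
  ∀ φ : Chart S 2, ∀ w ∈ sphereBundle B S, w.1 ∈ φ.target →
    ∀ a ∈ tangentVectors (sphereBundle B S) w, ∀ b ∈ tangentVectors (sphereBundle B S) w,
      G w a b = sasakiMok (φ.metric fun _ => B) (φ.cotangentCoord w)
        (fderiv ℝ φ.cotangentCoord w a) (fderiv ℝ φ.cotangentCoord w b)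

end Submanifolds

/-! ### The Kepler problem -/

/-- The plane, in which both positions and momenta take their values. -/
abbrev Plane := EuclideanSpace ℝ (Fin 2)

/-- The Hamiltonian vector field of `F(q, p)` for the symplectic form `ω = dp ∧ dq`, with the
convention `ι_X ω = -dF`, i.e. `q' = ∂F/∂p`, `p' = -∂F/∂q`. -/
def hamiltonianField (F : Plane × Plane → ℝ) (z : Plane × Plane) : Plane × Plane :=
  (gradient (fun p => F (z.1, p)) z.2, -gradient (fun q => F (q, z.2)) z.1)

/-- The Kepler Hamiltonian `H(q,p) = |p|²/2 - 1/|q|`. -/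
def keplerH (z : Plane × Plane) : ℝ := ‖z.2‖ ^ 2 / 2 - 1 / ‖z.1‖

/-- The energy level `H = c` of the Kepler problem, `q ≠ 0`. -/
def energyLevel (c : ℝ) : Set (Plane × Plane) := {z | z.1 ≠ 0 ∧ keplerH z = c}

/-- The regularized Kepler Hamiltonian `K_c(q,p) = (|q|²/2) ((|p|² - 2c)/2)²`. -/
def regularizedK (c : ℝ) (z : Plane × Plane) : ℝ :=
  ‖z.1‖ ^ 2 / 2 * ((‖z.2‖ ^ 2 - 2 * c) / 2) ^ 2

/-! ### The model surfaces -/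

/-- Three-space, with points `(u, h)`, `u` in the horizontal plane and `h` the height. -/
abbrev Space := Plane × ℝ

/-- The phase space `V × V^*` in which the cotangent bundles of surfaces in `V = Space` lie. -/
abbrev Phase := Space × (Space →L[ℝ] ℝ)

/-- The Euclidean form `|u|² + h²` if `c ≤ 0`, the Minkowski form `|u|² - h²` if `c > 0`. -/
def ambientForm (c : ℝ) : Space →L[ℝ] Space →L[ℝ] ℝ :=
  ((innerSL ℝ : Plane →L[ℝ] Plane →L[ℝ] ℝ).bilinearComp
      (ContinuousLinearMap.fst ℝ Plane ℝ) (ContinuousLinearMap.fst ℝ Plane ℝ) :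
        Space →L[ℝ] Space →L[ℝ] ℝ)
    + (if 0 < c then (-1 : ℝ) else 1) • ((ContinuousLinearMap.mul ℝ ℝ).bilinearComp
        (ContinuousLinearMap.snd ℝ Plane ℝ) (ContinuousLinearMap.snd ℝ Plane ℝ) :
          Space →L[ℝ] Space →L[ℝ] ℝ)

/-- The value of `ambientForm`, spelled out. -/
theorem ambientForm_apply (c : ℝ) (a b : Space) :
    ambientForm c a b = ⟪a.1, b.1⟫ + (if 0 < c then (-1 : ℝ) else 1) * (a.2 * b.2) := rfl

/-- The model surface: the sphere of radius `1/√(-2c)` in Euclidean space if `c < 0`, the horizontal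
plane `ℝ²` if `c = 0`, and the upper sheet of the hyperboloid `|u|² - h² = -1/(2c)` in Minkowski
space (the hyperbolic plane) if `c > 0`. -/
def modelSurface (c : ℝ) : Set Space :=
  if c < 0 then {m | ‖m.1‖ ^ 2 + m.2 ^ 2 = 1 / (-2 * c)}
  else if c = 0 then {m | m.2 = 0}
  else {m | ‖m.1‖ ^ 2 - m.2 ^ 2 = -1 / (2 * c) ∧ 0 < m.2}

/-- The collision point: north pole of the sphere, origin of the plane, vertex of the hyperboloid. -/
def pole (c : ℝ) : Space := (0, if c = 0 then 0 else 1 / √|2 * c|)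

/-- The map from `{x ∈ ℝ² : |x|² > 2c}` to the model surface. For `c ≠ 0` it is an inverse
stereographic projection: the image of `x` is the point of the surface, other than the pole, on the
line through the pole and the point above or below `x` in the horizontal plane at vertical distance
`√|2c|` from the pole (below the pole if `c < 0`, above if `c > 0`). For `c = 0` it is the inversion
`x ↦ 2x/|x|²`. -/
def stereo (c : ℝ) (x : Plane) : Space :=
  pole c + (2 / (‖x‖ ^ 2 - 2 * c)) • ((x, SignType.sign c * √|2 * c|) : Space)

/-- The unit cotangent bundle of the model surface. -/
def modelBundle (c : ℝ) : Set Phase := sphereBundle (ambientForm c) (modelSurface c)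

/-- The unit cotangent bundle with the fibre over the collision point removed. -/
def collisionFree (c : ℝ) : Set Phase := {w ∈ modelBundle c | w.1 ≠ pole c}

/-- The regularization map: the symplectic switch `(q,p) = (y,-x)` followed by the cotangent lift of
the map `stereo c`. -/
def regMap (c : ℝ) (z : Plane × Plane) : Phase :=
  cotangentLift (ambientForm c) (stereo c) (-z.2, innerSL ℝ z.1)

/-! ### The assertions on the regularized flow -/

/-- `X` is the regularized Kepler vector field on the unit cotangent bundle of the model surface:
`stereo c` identifies `{|x|² > 2c}` with the surface without the collision point, the regularization
map is a diffeomorphism of the energy level `H = c` onto the unit cotangent bundle without the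
collision fibre, and it carries the Hamiltonian field of `K_c` to `X`. (As the complement of the
collision fibre is dense, this determines a smooth `X`.) -/
def IsRegularizedField (c : ℝ) (X : Phase → Phase) : Prop :=
  BijOn (stereo c) {x | 2 * c < ‖x‖ ^ 2} (modelSurface c \ {pole c}) ∧
  BijOn (regMap c) (energyLevel c) (collisionFree c) ∧
  ContDiffOn ℝ ∞ (regMap c) {z | 2 * c < ‖z.2‖ ^ 2} ∧
  (∃ (O : Set Phase) (Θ : Phase → Plane × Plane), IsOpen O ∧ collisionFree c ⊆ O ∧
    ContDiffOn ℝ ∞ Θ O ∧ LeftInvOn Θ (regMap c) (energyLevel c)) ∧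
  ∀ z ∈ energyLevel c,
    fderiv ℝ (regMap c) z (hamiltonianField (regularizedK c) z) = X (regMap c z)

/-- The flow of `X` recovers the Kepler flow of energy `c` up to the time change `dt/dτ = |q|`:
every Kepler solution on an open time interval becomes, after this time change and the
regularization map, an integral curve of `X`, and every integral curve of `X` on an open interval
that avoids the collision fibre arises so. -/
def RecoversKepler (c : ℝ) (X : Phase → Phase) : Prop :=
  (∀ (I : Set ℝ) (z : ℝ → Plane × Plane), IsOpen I → I.OrdConnected →
    (∀ t ∈ I, z t ∈ energyLevel c) → IntegralOn (hamiltonianField keplerH) z I →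
    ∃ (J : Set ℝ) (T : ℝ → ℝ), IsOpen J ∧ J.OrdConnected ∧ BijOn T J I ∧
      (∀ τ ∈ J, HasDerivAt T ‖(z (T τ)).1‖ τ) ∧ IntegralOn X (fun τ => regMap c (z (T τ))) J) ∧
  (∀ (J : Set ℝ) (w : ℝ → Phase), IsOpen J → J.OrdConnected →
    (∀ τ ∈ J, w τ ∈ collisionFree c) → IntegralOn X w J →
    ∃ (I : Set ℝ) (T : ℝ → ℝ) (z : ℝ → Plane × Plane), IsOpen I ∧ I.OrdConnected ∧ BijOn T J I ∧
      (∀ t ∈ I, z t ∈ energyLevel c) ∧ IntegralOn (hamiltonianField keplerH) z I ∧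
      (∀ τ ∈ J, HasDerivAt T ‖(z (T τ)).1‖ τ) ∧ ∀ τ ∈ J, w τ = regMap c (z (T τ)))

/-- The flow of `X` is complete. -/
def IsCompleteField (c : ℝ) (X : Phase → Phase) : Prop :=
  ∀ w₀ ∈ modelBundle c, ∃ γ : ℝ → Phase,
    γ 0 = w₀ ∧ (∀ t, γ t ∈ modelBundle c) ∧ IntegralOn X γ univ

/-- The flow lines of `X` are exactly the lifted geodesics `t ↦ (m(t), ⟨m'(t), ·⟩)` of the model
surface. -/
def FlowLinesAreLiftedGeodesics (c : ℝ) (X : Phase → Phase) : Prop :=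
  ∀ (J : Set ℝ) (γ : ℝ → Phase), IsOpen J → (∀ t ∈ J, γ t ∈ modelBundle c) →
    (IntegralOn X γ J ↔
      IsGeodesicOn (modelSurface c) 2 (fun _ => ambientForm c) (fun t => (γ t).1) J ∧
      ∀ t ∈ J, IsDual (ambientForm c) (modelSurface c) (γ t).1 (γ t).2
        (deriv (fun s => (γ s).1) t))

/-- `F` is a symmetry of the regularized flow over the diffeomorphism `f` of the configuration
surface: a diffeomorphism of the unit cotangent bundle that covers `f` and preserves `X`. -/
def IsSymmetryOver (c : ℝ) (X F : Phase → Phase) (f : Space → Space) : Prop :=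
  IsDiffeo (modelSurface c) 2 f ∧ IsDiffeo (modelBundle c) 3 F ∧
    (∀ w ∈ modelBundle c, (F w).1 = f w.1) ∧ PreservesField (modelBundle c) 3 X F

/-- The symmetries of the Kepler problem correspond to isometries of the metric `G`:
* the rotations and reflections `(q,p) ↦ (Aq,Ap)` of the Kepler problem are carried by the
  regularization map to isometries of `G` that are symmetries of the regularized flow;
* every symmetry of the regularized flow that covers a diffeomorphism of the configuration surface
  is an isometry of `G`, and it covers an isometry of the surface;
* every isometry of the surface is covered by such a symmetry. -/
def SymmetriesAreIsometries (c : ℝ) (X : Phase → Phase)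
    (G : Phase → Phase →L[ℝ] Phase →L[ℝ] ℝ) : Prop :=
  (∀ A : Plane ≃ₗᵢ[ℝ] Plane, ∃ F f, IsSymmetryOver c X F f ∧ IsIsometry (modelBundle c) 3 G F ∧
    ∀ z ∈ energyLevel c, F (regMap c z) = regMap c (A z.1, A z.2)) ∧
  (∀ F f, IsSymmetryOver c X F f → IsIsometry (modelBundle c) 3 G F ∧
    IsIsometry (modelSurface c) 2 (fun _ => ambientForm c) f) ∧
  (∀ f, IsIsometry (modelSurface c) 2 (fun _ => ambientForm c) f → ∃ F, IsSymmetryOver c X F f)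

end KeplerEuler

end

open KeplerEuler

noncomputable section

namespace KeplerEuler

/-! ### The model surfaces, uniformly in the energy -/

section Ambient

/-! After the switch `(q,p) = (y,-x)`, the regularized Hamiltonian is half the squared dual norm of
the covector `y` at `x` for the metric `((|x|² - 2c)/2)⁻² |dx|²`. By `stereo_conformal` this metric
is the pullback of the metric of the model surface. Hence `K_c` describes the geodesic flow, and `H
= c` says that the covector has length one (`mem_energyLevel_iff`, `regVelocity_self`). In ambient
terms the geodesic field is the linear map `(m, ξ) ↦ (ξ^♯, 2c m^♭)`, which has no singularity over
the collision point; `fderiv_regMap_hamiltonianField` checks the correspondence by direct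
computation. On the energy level the fields of `K_c` and `H` differ by the factor `|q|`, whence the
time change.

Fluid part: let `α` be the Liouville form on the unit cotangent bundle. The geodesic field `X` is
its Reeb field, that is `α(X) = 1` and `ι_X dα = 0`, and it is also the metric dual of `α` for the
Sasaki-Mok lift (`sasaki_geodesicField`). An orthonormal coframe `α, Y, Z` with `dα = Z ∧ Y`
(`exists_coframe`) shows that `μ = α ∧ dα` is a Riemannian volume form. So `ι_X μ = dα = d(ι_X g)`,
which is the curl equation, and taking `d` again gives zero divergence. As `|X| = 1` and `ι_X dX^♭ =
0`, also `∇_X X = 0`, and the pressure is constant.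

Geodesics: the surface is umbilic, so the Gauss formula turns the geodesic equation at unit speed
into `m'' = 2c m`. This identifies the flow lines, and explicit solutions give completeness.

Symmetries: the base component of `X` at `(m, ξ)` is the vector dual to `ξ`. A map `F` over `f` that
preserves `X` therefore acts on dual vectors by the derivative of `f`, so `f` preserves unit vectors
and is an isometry. Conversely, lifted metric and geodesic field are written in a parametrization
through the induced metric and its Christoffel symbols alone, and these agree for `h` and `f ∘ h`
when `f` is an isometry.

The three geometries are treated at once by the numbers `signature c` and `slope c`, the defining
function `defect c` centred at the pole, and its gradient `normal c`. All of these remain meaningful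
at `c = 0`, where the centre of the sphere or hyperboloid has gone to infinity. -/

/-- The value of `ambientForm c` on the vertical unit vector. -/
def signature (c : ℝ) : ℝ := if 0 < c then -1 else 1

/-- The vertical component of the direction of projection of `stereo c`. -/
def slope (c : ℝ) : ℝ := SignType.sign c * √|2 * c|

/-- A normal field along the model surface, affine in the base point. -/
def normal (c : ℝ) (m : Space) : Space := ((0, signature c) : Space) - slope c • (m - pole c)

/-- A defining function of the model surface. -/
def defect (c : ℝ) (m : Space) : ℝ :=
  (m - pole c).2 - slope c / 2 * ambientForm c (m - pole c) (m - pole c)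

variable {c : ℝ}

theorem ambientForm_eq (c : ℝ) (a b : Space) :
    ambientForm c a b = ⟪a.1, b.1⟫ + signature c * (a.2 * b.2) := rfl

theorem ambientForm_comm (c : ℝ) (a b : Space) : ambientForm c a b = ambientForm c b a := by
  simp only [ambientForm_eq, real_inner_comm b.1 a.1, mul_comm b.2 a.2]

theorem signature_mul_self (c : ℝ) : signature c * signature c = 1 := by
  unfold signature; split_ifs <;> norm_num

theorem signature_ne_zero (c : ℝ) : signature c ≠ 0 := by
  unfold signature; split_ifs <;> norm_num

/-- With `two_mul_pole` and `signature_mul_self`, this is what allows later computations to run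
without a case split on the sign of `c`. Geometrically, it is the curvature of an umbilic surface
with shape factor `slope c` and unit normal of sign `signature c`. -/
theorem signature_mul_slope (c : ℝ) : signature c * (slope c * slope c) = -2 * c := by
  have h : √|2 * c| * √|2 * c| = |2 * c| := Real.mul_self_sqrt (abs_nonneg _)
  unfold signature slope
  rcases lt_trichotomy c 0 with hc | hc | hc
  · rw [if_neg hc.not_gt, sign_neg hc]
    rw [abs_of_neg (by linarith)] at h
    rw [abs_of_neg (by linarith), SignType.coe_neg_one]
    linarith
  · subst hc; simp
  · rw [if_pos hc, sign_pos hc]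
    rw [abs_of_pos (by linarith)] at h
    rw [abs_of_pos (by linarith), SignType.coe_one]
    linarith

theorem two_mul_pole (c : ℝ) : 2 * c * (pole c).2 = slope c := by
  unfold slope pole
  rcases lt_trichotomy c 0 with hc | hc | hc
  · have h : √|2 * c| * √|2 * c| = |2 * c| := Real.mul_self_sqrt (abs_nonneg _)
    have h0 : √|2 * c| ≠ 0 := by
      rw [Real.sqrt_ne_zero']; exact abs_pos.2 (by linarith)
    rw [sign_neg hc]
    simp only [hc.ne, if_false]
    field_simp
    rw [abs_of_neg (by linarith)] at h ⊢
    rw [SignType.coe_neg_one]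
    linarith
  · subst hc; simp
  · have h : √|2 * c| * √|2 * c| = |2 * c| := Real.mul_self_sqrt (abs_nonneg _)
    have h0 : √|2 * c| ≠ 0 := by
      rw [Real.sqrt_ne_zero']; exact abs_pos.2 (by linarith)
    rw [sign_pos hc]
    simp only [hc.ne', if_false]
    field_simp
    rw [abs_of_pos (by linarith)] at h ⊢
    rw [SignType.coe_one]
    linarith

theorem pole_fst (c : ℝ) : (pole c).1 = 0 := rfl

/-- The radius of the model surface is determined by the energy. -/
theorem pole_sq (hc : c ≠ 0) : 2 * c * (signature c * ((pole c).2 * (pole c).2)) = -1 := by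
  have h1 := two_mul_pole c
  have h2 := signature_mul_slope c
  rw [← h1] at h2
  have : 2 * c ≠ 0 := by simpa using hc
  apply mul_left_cancel₀ this
  linear_combination h2

theorem slope_eq_zero_iff : slope c = 0 ↔ c = 0 := by
  constructor
  · intro h
    have := signature_mul_slope c
    rw [h] at this
    linarith
  · rintro rfl; simp [slope]

theorem pole_pos (hc : c ≠ 0) : 0 < (pole c).2 := by
  simp only [pole, hc, if_false]
  have : 0 < √|2 * c| := Real.sqrt_pos.2 (abs_pos.2 (by simpa using hc))
  positivity

/-- The position vector of a sphere or hyperboloid centred at the origin is normal to it; at `c = 0`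
both sides vanish. This converts the second fundamental form into the term `2c m` of the geodesic
equation. -/
theorem signature_smul_normal (c : ℝ) (m : Space) :
    (signature c * slope c) • normal c m = (2 * c) • m := by
  have h1 := two_mul_pole c
  have h2 := signature_mul_slope c
  have h3 := signature_mul_self c
  apply Prod.ext
  · simp only [normal, Prod.smul_fst, Prod.fst_sub, pole_fst, smul_sub, smul_zero, sub_zero,
      zero_sub, smul_smul]
    rw [← neg_smul]
    congr 1
    linarith
  · simp only [normal, Prod.smul_snd, Prod.snd_sub, smul_eq_mul]
    linear_combination slope c * h3 - (m.2 - (pole c).2) * h2 - h1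

theorem ambientForm_normal (c : ℝ) (m v : Space) :
    ambientForm c (normal c m) v = v.2 - slope c * ambientForm c (m - pole c) v := by
  simp only [normal, map_sub, map_smul, sub_apply,
    smul_apply, smul_eq_mul]
  congr 1
  rw [ambientForm_eq, inner_zero_left]
  linear_combination v.2 * signature_mul_self c

theorem ambientForm_normal_normal (c : ℝ) (m : Space) :
    ambientForm c (normal c m) (normal c m) = signature c - 2 * slope c * defect c m := by
  rw [ambientForm_normal, ambientForm_comm, ambientForm_normal]
  simp only [normal, defect, Prod.snd_sub, Prod.smul_snd, smul_eq_mul]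
  ring

/-- Expanding the quadric about the pole, which lies on it, leaves `-slope c / 2` times the quadric
equation. The identity `key` carries a factor `2c`, which is cancelled for `c ≠ 0`; the plane is
checked separately. The sign condition selects the upper sheet. -/
theorem mem_modelSurface_iff (c : ℝ) (m : Space) :
    m ∈ modelSurface c ↔ defect c m = 0 ∧ (0 < c → 0 < m.2) := by
  have h1 := two_mul_pole c
  have key : 2 * c * defect c m = - slope c / 2 * (2 * c * (‖m.1‖ ^ 2 +
      signature c * m.2 ^ 2 - signature c * (pole c).2 ^ 2)) + slope c * 0 := by
    have h2 := signature_mul_slope c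
    simp only [defect, ambientForm_eq, Prod.fst_sub, Prod.snd_sub, pole_fst, sub_zero,
      real_inner_self_eq_norm_sq]
    linear_combination (m.2 - (pole c).2) * h2 +
      ((m.2 - (pole c).2) * signature c * slope c) * h1
  rcases eq_or_ne c 0 with rfl | hc
  · simp [modelSurface, defect, slope, pole]
  have hs : slope c ≠ 0 := slope_eq_zero_iff.not.2 hc
  have h3 := pole_sq hc
  have : defect c m = 0 ↔ ‖m.1‖ ^ 2 + signature c * m.2 ^ 2 = -1 / (2 * c) := by
    have e1 : signature c * (pole c).2 ^ 2 = -1 / (2 * c) := by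
      rw [eq_div_iff (by simpa using hc)]; linarith
    have h4 : 2 * c ≠ 0 := by simpa using hc
    rw [e1] at key
    constructor
    · intro h
      rw [h, mul_zero, mul_zero, add_zero] at key
      have := (mul_eq_zero.1 key.symm).resolve_left
        (div_ne_zero (neg_ne_zero.2 hs) two_ne_zero)
      have := (mul_eq_zero.1 this).resolve_left h4
      linarith
    · intro h
      rw [h, sub_self] at key
      have : 2 * c * defect c m = 0 := by rw [key]; ring
      exact (mul_eq_zero.1 this).resolve_left h4
  rw [this]
  rcases lt_or_gt_of_ne hc with hc' | hc'
  · have e2 : -1 / (2 * c) = 1 / (-2 * c) := by rw [neg_mul, div_neg, neg_div]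
    simp only [modelSurface, hc', if_true, mem_ofPred_eq, signature, hc'.not_gt, if_false,
      one_mul, false_implies, and_true, e2]
  · simp only [modelSurface, hc', hc'.not_gt, hc'.ne', if_true, mem_ofPred_eq, signature, if_false,
      true_implies]
    rw [neg_one_mul, ← sub_eq_add_neg]

theorem ambientForm_normal_self {m : Space} (hm : m ∈ modelSurface c) :
    ambientForm c (normal c m) (normal c m) = signature c := by
  rw [ambientForm_normal_normal, ((mem_modelSurface_iff c m).1 hm).1]; ring

/-- The ambient form is positive definite on the tangent planes of the model surface. -/
theorem ambientForm_pos {m v : Space} (hm : m ∈ modelSurface c)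
    (hv : ambientForm c (normal c m) v = 0) (h0 : v ≠ 0) : 0 < ambientForm c v v := by
  have hv0 : v.1 = 0 → v.2 ≠ 0 := fun h1 h2 => h0 (Prod.ext h1 h2)
  rcases lt_or_ge 0 c with hc | hc
  · have hm' := ((mem_modelSurface_iff c m).1 hm).2 hc
    have hs : slope c ≠ 0 := slope_eq_zero_iff.not.2 hc.ne'
    have hB : ambientForm c m v = 0 := by
      have : ambientForm c ((2 * c) • m) v = 0 := by
        rw [← signature_smul_normal]; simp [hv]
      simpa [hc.ne'] using this
    have hmm : ‖m.1‖ ^ 2 - m.2 ^ 2 = -1 / (2 * c) := by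
      simpa [modelSurface, hc.not_gt, hc.ne', hm'] using hm
    have hlt : ‖m.1‖ ^ 2 < m.2 ^ 2 := by
      have : -1 / (2 * c) < 0 := div_neg_of_neg_of_pos (by norm_num) (by linarith)
      linarith
    have hsig : signature c = -1 := by simp [signature, hc]
    rw [ambientForm_eq, hsig] at hB ⊢
    rw [real_inner_self_eq_norm_sq]
    have hcs := abs_real_inner_le_norm m.1 v.1
    have e : ⟪m.1, v.1⟫ = m.2 * v.2 := by linarith
    rw [e] at hcs
    -- A vector orthogonal to the timelike `m` is spacelike: Cauchy-Schwarz in the horizontal plane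
    -- gives `m.2² v.2² ≤ |m.1|² |v.1|²`, and `|m.1| < m.2`.
    have hsq : (m.2 * v.2) ^ 2 ≤ ‖m.1‖ ^ 2 * ‖v.1‖ ^ 2 := by
      rw [← sq_abs, ← mul_pow]
      exact pow_le_pow_left₀ (abs_nonneg _) hcs 2
    by_cases h1 : v.1 = 0
    · exfalso
      rw [h1, inner_zero_right] at e
      rcases mul_eq_zero.1 e.symm with h | h
      · exact hm'.ne' h
      · exact hv0 h1 h
    · have hp : 0 < ‖v.1‖ ^ 2 := by have := norm_pos_iff.2 h1; positivity
      have h2 : m.2 ^ 2 * v.2 ^ 2 < m.2 ^ 2 * ‖v.1‖ ^ 2 := by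
        rw [← mul_pow]
        exact hsq.trans_lt (mul_lt_mul_of_pos_right hlt hp)
      have := lt_of_mul_lt_mul_left h2 (sq_nonneg _)
      linarith
  · have hsig : signature c = 1 := by simp [signature, hc.not_gt]
    rw [ambientForm_eq, hsig, real_inner_self_eq_norm_sq]
    by_cases h1 : v.1 = 0
    · have := hv0 h1
      have : 0 < v.2 * v.2 := mul_self_pos.2 this
      have := sq_nonneg ‖v.1‖
      linarith
    · have : 0 < ‖v.1‖ ^ 2 := by have := norm_pos_iff.2 h1; positivity
      have := mul_self_nonneg v.2
      linarith

theorem ambientForm_injective (c : ℝ) : Function.Injective (ambientForm c) := by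
  rw [injective_iff_map_eq_zero]
  intro a ha
  have h1 := DFunLike.congr_fun ha ((a.1, 0) : Space)
  have h2 := DFunLike.congr_fun ha ((0, 1) : Space)
  simp only [ambientForm_eq, mul_zero, add_zero, zero_apply,
    inner_self_eq_zero, inner_zero_right, mul_one, zero_add] at h1 h2
  exact Prod.ext h1 ((mul_eq_zero.1 h2).resolve_left (signature_ne_zero c))

theorem finrank_space : Module.finrank ℝ Space = 3 := by
  rw [Module.finrank_prod, finrank_euclideanSpace_fin, Module.finrank_self]

theorem finrank_dual : Module.finrank ℝ (Space →L[ℝ] ℝ) = 3 := by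
  rw [(LinearMap.toContinuousLinearMap (𝕜 := ℝ) (E := Space) (F' := ℝ)).symm.finrank_eq,
    Module.finrank_linearMap, finrank_space, Module.finrank_self]

theorem finrank_phase : Module.finrank ℝ Phase = 6 := by
  rw [Module.finrank_prod, finrank_space, finrank_dual]

/-- The identification of vectors with covectors defined by `ambientForm c`. -/
def lower (c : ℝ) : Space ≃L[ℝ] (Space →L[ℝ] ℝ) :=
  (LinearEquiv.ofInjectiveOfFinrankEq (ambientForm c : Space →ₗ[ℝ] (Space →L[ℝ] ℝ))
    (ambientForm_injective c) (by rw [finrank_space, finrank_dual])).toContinuousLinearEquiv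

theorem lower_apply (v : Space) : lower c v = ambientForm c v := rfl

theorem ambientForm_lower_symm (ξ : Space →L[ℝ] ℝ) : ambientForm c ((lower c).symm ξ) = ξ := by
  rw [← lower_apply, ContinuousLinearEquiv.apply_symm_apply]

theorem lower_symm_ambientForm (v : Space) : (lower c).symm (ambientForm c v) = v := by
  rw [← lower_apply, ContinuousLinearEquiv.symm_apply_apply]

theorem apply_lower_symm (ξ η : Space →L[ℝ] ℝ) :
    ξ ((lower c).symm η) = η ((lower c).symm ξ) := by
  rw [← ambientForm_lower_symm (c := c) ξ, ambientForm_comm, ambientForm_lower_symm,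
    lower_symm_ambientForm]

/-- The tangential component with respect to the splitting of the ambient space into the tangent
plane and the normal line. -/
theorem ambientForm_normal_sub {m : Space} (hm : m ∈ modelSurface c) (v : Space) :
    ambientForm c (normal c m)
      (v - (signature c * ambientForm c (normal c m) v) • normal c m) = 0 := by
  rw [map_sub, map_smul, ambientForm_normal_self hm, smul_eq_mul]
  linear_combination (-ambientForm c (normal c m) v) * signature_mul_self c

end Ambient

end KeplerEuler

end

noncomputable section

namespace KeplerEuler

/-! ### Regular level sets -/

section LevelSets

variable {V W : Type*} [NormedAddCommGroup V] [NormedSpace ℝ V] [FiniteDimensional ℝ V]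
  [NormedAddCommGroup W] [NormedSpace ℝ W]

/-- A smooth map that is completed by a linear map to a local diffeomorphism at `q` yields a chart
of its zero set. -/
theorem exists_chart_of_prod {S U : Set V} {n : ℕ} {F : V → W} {q : V} (hU : IsOpen U)
    (hS : ∀ p ∈ U, p ∈ S ↔ F p = 0) (hqU : q ∈ U) (hF : ContDiff ℝ ∞ F) (L : V →L[ℝ] Coord n)
    (A : V ≃L[ℝ] W × Coord n) (hA : (A : V →L[ℝ] W × Coord n) = (fderiv ℝ F q).prod L) :
    ∃ φ : Chart S n, q ∈ φ.target ∧ φ.invFun = L ∧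
      ∀ x ∈ φ.source, F (φ.toFun x) = 0 ∧ L (φ.toFun x) = x := by
  set Φ : V → W × Coord n := fun p => (F p, L p) with hΦ
  have hΦs : ContDiff ℝ ∞ Φ := hF.prodMk L.contDiff
  have hΦd : ∀ p, HasFDerivAt Φ ((fderiv ℝ F p).prod L) p := fun p =>
    ((hF.differentiable (by simp)) p).hasFDerivAt.prodMk L.hasFDerivAt
  have hq : HasFDerivAt Φ (A : V →L[ℝ] W × Coord n) q := by rw [hA]; exact hΦd q
  set e := (hΦs.contDiffAt (x := q)).toOpenPartialHomeomorph Φ hq (by simp) with he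
  have hcoe : (e : V → W × Coord n) = Φ := rfl
  have hqe : q ∈ e.source := (hΦs.contDiffAt (x := q)).mem_toOpenPartialHomeomorph_source hq _
  -- Keeping only points where the derivative is invertible makes the local inverse smooth on its
  -- whole domain, not merely at the image of `q`.
  set O : Set V := U ∩ {p | fderiv ℝ Φ p ∈ range
    ((↑) : (V ≃L[ℝ] W × Coord n) → V →L[ℝ] W × Coord n)} with hO
  have hOo : IsOpen O := hU.inter
    (ContinuousLinearEquiv.isOpen.preimage (hΦs.continuous_fderiv (by simp)))
  have hqO : q ∈ O := ⟨hqU, A, hq.fderiv.symm⟩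
  set e' := e.restrOpen O hOo with he'
  have hsrc : e'.source = e.source ∩ O := rfl
  have hcoe' : (e' : V → W × Coord n) = Φ := rfl
  have hker : ∀ x, ((0 : W), x) ∈ e'.target →
      F (e'.symm (0, x)) = 0 ∧ L (e'.symm (0, x)) = x := fun x hx => by
    have := e'.right_inv hx
    rw [hcoe'] at this
    exact ⟨congrArg Prod.fst this, congrArg Prod.snd this⟩
  have hmem : ∀ x, ((0 : W), x) ∈ e'.target → e'.symm (0, x) ∈ e'.source := fun x hx =>
    e'.map_target hx
  have hinv : ∀ p ∈ S ∩ e'.source, ((0 : W), L p) = e' p := fun p hp => by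
    rw [hcoe']
    exact Prod.ext ((hS p hp.2.2.1).1 hp.1).symm rfl
  refine ⟨{
    toFun := fun x => e'.symm (0, x)
    invFun := L
    source := (fun x => ((0 : W), x)) ⁻¹' e'.target
    target := e'.source
    isOpen_source := e'.open_target.preimage (by fun_prop)
    isOpen_target := e'.open_source
    contDiffOn_toFun := ?_
    contDiffOn_invFun := L.contDiff.contDiffOn
    toFun_mem := fun x hx => ⟨(hS _ (hmem x hx).2.1).2 (hker x hx).1, hmem x hx⟩
    invFun_mem := fun p hp => ?_
    left_inv := fun x hx => (hker x hx).2
    right_inv := fun p hp => ?_ }, ⟨hqe, hqO⟩, rfl, hker⟩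
  · intro x hx
    obtain ⟨A', hA'⟩ := (hmem x hx).2.2
    have h1 : ContDiffAt ℝ ∞ e'.symm ((0 : W), x) := by
      refine e'.contDiffAt_symm (f₀' := A') hx ?_ hΦs.contDiffAt
      rw [hcoe', hA']
      exact (hΦs.differentiable (by simp) _).hasFDerivAt
    have h2 : ContDiffAt ℝ ∞ (fun y : Coord n => ((0 : W), y)) x := by fun_prop
    exact (h1.comp x h2).contDiffWithinAt
  · change ((0 : W), L p) ∈ e'.target
    rw [hinv p hp]
    exact e'.map_source hp.2
  · rw [hinv p hp]
    exact e'.left_inv hp.2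

variable [FiniteDimensional ℝ W]

/-- Take for `L` a left inverse of a linear parametrization of the kernel of `T`: it is injective on
that kernel, so `T.prod L` is injective, and the dimensions agree. -/
theorem exists_complement {n : ℕ} (T : V →L[ℝ] W) (hT : Function.Surjective T)
    (hdim : Module.finrank ℝ V = n + Module.finrank ℝ W) :
    ∃ (L : V →L[ℝ] Coord n) (A : V ≃L[ℝ] W × Coord n),
      (A : V →L[ℝ] W × Coord n) = T.prod L := by
  have hk : Module.finrank ℝ (LinearMap.ker (T : V →ₗ[ℝ] W)) = n := by
    have h1 := LinearMap.finrank_range_add_finrank_ker (T : V →ₗ[ℝ] W)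
    rw [LinearMap.range_eq_top.2 hT, finrank_top] at h1
    omega
  let i : Coord n ≃ₗ[ℝ] LinearMap.ker (T : V →ₗ[ℝ] W) :=
    LinearEquiv.ofFinrankEq _ _ (by rw [hk, finrank_euclideanSpace_fin])
  let j : Coord n →ₗ[ℝ] V := (LinearMap.ker (T : V →ₗ[ℝ] W)).subtype ∘ₗ i.toLinearMap
  obtain ⟨L, hL⟩ := LinearMap.exists_leftInverse_of_injective j
    (LinearMap.ker_eq_bot.2 (Subtype.val_injective.comp i.injective))
  have hinj : Function.Injective ((T : V →ₗ[ℝ] W).prod L) := by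
    rw [← LinearMap.ker_eq_bot, LinearMap.ker_eq_bot']
    intro v hv
    have h1 : T v = 0 := congrArg Prod.fst hv
    have h2 : L v = 0 := congrArg Prod.snd hv
    have h3 : j (i.symm ⟨v, h1⟩) = v := by simp [j]
    have h4 : L (j (i.symm ⟨v, h1⟩)) = i.symm ⟨v, h1⟩ := LinearMap.congr_fun hL _
    rw [h3, h2] at h4
    rw [← h3, ← h4, map_zero]
  refine ⟨L.toContinuousLinearMap, (LinearEquiv.ofInjectiveOfFinrankEq _ hinj
    ?_).toContinuousLinearEquiv, ?_⟩
  · rw [hdim, Module.finrank_prod, finrank_euclideanSpace_fin, add_comm]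
  · ext v <;> rfl

/-- A regular level set has charts, and its tangent vectors are the kernel of the derivative. -/
theorem exists_chart_of_levelSet {S U : Set V} {n : ℕ} {F : V → W} {q : V} (hU : IsOpen U)
    (hS : ∀ p ∈ U, p ∈ S ↔ F p = 0) (hqU : q ∈ U) (hF : ContDiff ℝ ∞ F)
    (hT : Function.Surjective (fderiv ℝ F q))
    (hdim : Module.finrank ℝ V = n + Module.finrank ℝ W) : ∃ φ : Chart S n, q ∈ φ.target := by
  obtain ⟨L, A, hA⟩ := exists_complement _ hT hdim
  obtain ⟨φ, h, -⟩ := exists_chart_of_prod hU hS hqU hF L A hA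
  exact ⟨φ, h⟩

/-- `F` is constant along curves in `S`, which gives one inclusion. For the other, follow the line
with direction `L v` in the coordinates `L` of the level set: its velocity has the same image as `v`
under `fderiv ℝ F q` and under `L`, and these two maps together are injective. -/
theorem tangentVectors_eq_of_levelSet {S U : Set V} {F : V → W} {q : V}
    (hU : IsOpen U) (hS : ∀ p ∈ U, p ∈ S ↔ F p = 0) (hqU : q ∈ U) (hqS : q ∈ S)
    (hF : ContDiff ℝ ∞ F) (hT : Function.Surjective (fderiv ℝ F q)) :
    tangentVectors S q = {v | fderiv ℝ F q v = 0} := by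
  have hFd : Differentiable ℝ F := hF.differentiable (by simp)
  ext v
  constructor
  · rintro ⟨γ, rfl, h1, h2⟩
    have h3 : HasDerivAt (F ∘ γ) (fderiv ℝ F (γ 0) v) 0 :=
      (hFd (γ 0)).hasFDerivAt.comp_hasDerivAt 0 h2
    have h4 : F ∘ γ =ᶠ[𝓝 0] fun _ => 0 := by
      filter_upwards [h1, h2.continuousAt.preimage_mem_nhds (hU.mem_nhds hqU)] with t ht ht'
      exact (hS _ ht').1 ht
    exact h3.unique ((hasDerivAt_const (0 : ℝ) (0 : W)).congr_of_eventuallyEq h4)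
  · intro hv
    have hd : Module.finrank ℝ W ≤ Module.finrank ℝ V :=
      LinearMap.finrank_le_finrank_of_surjective (f := (fderiv ℝ F q : V →ₗ[ℝ] W)) hT
    obtain ⟨L, A, hA⟩ := exists_complement (n := Module.finrank ℝ V - Module.finrank ℝ W) _ hT
      (by omega)
    obtain ⟨φ, h1, h2, h3⟩ := exists_chart_of_prod hU hS hqU hF L A hA
    have hx : L q ∈ φ.source := by rw [← h2]; exact φ.invFun_mem q ⟨hqS, h1⟩
    have hφq : φ.toFun (L q) = q := by rw [← h2]; exact φ.right_inv q ⟨hqS, h1⟩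
    have hev : ∀ᶠ t : ℝ in 𝓝 0, L q + t • L v ∈ φ.source := by
      have : Filter.Tendsto (fun t : ℝ => L q + t • L v) (𝓝 0) (𝓝 (L q)) := by
        have : Continuous (fun t : ℝ => L q + t • L v) := by fun_prop
        simpa using this.tendsto 0
      exact this (φ.isOpen_source.mem_nhds hx)
    have hφd : HasFDerivAt φ.toFun (fderiv ℝ φ.toFun (L q)) (L q) :=
      ((φ.contDiffOn_toFun.contDiffAt (φ.isOpen_source.mem_nhds hx)).differentiableAt
        (by simp)).hasFDerivAt
    have hF0 : ∀ b, fderiv ℝ F q (fderiv ℝ φ.toFun (L q) b) = 0 := fun b => by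
      have h4 : HasFDerivAt (F ∘ φ.toFun) ((fderiv ℝ F q).comp (fderiv ℝ φ.toFun (L q))) (L q) := by
        have := (hFd q).hasFDerivAt
        rw [← hφq] at this
        have := this.comp (L q) hφd
        rwa [hφq] at this
      have h5 : F ∘ φ.toFun =ᶠ[𝓝 (L q)] fun _ => 0 := by
        filter_upwards [φ.isOpen_source.mem_nhds hx] with y hy using (h3 y hy).1
      have := h4.unique ((hasFDerivAt_const (0 : W) (L q)).congr_of_eventuallyEq h5)
      exact DFunLike.congr_fun this b
    have hL0 : ∀ b, L (fderiv ℝ φ.toFun (L q) b) = b := fun b => by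
      have h4 : HasFDerivAt (L ∘ φ.toFun) (L.comp (fderiv ℝ φ.toFun (L q))) (L q) :=
        L.hasFDerivAt.comp (L q) hφd
      have h5 : L ∘ φ.toFun =ᶠ[𝓝 (L q)] id := by
        filter_upwards [φ.isOpen_source.mem_nhds hx] with y hy using (h3 y hy).2
      have := h4.unique ((hasFDerivAt_id (L q)).congr_of_eventuallyEq h5)
      exact DFunLike.congr_fun this b
    have hveq : fderiv ℝ φ.toFun (L q) (L v) = v := by
      apply A.injective
      have hA' : ∀ u, A u = (fderiv ℝ F q u, L u) := fun u => DFunLike.congr_fun hA u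
      rw [hA', hA', hF0, hL0, hv]
    refine ⟨fun t => φ.toFun (L q + t • L v), by simp [hφq], ?_, ?_⟩
    · filter_upwards [hev] with t ht using (φ.toFun_mem _ ht).1
    · have h6 : HasDerivAt (fun t : ℝ => L q + t • L v) (L v) 0 := by
        simpa using ((hasDerivAt_id (0 : ℝ)).smul_const (L v)).const_add (L q)
      have h7 : HasFDerivAt φ.toFun (fderiv ℝ φ.toFun (L q)) (L q + (0 : ℝ) • L v) := by
        simpa using hφd
      have := h7.comp_hasDerivAt 0 h6
      rwa [hveq] at this

end LevelSets

/-! ### Calculus in charts -/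

namespace Chart

variable {V : Type*} [NormedAddCommGroup V] [NormedSpace ℝ V] {S : Set V} {n : ℕ}
  (φ : Chart S n) {x : Coord n}

theorem source_mem_nhds (hx : x ∈ φ.source) : φ.source ∈ 𝓝 x := φ.isOpen_source.mem_nhds hx

theorem contDiffAt_toFun (hx : x ∈ φ.source) : ContDiffAt ℝ ∞ φ.toFun x :=
  φ.contDiffOn_toFun.contDiffAt (φ.source_mem_nhds hx)

theorem hasFDerivAt_toFun (hx : x ∈ φ.source) :
    HasFDerivAt φ.toFun (fderiv ℝ φ.toFun x) x :=
  ((φ.contDiffAt_toFun hx).differentiableAt (by simp)).hasFDerivAt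

theorem contDiffAt_invFun {q : V} (hq : q ∈ φ.target) : ContDiffAt ℝ ∞ φ.invFun q :=
  φ.contDiffOn_invFun.contDiffAt (φ.isOpen_target.mem_nhds hq)

theorem hasFDerivAt_invFun {q : V} (hq : q ∈ φ.target) :
    HasFDerivAt φ.invFun (fderiv ℝ φ.invFun q) q :=
  ((φ.contDiffAt_invFun hq).differentiableAt (by simp)).hasFDerivAt

theorem mem (hx : x ∈ φ.source) : φ.toFun x ∈ S := (φ.toFun_mem x hx).1

theorem mem_target (hx : x ∈ φ.source) : φ.toFun x ∈ φ.target := (φ.toFun_mem x hx).2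

theorem fderiv_invFun_fderiv_toFun (hx : x ∈ φ.source) (a : Coord n) :
    fderiv ℝ φ.invFun (φ.toFun x) (fderiv ℝ φ.toFun x a) = a := by
  have h1 := (φ.hasFDerivAt_invFun (φ.mem_target hx)).comp x (φ.hasFDerivAt_toFun hx)
  have h2 : φ.invFun ∘ φ.toFun =ᶠ[𝓝 x] id := by
    filter_upwards [φ.source_mem_nhds hx] with y hy using φ.left_inv y hy
  exact DFunLike.congr_fun (h1.unique ((hasFDerivAt_id x).congr_of_eventuallyEq h2)) a

theorem fderiv_toFun_injective (hx : x ∈ φ.source) :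
    Function.Injective (fderiv ℝ φ.toFun x) :=
  Function.LeftInverse.injective (φ.fderiv_invFun_fderiv_toFun hx)

theorem fderiv_toFun_mem (hx : x ∈ φ.source) (a : Coord n) :
    fderiv ℝ φ.toFun x a ∈ tangentVectors S (φ.toFun x) := by
  have h6 : HasDerivAt (fun t : ℝ => x + t • a) a 0 := by
    simpa using ((hasDerivAt_id (0 : ℝ)).smul_const a).const_add x
  refine ⟨fun t => φ.toFun (x + t • a), by simp, ?_, ?_⟩
  · have : Filter.Tendsto (fun t : ℝ => x + t • a) (𝓝 0) (𝓝 x) := by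
      simpa using h6.continuousAt.tendsto
    filter_upwards [this (φ.source_mem_nhds hx)] with t ht using φ.mem ht
  · have h7 : HasFDerivAt φ.toFun (fderiv ℝ φ.toFun x) (x + (0 : ℝ) • a) := by
      simpa using φ.hasFDerivAt_toFun hx
    exact h7.comp_hasDerivAt 0 h6

variable {E : Type*} [TopologicalSpace E]

/-- A map into `S` factors locally through the chart. -/
theorem eventually_right_inv {h : E → V} {z : E} (hh : ContinuousAt h z)
    (hS : ∀ᶠ y in 𝓝 z, h y ∈ S) (hz : h z ∈ φ.target) :
    ∀ᶠ y in 𝓝 z, h y ∈ φ.target ∧ φ.invFun (h y) ∈ φ.source ∧ φ.toFun (φ.invFun (h y)) = h y := by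
  filter_upwards [hS, hh.preimage_mem_nhds (φ.isOpen_target.mem_nhds hz)] with y h1 h2
  exact ⟨h2, φ.invFun_mem _ ⟨h1, h2⟩, φ.right_inv _ ⟨h1, h2⟩⟩

/-- The composition `φ.toFun ∘ φ.invFun` is the identity only on `S`, so the chain rule is applied
along a curve in `S` that represents `v`. -/
theorem fderiv_toFun_fderiv_invFun (hx : x ∈ φ.source) {v : V}
    (hv : v ∈ tangentVectors S (φ.toFun x)) :
    fderiv ℝ φ.toFun x (fderiv ℝ φ.invFun (φ.toFun x) v) = v := by
  obtain ⟨γ, h0, h1, h2⟩ := hv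
  have h3 := φ.hasFDerivAt_invFun (φ.mem_target hx)
  rw [← h0] at h3
  have h4 := h3.comp_hasDerivAt 0 h2
  have h5 : HasFDerivAt φ.toFun (fderiv ℝ φ.toFun x) ((φ.invFun ∘ γ) 0) := by
    simpa [h0, φ.left_inv x hx] using φ.hasFDerivAt_toFun hx
  have h6 := h5.comp_hasDerivAt 0 h4
  have h7 : γ =ᶠ[𝓝 0] φ.toFun ∘ φ.invFun ∘ γ := by
    filter_upwards [φ.eventually_right_inv h2.continuousAt h1 (h0 ▸ φ.mem_target hx)] with t ht
    exact ht.2.2.symm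
  rw [← h0]
  exact (h6.congr_of_eventuallyEq h7).unique h2

theorem tangentVectors_eq_range (hx : x ∈ φ.source) :
    tangentVectors S (φ.toFun x) = range (fderiv ℝ φ.toFun x) := by
  ext v
  constructor
  · exact fun hv => ⟨_, φ.fderiv_toFun_fderiv_invFun hx hv⟩
  · rintro ⟨a, rfl⟩; exact φ.fderiv_toFun_mem hx a

theorem fderiv_field {X : V → V} (hx : x ∈ φ.source)
    (hX : X (φ.toFun x) ∈ tangentVectors S (φ.toFun x)) :
    fderiv ℝ φ.toFun x (φ.field X x) = X (φ.toFun x) :=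
  φ.fderiv_toFun_fderiv_invFun hx hX

end Chart

/-! ### Maps defined on a submanifold -/

section Maps

variable {V : Type*} [NormedAddCommGroup V] [NormedSpace ℝ V] {S : Set V} {n : ℕ}
  {F : Type*} [NormedAddCommGroup F] [NormedSpace ℝ F]
  {E : Type*} [NormedAddCommGroup E] [NormedSpace ℝ E]

open Classical in
/-- The derivative at `q` of a map on the submanifold `S`, extended to the ambient space by means of
a local retraction. -/
def derivOn (S : Set V) (n : ℕ) (f : V → F) (q : V) : V →L[ℝ] F :=
  if h : ∃ φ : Chart S n, q ∈ φ.target then fderiv ℝ (f ∘ h.choose.toFun ∘ h.choose.invFun) q else 0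

/-- The chain rule for maps on a submanifold. -/
theorem SmoothOn.hasFDerivAt_comp {f : V → F} (hf : SmoothOn S n f) (hS : IsSubmanifold S n)
    {h : E → V} {h' : E →L[ℝ] V} {z : E} (hh : HasFDerivAt h h' z) (hm : ∀ᶠ y in 𝓝 z, h y ∈ S) :
    HasFDerivAt (f ∘ h) ((derivOn S n f (h z)).comp h') z := by
  have hex : ∃ φ : Chart S n, h z ∈ φ.target := hS _ hm.self_of_nhds
  rw [derivOn, dif_pos hex]
  have hφ := hex.choose_spec
  set φ := hex.choose
  have hev := φ.eventually_right_inv hh.continuousAt hm hφ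
  have h1 : DifferentiableAt ℝ (f ∘ φ.toFun ∘ φ.invFun) (h z) := by
    have h2 : DifferentiableAt ℝ (f ∘ φ.toFun) (φ.invFun (h z)) :=
      ((hf φ).contDiffAt (φ.source_mem_nhds hev.self_of_nhds.2.1)).differentiableAt (by simp)
    exact h2.comp (h z) (φ.hasFDerivAt_invFun hφ).differentiableAt
  refine (h1.hasFDerivAt.comp z hh).congr_of_eventuallyEq ?_
  filter_upwards [hev] with y hy
  simp only [Function.comp_apply, hy.2.2]

theorem SmoothOn.hasDerivAt_comp {f : V → F} (hf : SmoothOn S n f) (hS : IsSubmanifold S n)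
    {γ : ℝ → V} {v : V} {t : ℝ} (hh : HasDerivAt γ v t) (hm : ∀ᶠ y in 𝓝 t, γ y ∈ S) :
    HasDerivAt (f ∘ γ) (derivOn S n f (γ t) v) t := by
  have := (hf.hasFDerivAt_comp hS hh.hasFDerivAt hm).hasDerivAt
  simpa using this

theorem SmoothOn.contDiffAt_comp {f : V → F} (hf : SmoothOn S n f) (hS : IsSubmanifold S n)
    {h : E → V} {z : E} (hh : ContDiffAt ℝ ∞ h z) (hm : ∀ᶠ y in 𝓝 z, h y ∈ S) :
    ContDiffAt ℝ ∞ (f ∘ h) z := by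
  obtain ⟨φ, hφ⟩ := hS _ hm.self_of_nhds
  have hev := φ.eventually_right_inv hh.continuousAt hm hφ
  have h2 : ContDiffAt ℝ ∞ (f ∘ φ.toFun) (φ.invFun (h z)) :=
    (hf φ).contDiffAt (φ.source_mem_nhds hev.self_of_nhds.2.1)
  refine (h2.comp z ((φ.contDiffAt_invFun hφ).comp z hh)).congr_of_eventuallyEq ?_
  filter_upwards [hev] with y hy
  simp only [Function.comp_apply, hy.2.2]

/-- The restriction of a smooth map is smooth. -/
theorem ContDiff.smoothOn {f : V → F} (hf : ContDiff ℝ ∞ f) : SmoothOn S n f := fun φ =>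
  hf.comp_contDiffOn φ.contDiffOn_toFun

theorem fderiv_comp_toFun {f : V → F} (hf : SmoothOn S n f) (hS : IsSubmanifold S n)
    (φ : Chart S n) {x : Coord n} (hx : x ∈ φ.source) (a : Coord n) :
    fderiv ℝ (f ∘ φ.toFun) x a = derivOn S n f (φ.toFun x) (fderiv ℝ φ.toFun x a) := by
  have := hf.hasFDerivAt_comp hS (φ.hasFDerivAt_toFun hx)
    (by filter_upwards [φ.source_mem_nhds hx] with y hy using φ.mem hy)
  rw [this.fderiv]; rfl

theorem derivOn_mem {f : V → F} {S' : Set F} (hf : SmoothOn S n f) (hS : IsSubmanifold S n)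
    (hm : MapsTo f S S') {q v : V} (hv : v ∈ tangentVectors S q) :
    derivOn S n f q v ∈ tangentVectors S' (f q) := by
  obtain ⟨γ, rfl, h1, h2⟩ := hv
  refine ⟨f ∘ γ, rfl, ?_, hf.hasDerivAt_comp hS h2 h1⟩
  filter_upwards [h1] with t ht using hm ht

end Maps

end KeplerEuler

end

noncomputable section

namespace KeplerEuler

/-! ### The model surface and its unit cotangent bundle as level sets -/

section Models

variable {c : ℝ}

/-- This identifies `normal` as the gradient of `defect` with respect to the ambient form. -/
theorem hasFDerivAt_defect (c : ℝ) (m : Space) :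
    HasFDerivAt (defect c) (ambientForm c (normal c m)) m := by
  have h1 : HasFDerivAt (fun p : Space => p - pole c) (ContinuousLinearMap.id ℝ Space) m :=
    (hasFDerivAt_id m).sub_const _
  have h2 := h1.snd.sub (((ambientForm c).isBoundedBilinearMap.hasFDerivAt
    (m - pole c, m - pole c)).comp m (h1.prodMk h1) |>.const_mul (slope c / 2))
  refine h2.congr_fderiv ?_
  refine ContinuousLinearMap.ext fun v => ?_
  change v.2 - slope c / 2 * (ambientForm c (m - pole c) v + ambientForm c v (m - pole c)) = _
  rw [ambientForm_normal, ambientForm_comm c v]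
  ring

theorem contDiff_defect (c : ℝ) : ContDiff ℝ ∞ (defect c) := by
  have h1 : ContDiff ℝ ∞ (fun p : Space => p - pole c) := contDiff_id.sub contDiff_const
  have h2 : ContDiff ℝ ∞ (fun p : Space => ambientForm c (p - pole c)) :=
    (ambientForm c).contDiff.comp h1
  have h3 : ContDiff ℝ ∞ (fun p : Space => ambientForm c (p - pole c) (p - pole c)) :=
    h2.clm_apply h1
  exact h1.snd.sub (h3.const_smul (slope c / 2))

theorem hasFDerivAt_normal (c : ℝ) (m : Space) :
    HasFDerivAt (normal c) (-(slope c • ContinuousLinearMap.id ℝ Space)) m :=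
  (((hasFDerivAt_id m).sub_const (pole c)).const_smul (slope c)).const_sub _

theorem contDiff_normal (c : ℝ) : ContDiff ℝ ∞ (normal c) :=
  contDiff_const.sub ((contDiff_id.sub contDiff_const).const_smul (slope c))

/-- The region of the ambient space that contains the model surface as a level set. -/
def region (c : ℝ) : Set Space := {m | 0 < c → 0 < m.2}

theorem isOpen_region (c : ℝ) : IsOpen (region c) := by
  by_cases h : 0 < c
  · simp only [region, h, true_implies]
    exact isOpen_lt continuous_const continuous_snd
  · simp [region, h]

theorem mem_modelSurface_iff_of_region {m : Space} (hm : m ∈ region c) :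
    m ∈ modelSurface c ↔ defect c m = 0 := by
  rw [mem_modelSurface_iff]; exact and_iff_left hm

theorem region_of_mem {m : Space} (hm : m ∈ modelSurface c) : m ∈ region c :=
  ((mem_modelSurface_iff c m).1 hm).2

theorem surjective_fderiv_defect {m : Space} (hm : m ∈ modelSurface c) :
    Function.Surjective (fderiv ℝ (defect c) m) := fun r => by
  refine ⟨(r * signature c) • normal c m, ?_⟩
  rw [(hasFDerivAt_defect c m).fderiv, map_smul, ambientForm_normal_self hm, smul_eq_mul, mul_assoc,
    signature_mul_self, mul_one]

theorem isSubmanifold_modelSurface (c : ℝ) : IsSubmanifold (modelSurface c) 2 := fun q hq =>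
  exists_chart_of_levelSet (isOpen_region c) (fun _ => mem_modelSurface_iff_of_region)
    (region_of_mem hq) (contDiff_defect c) (surjective_fderiv_defect hq)
    (by rw [finrank_space, Module.finrank_self])

theorem mem_tangentVectors_modelSurface {m : Space} (hm : m ∈ modelSurface c) {v : Space} :
    v ∈ tangentVectors (modelSurface c) m ↔ ambientForm c (normal c m) v = 0 := by
  rw [tangentVectors_eq_of_levelSet (isOpen_region c) (fun _ => mem_modelSurface_iff_of_region)
    (region_of_mem hm) hm (contDiff_defect c) (surjective_fderiv_defect hm), mem_ofPred_eq,
    (hasFDerivAt_defect c m).fderiv]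

/-- A covector that vanishes on the normal line is `B(v, ·)` on the whole ambient space for its dual
tangent vector `v`, by splitting off the normal component of the argument. Hence the dual norm can
be computed with the ambient form, and the bundle becomes a level set of three functions. -/
theorem mem_modelBundle_iff (w : Phase) : w ∈ modelBundle c ↔
    w.1 ∈ modelSurface c ∧ w.2 (normal c w.1) = 0 ∧ w.2 ((lower c).symm w.2) = 1 := by
  obtain ⟨m, ξ⟩ := w
  constructor
  · rintro ⟨⟨hm, h1⟩, v, ⟨h2, h3⟩, h4⟩
    simp only at hm h1 h2 h3
    have hν : ξ (normal c m) = 0 := h1 _ fun v hv => (mem_tangentVectors_modelSurface hm).1 hv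
    have hv := (mem_tangentVectors_modelSurface hm).1 h2
    have hξ : ξ = ambientForm c v := by
      refine ContinuousLinearMap.ext fun p => ?_
      have h5 := h3 _ ((mem_tangentVectors_modelSurface hm).2 (ambientForm_normal_sub hm p))
      rw [map_sub, map_smul, hν, map_sub, map_smul, ambientForm_comm c v (normal c m), hv] at h5
      simpa using h5
    refine ⟨hm, hν, ?_⟩
    simp only
    rw [hξ, lower_symm_ambientForm, h4]
  · rintro ⟨hm, h1, h2⟩
    simp only at hm h1 h2
    have e : ∀ u, ξ u = ambientForm c ((lower c).symm ξ) u := fun u => by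
      rw [ambientForm_lower_symm]
    refine ⟨⟨hm, fun n hn => ?_⟩, (lower c).symm ξ, ⟨(mem_tangentVectors_modelSurface hm).2 ?_,
      fun u _ => e u⟩, by rw [← e]; exact h2⟩
    · simp only at hn ⊢
      rw [e, ambientForm_comm]
      apply hn
      rw [mem_tangentVectors_modelSurface hm, ambientForm_comm, ← e, h1]
    · rw [ambientForm_comm, ← e, h1]

theorem mk_mem_modelBundle_iff (m v : Space) : (m, ambientForm c v) ∈ modelBundle c ↔
    m ∈ modelSurface c ∧ ambientForm c (normal c m) v = 0 ∧ ambientForm c v v = 1 := by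
  rw [mem_modelBundle_iff, lower_symm_ambientForm, ambientForm_comm c (normal c m) v]

/-- The unit tangent vector dual to a point of the unit cotangent bundle. -/
theorem exists_dual {w : Phase} (hw : w ∈ modelBundle c) : ∃ v, w.2 = ambientForm c v ∧
    ambientForm c (normal c w.1) v = 0 ∧ ambientForm c v v = 1 := by
  refine ⟨(lower c).symm w.2, (ambientForm_lower_symm _).symm, ?_⟩
  have := (mem_modelBundle_iff w).1 hw
  rw [ambientForm_comm, ambientForm_lower_symm]
  exact this.2

/-- Defining functions of the unit cotangent bundle. -/
def bundleDefect (c : ℝ) (w : Phase) : ℝ × ℝ × ℝ :=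
  (defect c w.1, w.2 (normal c w.1), w.2 ((lower c).symm w.2) - 1)

theorem contDiff_bundleDefect (c : ℝ) : ContDiff ℝ ∞ (bundleDefect c) := by
  have h1 := (contDiff_defect c).comp (contDiff_fst (E := Space) (F := Space →L[ℝ] ℝ))
  have h2 := (contDiff_normal c).comp (contDiff_fst (E := Space) (F := Space →L[ℝ] ℝ))
  have h3 := (lower c).symm.contDiff.comp
    (contDiff_snd (𝕜 := ℝ) (n := ∞) (E := Space) (F := Space →L[ℝ] ℝ))
  exact h1.prodMk ((contDiff_snd.clm_apply h2).prodMk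
    ((contDiff_snd.clm_apply h3).sub contDiff_const))

theorem fderiv_bundleDefect (c : ℝ) (w t : Phase) : fderiv ℝ (bundleDefect c) w t =
    (ambientForm c (normal c w.1) t.1, t.2 (normal c w.1) - slope c * w.2 t.1,
      2 * t.2 ((lower c).symm w.2)) := by
  have h1 := (hasFDerivAt_defect c w.1).comp w (hasFDerivAt_fst (𝕜 := ℝ) (p := w))
  have h2 := (hasFDerivAt_normal c w.1).comp w (hasFDerivAt_fst (𝕜 := ℝ) (p := w))
  have h0 := hasFDerivAt_snd (𝕜 := ℝ) (p := w)
  have h3 := ((lower c).symm : (Space →L[ℝ] ℝ) →L[ℝ] Space).hasFDerivAt.comp w h0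
  have h := h1.prodMk ((h0.clm_apply h2).prodMk ((h0.clm_apply h3).sub_const 1))
  have h' : HasFDerivAt (bundleDefect c) _ w := h
  rw [h'.fderiv]
  refine Prod.ext rfl (Prod.ext ?_ ?_)
  · change w.2 (-(slope c • t.1)) + t.2 (normal c w.1) = _
    rw [map_neg, map_smul, smul_eq_mul]; ring
  · change w.2 ((lower c).symm t.2) + t.2 ((lower c).symm w.2) = _
    rw [apply_lower_symm]; ring

theorem mem_modelBundle_iff_of_region (w : Phase) (hw : w ∈ Prod.fst ⁻¹' region c) :
    w ∈ modelBundle c ↔ bundleDefect c w = 0 := by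
  rw [mem_modelBundle_iff, mem_modelSurface_iff_of_region hw, bundleDefect, Prod.mk_eq_zero,
    Prod.mk_eq_zero, sub_eq_zero]

theorem surjective_fderiv_bundleDefect {w : Phase} (hw : w ∈ modelBundle c) :
    Function.Surjective (fderiv ℝ (bundleDefect c) w) := by
  rintro ⟨x, y, z⟩
  obtain ⟨v, h1, h2, h3⟩ := exists_dual hw
  have hm := ambientForm_normal_self ((mem_modelBundle_iff w).1 hw).1
  have hs := signature_mul_self c
  -- Moving the base point along the normal changes the first function only; the covectors dual to
  -- the normal and to `v` then adjust the other two. The factor `1/2` compensates the derivative of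
  -- the quadratic norm.
  refine ⟨((x * signature c) • normal c w.1,
    (y * signature c) • ambientForm c (normal c w.1) + (z / 2) • ambientForm c v), ?_⟩
  have h2' : ambientForm c v (normal c w.1) = 0 := by rw [ambientForm_comm, h2]
  rw [fderiv_bundleDefect, h1, lower_symm_ambientForm]
  simp only [map_smul, add_apply, smul_apply, hm, h2, h3, h2', smul_eq_mul, mul_zero, add_zero,
    sub_zero, zero_add, mul_one, mul_assoc, hs]
  congr 2; ring

theorem isSubmanifold_modelBundle (c : ℝ) : IsSubmanifold (modelBundle c) 3 := fun q hq =>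
  exists_chart_of_levelSet ((isOpen_region c).preimage continuous_fst)
    mem_modelBundle_iff_of_region (region_of_mem ((mem_modelBundle_iff q).1 hq).1)
    (contDiff_bundleDefect c) (surjective_fderiv_bundleDefect hq)
    (by rw [finrank_phase, Module.finrank_prod, Module.finrank_prod, Module.finrank_self])

/-- The middle condition comes from differentiating `ξ(normal) = 0`: the second fundamental form
prescribes the normal component of the covector velocity in terms of `ξ(a)`. The correction term of
`sasaki` rests on this. -/
theorem mem_tangentVectors_modelBundle {w t : Phase} (hw : w ∈ modelBundle c) :
    t ∈ tangentVectors (modelBundle c) w ↔ ambientForm c (normal c w.1) t.1 = 0 ∧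
      t.2 (normal c w.1) = slope c * w.2 t.1 ∧ t.2 ((lower c).symm w.2) = 0 := by
  rw [tangentVectors_eq_of_levelSet ((isOpen_region c).preimage continuous_fst)
    mem_modelBundle_iff_of_region (region_of_mem ((mem_modelBundle_iff w).1 hw).1) hw
    (contDiff_bundleDefect c) (surjective_fderiv_bundleDefect hw), mem_ofPred_eq,
    fderiv_bundleDefect, Prod.mk_eq_zero, Prod.mk_eq_zero, sub_eq_zero]
  simp

/-- A unit tangent vector is completed to an orthonormal frame. -/
theorem exists_frame {m v : Space} (hm : m ∈ modelSurface c)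
    (hv : ambientForm c (normal c m) v = 0) (hvv : ambientForm c v v = 1) :
    ∃ n, ambientForm c (normal c m) n = 0 ∧ ambientForm c v n = 0 ∧ ambientForm c n n = 1 ∧
      ∀ p, p = (signature c * ambientForm c (normal c m) p) • normal c m
        + ambientForm c v p • v + ambientForm c n p • n := by
  -- Two linear functionals on a three-dimensional space have a common nonzero zero. It is tangent
  -- to the surface, hence of positive length, and can be normalized.
  obtain ⟨n₀, hn₀, h0⟩ : ∃ n₀ : Space, (ambientForm c (normal c m)).prod (ambientForm c v) n₀ = 0 ∧
      n₀ ≠ 0 := by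
    by_contra! h
    have : Function.Injective ((ambientForm c (normal c m)).prod (ambientForm c v) :
        Space →ₗ[ℝ] ℝ × ℝ) := by
      rw [← LinearMap.ker_eq_bot, LinearMap.ker_eq_bot']
      exact h
    have := LinearMap.finrank_le_finrank_of_injective this
    rw [finrank_space, Module.finrank_prod, Module.finrank_self] at this
    omega
  have h1 : ambientForm c (normal c m) n₀ = 0 := congrArg Prod.fst hn₀
  have h2 : ambientForm c v n₀ = 0 := congrArg Prod.snd hn₀
  have h3 := ambientForm_pos hm h1 h0
  set r := √(ambientForm c n₀ n₀) with hr
  have hr0 : r ≠ 0 := (Real.sqrt_pos.2 h3).ne'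
  have hrr : r * r = ambientForm c n₀ n₀ := Real.mul_self_sqrt h3.le
  obtain ⟨n, hn1, hn2, hn3⟩ : ∃ n, ambientForm c (normal c m) n = 0 ∧ ambientForm c v n = 0 ∧
      ambientForm c n n = 1 := by
    refine ⟨r⁻¹ • n₀, ?_, ?_, ?_⟩
    · rw [map_smul, h1, smul_zero]
    · rw [map_smul, h2, smul_zero]
    · simp only [map_smul, smul_apply, smul_eq_mul, ← hrr]
      field_simp
  refine ⟨n, hn1, hn2, hn3, ?_⟩
  have hνν := ambientForm_normal_self hm
  have hs := signature_mul_self c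
  have hv' : ambientForm c v (normal c m) = 0 := by rw [ambientForm_comm, hv]
  have hn1' : ambientForm c n (normal c m) = 0 := by rw [ambientForm_comm, hn1]
  have hn2' : ambientForm c n v = 0 := by rw [ambientForm_comm, hn2]
  let T : Space →ₗ[ℝ] ℝ × ℝ × ℝ := ((ambientForm c (normal c m)).prod
    ((ambientForm c v).prod (ambientForm c n)) : Space →L[ℝ] ℝ × ℝ × ℝ)
  have hT : ∀ p, T p = (ambientForm c (normal c m) p, ambientForm c v p, ambientForm c n p) :=
    fun _ => rfl
  have hTs : Function.Surjective T := by
    rintro ⟨x, y, z⟩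
    refine ⟨(x * signature c) • normal c m + y • v + z • n, ?_⟩
    simp only [hT, map_add, map_smul, hνν, hv, hn1, hv', hvv, hn2, hn1', hn2', hn3, smul_eq_mul,
      mul_zero, add_zero, zero_add, mul_one, mul_assoc, hs]
  have hTi : Function.Injective T := (LinearMap.injective_iff_surjective_of_finrank_eq_finrank
    (by rw [finrank_space, Module.finrank_prod, Module.finrank_prod, Module.finrank_self])).2 hTs
  intro p
  apply hTi
  simp only [hT, map_add, map_smul, hνν, hv, hn1, hv', hvv, hn2, hn1', hn2', hn3, smul_eq_mul,
    mul_zero, add_zero, zero_add, mul_one]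
  rw [mul_comm (signature c), mul_assoc, hs, mul_one]

end Models

end KeplerEuler

end

noncomputable section

namespace KeplerEuler

/-! ### Parametrized pieces of the model surface -/

theorem minSmoothness_two_le : minSmoothness ℝ 2 ≤ (∞ : WithTop ℕ∞) := by
  rw [minSmoothness_of_isRCLikeNormedField]
  exact WithTop.coe_le_coe.2 (le_top : (2 : ℕ∞) ≤ ⊤)

/-! ### Pullback and inversion of bilinear forms depending on a parameter. -/

section Bilinear

variable {E V : Type*} [NormedAddCommGroup E] [NormedSpace ℝ E] [NormedAddCommGroup V]
  [NormedSpace ℝ V] {P : Type*} [NormedAddCommGroup P] [NormedSpace ℝ P] {k : WithTop ℕ∞}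

theorem _root_.ContDiffAt.bilinearComp_self {G : P → V →L[ℝ] V →L[ℝ] ℝ} {A : P → E →L[ℝ] V} {x : P}
    (hG : ContDiffAt ℝ k G x) (hA : ContDiffAt ℝ k A x) :
    ContDiffAt ℝ k (fun y => (G y).bilinearComp (A y) (A y)) x := by
  have h1 : ContDiffAt ℝ k (fun y => (G y).comp (A y)) x := hG.clm_comp hA
  have h2 : ContDiffAt ℝ k (fun y => ((G y).comp (A y)).flip) x :=
    (ContinuousLinearMap.flipₗᵢ ℝ E V ℝ).toContinuousLinearEquiv.contDiff.contDiffAt.comp x h1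
  have h3 : ContDiffAt ℝ k (fun y => (((G y).comp (A y)).flip).comp (A y)) x := h2.clm_comp hA
  exact (ContinuousLinearMap.flipₗᵢ ℝ E E ℝ).toContinuousLinearEquiv.contDiff.contDiffAt.comp x h3

theorem inverse_apply_self [FiniteDimensional ℝ E] {g : E →L[ℝ] E →L[ℝ] ℝ}
    (hg : Function.Injective g) (a : E) : g.inverse (g a) = a := by
  let e : E ≃L[ℝ] (E →L[ℝ] ℝ) := (LinearEquiv.ofInjectiveOfFinrankEq (g : E →ₗ[ℝ] (E →L[ℝ] ℝ)) hg
    (by rw [(LinearMap.toContinuousLinearMap (𝕜 := ℝ) (E := E) (F' := ℝ)).symm.finrank_eq,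
      Module.finrank_linearMap, Module.finrank_self, mul_one])).toContinuousLinearEquiv
  have he : (e : E →L[ℝ] (E →L[ℝ] ℝ)) = g := rfl
  rw [← he, ContinuousLinearMap.inverse_equiv]
  exact e.symm_apply_apply a

theorem apply_inverse_self [FiniteDimensional ℝ E] {g : E →L[ℝ] E →L[ℝ] ℝ}
    (hg : Function.Injective g) (y : E →L[ℝ] ℝ) : g (g.inverse y) = y := by
  let e : E ≃L[ℝ] (E →L[ℝ] ℝ) := (LinearEquiv.ofInjectiveOfFinrankEq (g : E →ₗ[ℝ] (E →L[ℝ] ℝ)) hg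
    (by rw [(LinearMap.toContinuousLinearMap (𝕜 := ℝ) (E := E) (F' := ℝ)).symm.finrank_eq,
      Module.finrank_linearMap, Module.finrank_self, mul_one])).toContinuousLinearEquiv
  have he : (e : E →L[ℝ] (E →L[ℝ] ℝ)) = g := rfl
  rw [← he, ContinuousLinearMap.inverse_equiv]
  exact e.apply_symm_apply y

theorem _root_.ContDiffAt.clm_inverse [FiniteDimensional ℝ E] {g : P → E →L[ℝ] E →L[ℝ] ℝ}
    {x : P} (hg : ContDiffAt ℝ k g x) (hi : Function.Injective (g x)) :
    ContDiffAt ℝ k (fun y => (g y).inverse) x := by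
  let e : E ≃L[ℝ] (E →L[ℝ] ℝ) := (LinearEquiv.ofInjectiveOfFinrankEq
    (g x : E →ₗ[ℝ] (E →L[ℝ] ℝ)) hi
    (by rw [(LinearMap.toContinuousLinearMap (𝕜 := ℝ) (E := E) (F' := ℝ)).symm.finrank_eq,
      Module.finrank_linearMap, Module.finrank_self, mul_one])).toContinuousLinearEquiv
  have he : (e : E →L[ℝ] (E →L[ℝ] ℝ)) = g x := rfl
  have : CompleteSpace E := FiniteDimensional.complete ℝ E
  have h := contDiffAt_map_inverse (𝕜 := ℝ) (n := k) e
  rw [he] at h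
  exact h.comp x hg

end Bilinear

/-- `h` is a smooth immersion of the open set `U` into the model surface. -/
structure IsParametrization (c : ℝ) (h : Coord 2 → Space) (U : Set (Coord 2)) : Prop where
  isOpen : IsOpen U
  contDiffOn : ContDiffOn ℝ ∞ h U
  mem : ∀ x ∈ U, h x ∈ modelSurface c
  injective : ∀ x ∈ U, Function.Injective (fderiv ℝ h x)

/-- The metric induced by a parametrization. -/
def inducedMetric (c : ℝ) (h : Coord 2 → Space) (x : Coord 2) : Coord 2 →L[ℝ] Coord 2 →L[ℝ] ℝ :=
  (ambientForm c).bilinearComp (fderiv ℝ h x) (fderiv ℝ h x)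

theorem inducedMetric_apply (c : ℝ) (h : Coord 2 → Space) (x a b : Coord 2) :
    inducedMetric c h x a b = ambientForm c (fderiv ℝ h x a) (fderiv ℝ h x b) := rfl

theorem inducedMetric_comm (c : ℝ) (h : Coord 2 → Space) (x a b : Coord 2) :
    inducedMetric c h x a b = inducedMetric c h x b a := ambientForm_comm _ _ _

theorem Chart.isParametrization {c : ℝ} (φ : Chart (modelSurface c) 2) :
    IsParametrization c φ.toFun φ.source where
  isOpen := φ.isOpen_source
  contDiffOn := φ.contDiffOn_toFun
  mem _ hx := φ.mem hx
  injective _ hx := φ.fderiv_toFun_injective hx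

theorem Chart.metric_eq {c : ℝ} (φ : Chart (modelSurface c) 2) :
    φ.metric (fun _ => ambientForm c) = inducedMetric c φ.toFun := rfl

namespace IsParametrization

variable {c : ℝ} {h : Coord 2 → Space} {U : Set (Coord 2)} {x : Coord 2}

theorem contDiffAt (hp : IsParametrization c h U) (hx : x ∈ U) : ContDiffAt ℝ ∞ h x :=
  hp.contDiffOn.contDiffAt (hp.isOpen.mem_nhds hx)

theorem hasFDerivAt (hp : IsParametrization c h U) (hx : x ∈ U) :
    HasFDerivAt h (fderiv ℝ h x) x :=
  ((hp.contDiffAt hx).differentiableAt (by simp)).hasFDerivAt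

theorem contDiffAt_fderiv (hp : IsParametrization c h U) (hx : x ∈ U) :
    ContDiffAt ℝ ∞ (fderiv ℝ h) x := (hp.contDiffAt hx).fderiv_right (by simp)

theorem hasFDerivAt_fderiv (hp : IsParametrization c h U) (hx : x ∈ U) :
    HasFDerivAt (fderiv ℝ h) (fderiv ℝ (fderiv ℝ h) x) x :=
  ((hp.contDiffAt_fderiv hx).differentiableAt (by simp)).hasFDerivAt

theorem contDiffAt_fderiv_fderiv (hp : IsParametrization c h U) (hx : x ∈ U) :
    ContDiffAt ℝ ∞ (fderiv ℝ (fderiv ℝ h)) x := (hp.contDiffAt_fderiv hx).fderiv_right (by simp)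

theorem fderiv_fderiv_comm (hp : IsParametrization c h U) (hx : x ∈ U) (a b : Coord 2) :
    fderiv ℝ (fderiv ℝ h) x a b = fderiv ℝ (fderiv ℝ h) x b a :=
  ((hp.contDiffAt hx).isSymmSndFDerivAt minSmoothness_two_le) a b

theorem ambientForm_normal_fderiv (hp : IsParametrization c h U) (hx : x ∈ U) (a : Coord 2) :
    ambientForm c (normal c (h x)) (fderiv ℝ h x a) = 0 := by
  have h1 := (hasFDerivAt_defect c (h x)).comp x (hp.hasFDerivAt hx)
  have h2 : defect c ∘ h =ᶠ[𝓝 x] fun _ => 0 := by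
    filter_upwards [hp.isOpen.mem_nhds hx] with y hy
    exact ((mem_modelSurface_iff c _).1 (hp.mem y hy)).1
  exact DFunLike.congr_fun (h1.unique ((hasFDerivAt_const (0 : ℝ) x).congr_of_eventuallyEq h2)) a

theorem exists_fderiv_eq (hp : IsParametrization c h U) (hx : x ∈ U) {v : Space}
    (hv : ambientForm c (normal c (h x)) v = 0) : ∃ a, fderiv ℝ h x a = v := by
  have hle : LinearMap.range (fderiv ℝ h x : Coord 2 →ₗ[ℝ] Space) ≤
      LinearMap.ker (ambientForm c (normal c (h x)) : Space →ₗ[ℝ] ℝ) := by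
    rintro _ ⟨a, rfl⟩
    exact hp.ambientForm_normal_fderiv hx a
  have hm := hp.mem x hx
  have hs : Function.Surjective (ambientForm c (normal c (h x))) := by
    have := surjective_fderiv_defect hm
    rwa [(hasFDerivAt_defect c (h x)).fderiv] at this
  have h1 := LinearMap.finrank_range_add_finrank_ker
    (ambientForm c (normal c (h x)) : Space →ₗ[ℝ] ℝ)
  rw [LinearMap.range_eq_top.2 hs, finrank_top, Module.finrank_self, finrank_space] at h1
  have h2 := LinearMap.finrank_range_of_inj (f := (fderiv ℝ h x : Coord 2 →ₗ[ℝ] Space))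
    (hp.injective x hx)
  rw [finrank_euclideanSpace_fin] at h2
  have h3 := Submodule.eq_of_le_of_finrank_eq hle (by omega)
  have h4 : v ∈ LinearMap.ker (ambientForm c (normal c (h x)) : Space →ₗ[ℝ] ℝ) := hv
  rw [← h3] at h4
  exact h4

theorem inducedMetric_pos (hp : IsParametrization c h U) (hx : x ∈ U) {a : Coord 2} (ha : a ≠ 0) :
    0 < inducedMetric c h x a a :=
  ambientForm_pos (hp.mem x hx) (hp.ambientForm_normal_fderiv hx a) fun h0 =>
    ha (hp.injective x hx (h0.trans (map_zero _).symm))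

theorem inducedMetric_injective (hp : IsParametrization c h U) (hx : x ∈ U) :
    Function.Injective (inducedMetric c h x) := by
  rw [injective_iff_map_eq_zero]
  intro a ha
  by_contra h0
  have := hp.inducedMetric_pos hx h0
  rw [ha] at this
  exact lt_irrefl _ this

theorem contDiffAt_inducedMetric (hp : IsParametrization c h U) (hx : x ∈ U) :
    ContDiffAt ℝ ∞ (inducedMetric c h) x :=
  contDiffAt_const.bilinearComp_self (hp.contDiffAt_fderiv hx)

theorem fderiv_inducedMetric (hp : IsParametrization c h U) (hx : x ∈ U) (a b d : Coord 2) :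
    fderiv ℝ (inducedMetric c h) x a b d =
      ambientForm c (fderiv ℝ (fderiv ℝ h) x a b) (fderiv ℝ h x d) +
        ambientForm c (fderiv ℝ h x b) (fderiv ℝ (fderiv ℝ h) x a d) := by
  have h1 := ((hp.contDiffAt_inducedMetric hx).differentiableAt (by simp)).hasFDerivAt
  have h2 := (h1.clm_apply (hasFDerivAt_const b x)).clm_apply (hasFDerivAt_const d x)
  have h3 := hp.hasFDerivAt_fderiv hx
  have h4 := ((ambientForm c).hasFDerivAt.comp x (h3.clm_apply (hasFDerivAt_const b x))).clm_apply
    (h3.clm_apply (hasFDerivAt_const d x))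
  have := DFunLike.congr_fun (h2.unique h4) a
  simp at this
  rw [this, add_comm]

/-- In the Koszul combination of metric derivatives, the symmetry of second derivatives cancels all
terms except twice `B(D²h(a,b), Dh d)`. -/
theorem christoffel_eq (hp : IsParametrization c h U) (hx : x ∈ U) (a b : Coord 2) :
    christoffel (inducedMetric c h) x a b = (inducedMetric c h x).inverse
      ((ambientForm c (fderiv ℝ (fderiv ℝ h) x a b)).comp (fderiv ℝ h x)) := by
  rw [christoffel_apply, ← map_smul]
  congr 1
  refine ContinuousLinearMap.ext fun d => ?_
  simp only [smul_apply, sub_apply, add_apply, ContinuousLinearMap.flip_apply,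
    hp.fderiv_inducedMetric hx, ContinuousLinearMap.comp_apply, smul_eq_mul]
  rw [hp.fderiv_fderiv_comm hx b a, hp.fderiv_fderiv_comm hx d a, hp.fderiv_fderiv_comm hx d b,
    ambientForm_comm c (fderiv ℝ h x b), ambientForm_comm c (fderiv ℝ h x a)]
  ring

theorem inducedMetric_christoffel (hp : IsParametrization c h U) (hx : x ∈ U) (a b d : Coord 2) :
    inducedMetric c h x (christoffel (inducedMetric c h) x a b) d =
      ambientForm c (fderiv ℝ (fderiv ℝ h) x a b) (fderiv ℝ h x d) := by
  rw [hp.christoffel_eq hx, apply_inverse_self (hp.inducedMetric_injective hx)]; rfl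

/-- Differentiate `B(N, Dh b) = 0`. As `normal` is affine with linear part `-slope c`, the surface
is umbilic. -/
theorem ambientForm_normal_fderiv_fderiv (hp : IsParametrization c h U) (hx : x ∈ U)
    (a b : Coord 2) : ambientForm c (normal c (h x)) (fderiv ℝ (fderiv ℝ h) x a b) =
      slope c * inducedMetric c h x a b := by
  have h1 := ((ambientForm c).hasFDerivAt.comp x ((hasFDerivAt_normal c (h x)).comp x
    (hp.hasFDerivAt hx))).clm_apply ((hp.hasFDerivAt_fderiv hx).clm_apply (hasFDerivAt_const b x))
  have h2 : (fun y => ambientForm c (normal c (h y)) (fderiv ℝ h y b)) =ᶠ[𝓝 x] fun _ => 0 := by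
    filter_upwards [hp.isOpen.mem_nhds hx] with y hy using hp.ambientForm_normal_fderiv hy b
  have := DFunLike.congr_fun
    (h1.unique ((hasFDerivAt_const (0 : ℝ) x).congr_of_eventuallyEq h2)) a
  simp at this
  rw [inducedMetric_apply]
  linarith

/-- The Gauss formula: the second derivative of a parametrization in terms of the Levi-Civita
connection of the induced metric and the second fundamental form. -/
theorem gauss_formula (hp : IsParametrization c h U) (hx : x ∈ U) (a b : Coord 2) :
    fderiv ℝ (fderiv ℝ h) x a b = fderiv ℝ h x (christoffel (inducedMetric c h) x a b) +
      (signature c * slope c * inducedMetric c h x a b) • normal c (h x) := by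
  set z := fderiv ℝ (fderiv ℝ h) x a b - (fderiv ℝ h x (christoffel (inducedMetric c h) x a b) +
      (signature c * slope c * inducedMetric c h x a b) • normal c (h x)) with hz
  have hm := hp.mem x hx
  have h1 : ambientForm c (normal c (h x)) z = 0 := by
    rw [hz, map_sub, map_add, map_smul, hp.ambientForm_normal_fderiv_fderiv hx,
      hp.ambientForm_normal_fderiv hx, ambientForm_normal_self hm, smul_eq_mul]
    linear_combination (-slope c * inducedMetric c h x a b) * signature_mul_self c
  have h2 : ∀ d, ambientForm c z (fderiv ℝ h x d) = 0 := fun d => by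
    have := hp.inducedMetric_christoffel hx a b d
    rw [inducedMetric_apply] at this
    simp only [hz, map_sub, map_add, map_smul, sub_apply, add_apply, smul_apply, this,
      hp.ambientForm_normal_fderiv hx, smul_zero, add_zero, sub_self]
  obtain ⟨e, he⟩ := hp.exists_fderiv_eq hx h1
  -- The difference `z` is orthogonal to the normal, hence tangent, and orthogonal to all tangent
  -- vectors; the form is definite on the tangent plane.
  have h3 : z = 0 := by
    by_contra h0
    have h4 := ambientForm_pos hm h1 h0
    nth_rw 2 [← he] at h4
    rw [h2] at h4
    exact lt_irrefl _ h4
  exact sub_eq_zero.1 h3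

theorem differentiableAt_christoffel (hp : IsParametrization c h U) (hx : x ∈ U)
    (a b : Coord 2) : DifferentiableAt ℝ (fun z => christoffel (inducedMetric c h) z a b) x := by
  have h1 : ContDiffAt ℝ ∞ (fun z => (inducedMetric c h z).inverse
      ((ambientForm c (fderiv ℝ (fderiv ℝ h) z a b)).comp (fderiv ℝ h z))) x :=
    ((hp.contDiffAt_inducedMetric hx).clm_inverse (hp.inducedMetric_injective hx)).clm_apply
      (((ambientForm c).contDiff.contDiffAt.comp x (((hp.contDiffAt_fderiv_fderiv hx).clm_apply
        contDiffAt_const).clm_apply contDiffAt_const)).clm_comp (hp.contDiffAt_fderiv hx))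
  refine (h1.differentiableAt (by simp)).congr_of_eventuallyEq ?_
  filter_upwards [hp.isOpen.mem_nhds hx] with z hz using hp.christoffel_eq hz a b

/-- The model surface has constant curvature. -/
theorem riemann_eq (hp : IsParametrization c h U) (hx : x ∈ U) (a b d : Coord 2) :
    riemann (inducedMetric c h) x a b d =
      (-2 * c) • (inducedMetric c h x b d • a - inducedMetric c h x a d • b) := by
  set Γ := christoffel (inducedMetric c h) with hΓ
  -- Differentiating the Gauss formula once more expresses the tangential part of the third
  -- derivative of `h` by the Christoffel symbols and the metric; the normal part is collected in
  -- `r`. The curvature is the obstruction to symmetry in `a, b` of the Christoffel terms, and the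
  -- third derivative is symmetric.
  have key : ∀ a b : Coord 2, ∃ r : ℝ, fderiv ℝ (fderiv ℝ (fderiv ℝ h)) x a b d =
      fderiv ℝ h x (Γ x a (Γ x b d) + fderiv ℝ (fun z => Γ z b d) x a +
        (2 * c * inducedMetric c h x b d) • a) + r • normal c (h x) := fun a b => by
    have h3 : HasFDerivAt (fderiv ℝ (fderiv ℝ h)) (fderiv ℝ (fderiv ℝ (fderiv ℝ h)) x) x :=
      ((hp.contDiffAt_fderiv_fderiv hx).differentiableAt (by simp)).hasFDerivAt
    have h4 := (h3.clm_apply (hasFDerivAt_const b x)).clm_apply (hasFDerivAt_const d x)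
    have h5 := (hp.hasFDerivAt_fderiv hx).clm_apply
      (hp.differentiableAt_christoffel hx b d).hasFDerivAt
    have h6 := ((((hp.contDiffAt_inducedMetric hx).differentiableAt (by simp)).hasFDerivAt.clm_apply
      (hasFDerivAt_const b x)).clm_apply (hasFDerivAt_const d x)).const_mul
        (signature c * slope c)
    have h7 := h5.add (h6.smul ((hasFDerivAt_normal c (h x)).comp x (hp.hasFDerivAt hx)))
    have h8 := h7.congr_of_eventuallyEq (f₁ := fun y => fderiv ℝ (fderiv ℝ h) y b d) (by
      filter_upwards [hp.isOpen.mem_nhds hx] with y hy using hp.gauss_formula hy b d)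
    have h9 := DFunLike.congr_fun (h4.unique h8) a
    simp at h9
    have hs : signature c * slope c * (inducedMetric c h x) b d * slope c =
      -(2 * c * (inducedMetric c h x) b d) := by
      linear_combination (inducedMetric c h x b d) * signature_mul_slope c
    refine ⟨signature c * slope c * inducedMetric c h x a (Γ x b d) +
      signature c * slope c * fderiv ℝ (inducedMetric c h) x a b d, ?_⟩
    rw [h9, hp.gauss_formula hx a (christoffel (inducedMetric c h) x b d), smul_smul, hs]
    simp only [← hΓ, map_add, map_smul, add_smul, neg_smul, neg_neg]
    abel
  obtain ⟨r, hr⟩ := key a b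
  obtain ⟨r', hr'⟩ := key b a
  have hsymm : fderiv ℝ (fderiv ℝ (fderiv ℝ h)) x a b d =
      fderiv ℝ (fderiv ℝ (fderiv ℝ h)) x b a d :=
    congrArg (fun T => T d) (((hp.contDiffAt_fderiv hx).isSymmSndFDerivAt minSmoothness_two_le) a b)
  rw [hr, hr', ← sub_eq_zero, add_sub_add_comm, ← map_sub, ← sub_smul] at hsymm
  -- Pairing with the normal shows that the normal parts cancel, which leaves an identity of tangent
  -- vectors to which injectivity of `fderiv ℝ h x` applies.
  have hn := congrArg (ambientForm c (normal c (h x))) hsymm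
  rw [map_add, hp.ambientForm_normal_fderiv hx, map_smul, ambientForm_normal_self (hp.mem x hx),
    map_zero, zero_add, smul_eq_mul] at hn
  rw [(mul_eq_zero.1 hn).resolve_right (signature_ne_zero c), zero_smul, add_zero] at hsymm
  have h0 := hp.injective x hx (hsymm.trans (map_zero _).symm)
  rw [riemann, ← sub_eq_zero, ← h0, ← hΓ]
  simp only [smul_sub, smul_smul]
  rw [neg_mul, neg_mul, neg_mul, neg_smul, neg_smul]
  abel

end IsParametrization

theorem isRiemannian_modelSurface (c : ℝ) :
    IsRiemannian (modelSurface c) 2 (fun _ => ambientForm c) := fun φ => by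
  rw [φ.metric_eq]
  exact ⟨fun _ hx => (φ.isParametrization.contDiffAt_inducedMetric hx).contDiffWithinAt,
    fun _ hx => ⟨fun a b => inducedMetric_comm _ _ _ _ _,
      fun a ha => φ.isParametrization.inducedMetric_pos hx ha⟩⟩

theorem hasConstantCurvature_modelSurface (c : ℝ) :
    HasConstantCurvature (modelSurface c) 2 (fun _ => ambientForm c) (-2 * c) := fun φ _ hx a b d =>
  φ.isParametrization.riemann_eq hx a b d

/-! ### Parametrized pieces of the unit cotangent bundle -/

/-- The cotangent lift of the induced metric to the ambient phase space. -/
def sasaki (c : ℝ) (w : Phase) : Phase →L[ℝ] Phase →L[ℝ] ℝ :=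
  (ambientForm c).bilinearComp (ContinuousLinearMap.fst ℝ Space (Space →L[ℝ] ℝ))
      (ContinuousLinearMap.fst ℝ Space (Space →L[ℝ] ℝ))
    + (ContinuousLinearMap.id ℝ (Space →L[ℝ] ℝ)).bilinearComp
      (ContinuousLinearMap.snd ℝ Space (Space →L[ℝ] ℝ))
      (((lower c).symm : (Space →L[ℝ] ℝ) →L[ℝ] Space).comp
        (ContinuousLinearMap.snd ℝ Space (Space →L[ℝ] ℝ)))
    + (2 * c) • (w.2.comp (ContinuousLinearMap.fst ℝ Space (Space →L[ℝ] ℝ))).smulRight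
      (w.2.comp (ContinuousLinearMap.fst ℝ Space (Space →L[ℝ] ℝ)))

/-- The middle term counts the full covector velocity, including its normal component. On tangent
vectors of the bundle that component contributes `signature c * slope c ^ 2 * ξ(a) ξ(a')`, which is
`-2c ξ(a) ξ(a')`; the last term removes it and leaves the covariant derivative. -/
theorem sasaki_apply (c : ℝ) (w t t' : Phase) : sasaki c w t t' =
    ambientForm c t.1 t'.1 + t.2 ((lower c).symm t'.2) + 2 * c * (w.2 t.1 * w.2 t'.1) := rfl

theorem contDiff_sasaki (c : ℝ) : ContDiff ℝ ∞ (sasaki c) := by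
  have h1 : ContDiff ℝ ∞ (fun w : Phase =>
      w.2.comp (ContinuousLinearMap.fst ℝ Space (Space →L[ℝ] ℝ))) :=
    contDiff_snd.clm_comp contDiff_const
  exact contDiff_const.add ((h1.smulRight h1).const_smul (2 * c))

/-- The generator of the geodesic flow. -/
def geodesicField (c : ℝ) (w : Phase) : Phase := ((lower c).symm w.2, (2 * c) • ambientForm c w.1)

theorem contDiff_geodesicField (c : ℝ) : ContDiff ℝ ∞ (geodesicField c) :=
  ((lower c).symm.contDiff.comp contDiff_snd).prodMk
    (((ambientForm c).contDiff.comp contDiff_fst).const_smul (2 * c))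

/-- Points of the unit cotangent bundle in terms of a parametrization of the surface. -/
def tangentLift (c : ℝ) (h : Coord 2 → Space) (z : Coord 2 × Coord 2) : Phase :=
  (h z.1, ambientForm c (fderiv ℝ h z.1 z.2))

namespace IsParametrization

variable {c : ℝ} {h : Coord 2 → Space} {U : Set (Coord 2)} {z : Coord 2 × Coord 2}

theorem contDiffAt_tangentLift (hp : IsParametrization c h U) (hz : z.1 ∈ U) :
    ContDiffAt ℝ ∞ (tangentLift c h) z := by
  have h1 : ContDiffAt ℝ ∞ (fun z : Coord 2 × Coord 2 => h z.1) z :=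
    (hp.contDiffAt hz).comp z contDiffAt_fst
  have h2 : ContDiffAt ℝ ∞ (fun z : Coord 2 × Coord 2 => fderiv ℝ h z.1) z :=
    (hp.contDiffAt_fderiv hz).comp z contDiffAt_fst
  exact h1.prodMk ((ambientForm c).contDiff.contDiffAt.comp z (h2.clm_apply contDiffAt_snd))

theorem fderiv_tangentLift (hp : IsParametrization c h U) (hz : z.1 ∈ U) (t : Coord 2 × Coord 2) :
    fderiv ℝ (tangentLift c h) z t = (fderiv ℝ h z.1 t.1, ambientForm c (fderiv ℝ h z.1
      (t.2 + christoffel (inducedMetric c h) z.1 t.1 z.2) +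
        (signature c * slope c * inducedMetric c h z.1 t.1 z.2) • normal c (h z.1))) := by
  have h1 := (hp.hasFDerivAt hz).comp z (hasFDerivAt_fst (𝕜 := ℝ) (p := z))
  have h2 := ((hp.hasFDerivAt_fderiv hz).comp z (hasFDerivAt_fst (𝕜 := ℝ) (p := z))).clm_apply
    (hasFDerivAt_snd (𝕜 := ℝ) (p := z))
  have h3 : HasFDerivAt (tangentLift c h) _ z :=
    h1.prodMk ((ambientForm c).hasFDerivAt.comp z h2)
  rw [h3.fderiv]
  refine Prod.ext rfl ?_
  change ambientForm c (fderiv ℝ h z.1 t.2 + fderiv ℝ (fderiv ℝ h) z.1 t.1 z.2) = _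
  rw [hp.gauss_formula hz, map_add (fderiv ℝ h z.1), add_assoc]

/-- In a parametrization, the lifted metric is determined by the induced metric. -/
theorem sasaki_tangentLift (hp : IsParametrization c h U) (hz : z.1 ∈ U)
    (t t' : Coord 2 × Coord 2) : sasaki c (tangentLift c h z) (fderiv ℝ (tangentLift c h) z t)
      (fderiv ℝ (tangentLift c h) z t') = inducedMetric c h z.1 t.1 t'.1 +
      inducedMetric c h z.1 (t.2 + christoffel (inducedMetric c h) z.1 t.1 z.2)
        (t'.2 + christoffel (inducedMetric c h) z.1 t'.1 z.2) := by
  rw [hp.fderiv_tangentLift hz, hp.fderiv_tangentLift hz, sasaki_apply]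
  simp only [lower_symm_ambientForm, tangentLift]
  set p := t.2 + christoffel (inducedMetric c h) z.1 t.1 z.2
  set p' := t'.2 + christoffel (inducedMetric c h) z.1 t'.1 z.2
  have hn := hp.ambientForm_normal_fderiv hz
  have hn' : ∀ a, ambientForm c (fderiv ℝ h z.1 a) (normal c (h z.1)) = 0 := fun a => by
    rw [ambientForm_comm, hn]
  simp only [map_add (ambientForm c), map_smul, add_apply, smul_apply,
    map_add (ambientForm c (fderiv ℝ h z.1 p)), map_add (ambientForm c (normal c (h z.1))),
    hn, hn', ambientForm_normal_self (hp.mem _ hz), smul_eq_mul, mul_zero, add_zero, zero_add]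
  simp only [← inducedMetric_apply]
  rw [inducedMetric_comm c h z.1 z.2, inducedMetric_comm c h z.1 z.2]
  linear_combination (inducedMetric c h z.1 t.1 z.2 * inducedMetric c h z.1 t'.1 z.2) *
    (signature_mul_slope c + signature c * slope c * slope c * signature_mul_self c)

/-- In a parametrization, the geodesic field is determined by the induced metric. -/
theorem geodesicField_tangentLift (hp : IsParametrization c h U) (hz : z.1 ∈ U)
    (hu : inducedMetric c h z.1 z.2 z.2 = 1) : fderiv ℝ (tangentLift c h) z
      (z.2, -christoffel (inducedMetric c h) z.1 z.2 z.2) = geodesicField c (tangentLift c h z) := by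
  rw [hp.fderiv_tangentLift hz]
  simp only [neg_add_cancel, map_zero, zero_add, hu, mul_one, signature_smul_normal, geodesicField,
    tangentLift, lower_symm_ambientForm, map_smul]

end IsParametrization

/-- By the Gauss formula the Christoffel term in the covariant derivative of a covector cancels the
second derivative of the chart, because `ξ` annihilates the normal. The covariant derivative is
therefore the restriction of the ambient covector velocity to the tangent plane. -/
theorem isSasakiMokLift_sasaki (c : ℝ) :
    IsSasakiMokLift (ambientForm c) (modelSurface c) (sasaki c) := by
  intro φ w hw hφ a ha b hb
  have hwm := (mem_modelBundle_iff w).1 hw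
  have hx : φ.invFun w.1 ∈ φ.source := φ.invFun_mem _ ⟨hwm.1, hφ⟩
  have hxw : φ.toFun (φ.invFun w.1) = w.1 := φ.right_inv _ ⟨hwm.1, hφ⟩
  have hp := φ.isParametrization
  rw [φ.metric_eq]
  have hV : ∀ t : Phase, fderiv ℝ φ.cotangentCoord w t = (fderiv ℝ φ.invFun w.1 t.1,
      t.2.comp (fderiv ℝ φ.toFun (φ.invFun w.1)) +
        w.2.comp (fderiv ℝ (fderiv ℝ φ.toFun) (φ.invFun w.1) (fderiv ℝ φ.invFun w.1 t.1))) := by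
    intro t
    have h1 := (φ.hasFDerivAt_invFun hφ).comp w (hasFDerivAt_fst (𝕜 := ℝ) (p := w))
    have h2 := (hp.hasFDerivAt_fderiv hx).comp w h1
    have h3 : HasFDerivAt φ.cotangentCoord _ w :=
      h1.prodMk ((hasFDerivAt_snd (𝕜 := ℝ) (p := w)).clm_comp h2)
    rw [h3.fderiv]
    refine Prod.ext rfl ?_
    refine ContinuousLinearMap.ext fun d => ?_
    exact add_comm _ _
  have hD : ∀ t : Phase, covectorDeriv (inducedMetric c φ.toFun) (φ.cotangentCoord w).1
      (φ.cotangentCoord w).2 (fderiv ℝ φ.cotangentCoord w t) =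
        t.2.comp (fderiv ℝ φ.toFun (φ.invFun w.1)) := by
    intro t
    rw [hV]
    refine ContinuousLinearMap.ext fun d => ?_
    simp only [covectorDeriv, Chart.cotangentCoord, sub_apply, add_apply,
      ContinuousLinearMap.comp_apply, hp.gauss_formula hx, map_add, map_smul, hxw, hwm.2.1]
    simp
  have hT : ∀ t ∈ tangentVectors (modelBundle c) w,
      fderiv ℝ φ.toFun (φ.invFun w.1) (fderiv ℝ φ.invFun w.1 t.1) = t.1 := by
    intro t ht
    have h1 := (mem_tangentVectors_modelBundle hw).1 ht
    have h2 : t.1 ∈ tangentVectors (modelSurface c) (φ.toFun (φ.invFun w.1)) := by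
      rw [hxw, mem_tangentVectors_modelSurface hwm.1]; exact h1.1
    have h3 := φ.fderiv_toFun_fderiv_invFun hx h2
    rwa [hxw] at h3
  have ha' := (mem_tangentVectors_modelBundle hw).1 ha
  have hb' := (mem_tangentVectors_modelBundle hw).1 hb
  -- `u` is the coordinate vector of the tangential part of the vector dual to `b.2`; it represents
  -- the inverse metric applied to the covariant derivative.
  obtain ⟨u, hu⟩ := hp.exists_fderiv_eq hx (v := (lower c).symm b.2 -
    (signature c * ambientForm c (normal c w.1) ((lower c).symm b.2)) • normal c w.1) (by
      rw [hxw]; exact ambientForm_normal_sub hwm.1 _)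
  have hu' : inducedMetric c φ.toFun (φ.invFun w.1) u =
      b.2.comp (fderiv ℝ φ.toFun (φ.invFun w.1)) := by
    refine ContinuousLinearMap.ext fun d => ?_
    have hn := hp.ambientForm_normal_fderiv hx d
    rw [hxw] at hn
    rw [inducedMetric_apply, hu]
    simp only [map_sub, map_smul, sub_apply, smul_apply, hn, ambientForm_lower_symm, smul_zero,
      sub_zero, ContinuousLinearMap.comp_apply]
  rw [sasakiMok, hD, hD, hV, hV]
  simp only [Chart.cotangentCoord]
  rw [← hu', inverse_apply_self (hp.inducedMetric_injective hx), inducedMetric_apply, hT a ha,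
    hT b hb, ContinuousLinearMap.comp_apply, hu, sasaki_apply, map_sub, map_smul,
    ambientForm_comm c (normal c w.1), ambientForm_lower_symm, ha'.2.1, hb'.2.1, smul_eq_mul]
  linear_combination (w.2 a.1 * w.2 b.1) * signature_mul_slope c

end KeplerEuler

end

noncomputable section

namespace KeplerEuler

/-! ### The Liouville form and its exterior derivative -/

section Forms

/-- The bilinear map `(w, t) ↦ ξ(a)`, where `w = (m, ξ)` and `t = (a, β)`; in its second argument it
is the Liouville form at `w`. -/
def pairing : Phase →L[ℝ] Phase →L[ℝ] ℝ :=
  (ContinuousLinearMap.id ℝ (Space →L[ℝ] ℝ)).bilinearComp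
    (ContinuousLinearMap.snd ℝ Space (Space →L[ℝ] ℝ))
    (ContinuousLinearMap.fst ℝ Space (Space →L[ℝ] ℝ))

theorem pairing_apply (w t : Phase) : pairing w t = w.2 t.1 := rfl

variable {E : Type*} [NormedAddCommGroup E] [NormedSpace ℝ E]

/-- The exterior derivative of a one-form that depends linearly on the base point. -/
def antisymmetrize (J : E →L[ℝ] E →L[ℝ] ℝ) : E [⋀^Fin 2]→L[ℝ] ℝ :=
  ContinuousAlternatingMap.alternatizeUncurryFinCLM ℝ E ℝ
    (((ContinuousAlternatingMap.ofSubsingletonLIE (𝕜 := ℝ) (E := E) (F := ℝ)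
      (0 : Fin 1)).toContinuousLinearEquiv :
      (E →L[ℝ] ℝ) →L[ℝ] E [⋀^Fin 1]→L[ℝ] ℝ).comp J)

theorem antisymmetrize_apply (J : E →L[ℝ] E →L[ℝ] ℝ) (v : Fin 2 → E) :
    antisymmetrize J v = J (v 0) (v 1) - J (v 1) (v 0) := by
  rw [antisymmetrize, ContinuousAlternatingMap.alternatizeUncurryFinCLM_apply,
    ContinuousAlternatingMap.alternatizeUncurryFin_apply, Fin.sum_univ_two]
  change (-1) ^ 0 • J (v 0) (v 1) + (-1) ^ 1 • J (v 1) (v 0) = _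
  simp [sub_eq_add_neg]

/-- The exterior product of a one-form and a two-form. -/
def wedge (α : E →L[ℝ] ℝ) (η : E [⋀^Fin 2]→L[ℝ] ℝ) : E [⋀^Fin 3]→L[ℝ] ℝ :=
  ContinuousAlternatingMap.alternatizeUncurryFinCLM ℝ E ℝ (α.smulRight η)

theorem wedge_apply (α : E →L[ℝ] ℝ) (η : E [⋀^Fin 2]→L[ℝ] ℝ) (v : Fin 3 → E) :
    wedge α η v = α (v 0) * η ![v 1, v 2] - α (v 1) * η ![v 0, v 2] + α (v 2) * η ![v 0, v 1] := by
  rw [wedge, ContinuousAlternatingMap.alternatizeUncurryFinCLM_apply,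
    ContinuousAlternatingMap.alternatizeUncurryFin_apply, Fin.sum_univ_three]
  have h0 : Fin.removeNth 0 v = ![v 1, v 2] := by ext i; fin_cases i <;> rfl
  have h1 : Fin.removeNth 1 v = ![v 0, v 2] := by ext i; fin_cases i <;> rfl
  have h2 : Fin.removeNth 2 v = ![v 0, v 1] := by ext i; fin_cases i <;> rfl
  rw [h0, h1, h2]
  simp [sub_eq_add_neg]

theorem extDeriv_ofSubsingleton {α : E → E →L[ℝ] ℝ} {x : E} (hα : DifferentiableAt ℝ α x) :
    extDeriv (fun y => ContinuousAlternatingMap.ofSubsingleton ℝ E ℝ (0 : Fin 1) (α y)) x =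
      antisymmetrize (fderiv ℝ α x) := by
  rw [extDeriv, antisymmetrize, ContinuousAlternatingMap.alternatizeUncurryFinCLM_apply]
  congr 1
  exact ((((ContinuousAlternatingMap.ofSubsingletonLIE (𝕜 := ℝ) (E := E) (F := ℝ)
      (0 : Fin 1)).toContinuousLinearEquiv :
      (E →L[ℝ] ℝ) →L[ℝ] E [⋀^Fin 1]→L[ℝ] ℝ).hasFDerivAt.comp x hα.hasFDerivAt)).fderiv

theorem eq_zero_of_finrank_lt {k : ℕ} (f : E [⋀^Fin k]→L[ℝ] ℝ) [FiniteDimensional ℝ E]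
    (h : Module.finrank ℝ E < k) : f = 0 := by
  ext v
  refine f.toAlternatingMap.map_linearDependent v fun hv => ?_
  have := hv.fintype_card_le_finrank
  rw [Fintype.card_fin] at this
  omega

/-- A volume form of the unit cotangent bundle: the exterior product of the Liouville form with its
exterior derivative. -/
def liouvilleVolume (w : Phase) : Phase [⋀^Fin 3]→L[ℝ] ℝ :=
  wedge (pairing w) (antisymmetrize pairing)

end Forms

/-! ### The geodesic field as Reeb field, Beltrami field and stationary Euler flow. -/

section Bundle

variable {c : ℝ}

/-- An orthonormal coframe of the unit cotangent bundle. -/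
theorem exists_coframe {w : Phase} (hw : w ∈ modelBundle c) : ∃ Y Z : Phase → ℝ,
    ∀ t ∈ tangentVectors (modelBundle c) w, (w.2 t.1 = 0 → Y t = 0 → Z t = 0 → t = 0) ∧
      ∀ t' ∈ tangentVectors (modelBundle c) w,
        sasaki c w t t' = w.2 t.1 * w.2 t'.1 + Y t * Y t' + Z t * Z t' ∧
        antisymmetrize pairing ![t, t'] = Z t * Y t' - Z t' * Y t := by
  obtain ⟨v, hv, hν, hvv⟩ := exists_dual hw
  have hm := ((mem_modelBundle_iff w).1 hw).1
  obtain ⟨n, h1, h2, h3, hn⟩ := exists_frame hm hν hvv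
  have hsplit : ∀ t ∈ tangentVectors (modelBundle c) w,
      t.1 = w.2 t.1 • v + ambientForm c n t.1 • n ∧ t.2 = ambientForm c
        ((signature c * slope c * w.2 t.1) • normal c w.1 + t.2 n • n) := by
    intro t ht
    obtain ⟨ha, hb, hd⟩ := (mem_tangentVectors_modelBundle hw).1 ht
    constructor
    · conv_lhs => rw [hn t.1]
      rw [ha, mul_zero, zero_smul, zero_add, hv]
    · conv_lhs => rw [← ambientForm_lower_symm (c := c) t.2]
      congr 1
      conv_lhs => rw [hn ((lower c).symm t.2)]
      rw [hv, lower_symm_ambientForm] at hd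
      rw [hv] at hb
      have e : ∀ p, ambientForm c p ((lower c).symm t.2) = t.2 p := fun p => by
        rw [ambientForm_comm, ambientForm_lower_symm]
      rw [e, e, e, hd, hb, zero_smul, add_zero, ← mul_assoc, hv]
  have hνn := ambientForm_normal_self hm
  have h1' : ambientForm c n (normal c w.1) = 0 := by rw [ambientForm_comm, h1]
  have h2' : ambientForm c n v = 0 := by rw [ambientForm_comm, h2]
  -- With `v` the unit vector dual to `ξ` and `n` orthogonal to it, `Y` is the horizontal component
  -- along `n` and `Z` the vertical one. The velocity of `ξ` has no component along `v` because its
  -- length is fixed.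
  refine ⟨fun t => ambientForm c n t.1, fun t => t.2 n, fun t ht => ⟨fun e1 e2 e3 => ?_,
    fun t' ht' => ?_⟩⟩
  · simp only at e2 e3
    refine Prod.ext ?_ ?_
    · rw [(hsplit t ht).1, e1, e2]; simp
    · rw [(hsplit t ht).2, e1, e3]; simp
  · set x := w.2 t.1
    set x' := w.2 t'.1
    set y := ambientForm c n t.1
    set y' := ambientForm c n t'.1
    have ht1 := hsplit t ht
    have ht2 := hsplit t' ht'
    simp only
    set z := t.2 n
    set z' := t'.2 n
    rw [sasaki_apply, antisymmetrize_apply, pairing_apply, pairing_apply]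
    simp only [Matrix.cons_val_zero, Matrix.cons_val_one]
    change ambientForm c t.1 t'.1 + t.2 ((lower c).symm t'.2) + 2 * c * (x * x') = _ ∧ _
    rw [ht1.1, ht1.2, ht2.1, ht2.2, lower_symm_ambientForm]
    simp only [map_add (ambientForm c), map_smul (ambientForm c), add_apply, smul_apply,
      map_add (ambientForm c v), map_add (ambientForm c n), map_add (ambientForm c (normal c w.1)),
      map_smul (ambientForm c v), map_smul (ambientForm c n),
      map_smul (ambientForm c (normal c w.1)), hν, h1, h1', h2, h2', h3, hvv, hνn,
      smul_eq_mul]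
    constructor
    · linear_combination (x * x') * (signature_mul_slope c +
        signature c * slope c * slope c * signature_mul_self c)
    · ring

theorem geodesicField_mem {w : Phase} (hw : w ∈ modelBundle c) :
    geodesicField c w ∈ tangentVectors (modelBundle c) w := by
  obtain ⟨v, hv, hν, hvv⟩ := exists_dual hw
  have hm := ((mem_modelBundle_iff w).1 hw).1
  have h1 : (2 * c) • ambientForm c w.1 = (signature c * slope c) • ambientForm c (normal c w.1) := by
    rw [← map_smul, ← map_smul, signature_smul_normal]
  rw [mem_tangentVectors_modelBundle hw, geodesicField, hv, lower_symm_ambientForm]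
  simp only [h1, smul_apply, ambientForm_normal_self hm, hν, hvv, smul_eq_mul, mul_zero,
    true_and, and_true, mul_one]
  linear_combination slope c * signature_mul_self c

theorem apply_geodesicField {w : Phase} (hw : w ∈ modelBundle c) :
    w.2 (geodesicField c w).1 = 1 := ((mem_modelBundle_iff w).1 hw).2.2

/-- The geodesic field is metrically dual to the Liouville form. -/
theorem sasaki_geodesicField {w t : Phase} (hw : w ∈ modelBundle c)
    (ht : t ∈ tangentVectors (modelBundle c) w) : sasaki c w (geodesicField c w) t = w.2 t.1 := by
  obtain ⟨h1, h2, h3⟩ := (mem_tangentVectors_modelBundle hw).1 ht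
  have h4 : ambientForm c w.1 ((lower c).symm t.2) = t.2 w.1 := by
    rw [ambientForm_comm, ambientForm_lower_symm]
  have h5 : 2 * c * t.2 w.1 = signature c * slope c * (slope c * w.2 t.1) := by
    rw [← h2, ← smul_eq_mul, ← map_smul, ← signature_smul_normal, map_smul, smul_eq_mul]
  rw [sasaki_apply, apply_geodesicField hw]
  simp only [geodesicField, smul_apply, ambientForm_lower_symm, h4, smul_eq_mul]
  linear_combination h5 + w.2 t.1 * signature_mul_slope c

/-- This is the Reeb condition `ι_X dα = 0`. One term is `2c B(m, ·)` on a vector tangent to the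
surface and vanishes because `2c m` is normal; the other vanishes because unit covectors keep their
length. -/
theorem antisymmetrize_geodesicField {w t : Phase} (hw : w ∈ modelBundle c)
    (ht : t ∈ tangentVectors (modelBundle c) w) :
    pairing (geodesicField c w) t - pairing t (geodesicField c w) = 0 := by
  obtain ⟨h1, h2, h3⟩ := (mem_tangentVectors_modelBundle hw).1 ht
  rw [pairing_apply, pairing_apply]
  simp only [geodesicField, h3, sub_zero]
  rw [← map_smul, ← signature_smul_normal, map_smul, smul_apply, h1, smul_zero]

theorem isVectorField_geodesicField (c : ℝ) :
    IsVectorField (modelBundle c) 3 (geodesicField c) :=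
  ⟨(contDiff_geodesicField c).smoothOn, fun _ hw => geodesicField_mem hw⟩

section Charts

variable (φ : Chart (modelBundle c) 3) {x : Coord 3}

theorem contDiffAt_chart_fderiv (hx : x ∈ φ.source) : ContDiffAt ℝ ∞ (fderiv ℝ φ.toFun) x :=
  (φ.contDiffAt_toFun hx).fderiv_right (by simp)

theorem contDiffAt_chart_metric (hx : x ∈ φ.source) :
    ContDiffAt ℝ ∞ (φ.metric (sasaki c)) x :=
  ((contDiff_sasaki c).contDiffAt.comp x (φ.contDiffAt_toFun hx)).bilinearComp_self
    (contDiffAt_chart_fderiv φ hx)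

theorem chart_metric_apply (x a b : Coord 3) : φ.metric (sasaki c) x a b =
    sasaki c (φ.toFun x) (fderiv ℝ φ.toFun x a) (fderiv ℝ φ.toFun x b) := rfl

theorem chart_metric_comm (x a b : Coord 3) :
    φ.metric (sasaki c) x a b = φ.metric (sasaki c) x b a := by
  rw [chart_metric_apply, chart_metric_apply, sasaki_apply, sasaki_apply, ambientForm_comm,
    apply_lower_symm, mul_comm ((φ.toFun x).2 _)]

theorem chart_metric_pos (hx : x ∈ φ.source) {a : Coord 3} (ha : a ≠ 0) :
    0 < φ.metric (sasaki c) x a a := by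
  obtain ⟨Y, Z, h⟩ := exists_coframe (φ.mem hx)
  have ht := φ.fderiv_toFun_mem hx a
  rw [chart_metric_apply, ((h _ ht).2 _ ht).1]
  set X := (φ.toFun x).2 (fderiv ℝ φ.toFun x a).1
  set y := Y (fderiv ℝ φ.toFun x a)
  set z := Z (fderiv ℝ φ.toFun x a)
  by_contra hle
  have h1 := mul_self_nonneg X
  have h2 := mul_self_nonneg y
  have h3 := mul_self_nonneg z
  have := (h _ ht).1 (mul_self_eq_zero.1 (by linarith)) (mul_self_eq_zero.1 (by linarith))
    (mul_self_eq_zero.1 (by linarith))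
  exact ha (φ.fderiv_toFun_injective hx (this.trans (map_zero _).symm))

theorem chart_metric_injective (hx : x ∈ φ.source) :
    Function.Injective (φ.metric (sasaki c) x) := by
  rw [injective_iff_map_eq_zero]
  intro a ha
  by_contra h0
  have := chart_metric_pos φ hx h0
  rw [ha] at this
  exact lt_irrefl _ this

theorem isRiemannian_sasaki (c : ℝ) : IsRiemannian (modelBundle c) 3 (sasaki c) := fun φ =>
  ⟨fun _ hx => (contDiffAt_chart_metric φ hx).contDiffWithinAt, fun x hx =>
    ⟨chart_metric_comm φ x, fun _ ha => chart_metric_pos φ hx ha⟩⟩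

theorem chart_form_eq (x : Coord 3) : φ.form liouvilleVolume x =
    wedge ((pairing (φ.toFun x)).comp (fderiv ℝ φ.toFun x))
      (antisymmetrize (pairing.bilinearComp (fderiv ℝ φ.toFun x) (fderiv ℝ φ.toFun x))) := by
  ext v
  simp only [Chart.form, liouvilleVolume, ContinuousAlternatingMap.compContinuousLinearMap_apply,
    wedge_apply, antisymmetrize_apply]
  rfl

theorem contDiffAt_chart_form (hx : x ∈ φ.source) :
    ContDiffAt ℝ ∞ (φ.form liouvilleVolume) x := by
  have h0 := contDiffAt_chart_fderiv φ hx
  have h1 : ContDiffAt ℝ ∞ (fun x => (pairing (φ.toFun x)).comp (fderiv ℝ φ.toFun x)) x :=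
    (pairing.contDiff.contDiffAt.comp x (φ.contDiffAt_toFun hx)).clm_comp h0
  have h2 : ContDiffAt ℝ ∞ (fun x => pairing.bilinearComp (fderiv ℝ φ.toFun x)
    (fderiv ℝ φ.toFun x)) x := contDiffAt_const.bilinearComp_self h0
  have h3 : ContDiffAt ℝ ∞ (fun x => antisymmetrize (pairing.bilinearComp (fderiv ℝ φ.toFun x)
    (fderiv ℝ φ.toFun x))) x :=
    (ContinuousAlternatingMap.alternatizeUncurryFinCLM ℝ (Coord 3) ℝ).contDiff.contDiffAt.comp x
      (contDiffAt_const.clm_comp h2)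
  have h4 := (ContinuousAlternatingMap.alternatizeUncurryFinCLM ℝ
    (Coord 3) ℝ).contDiff.contDiffAt.comp x (h1.smulRight h3)
  exact h4.congr_of_eventuallyEq (Filter.Eventually.of_forall (chart_form_eq φ))

/-- In the coframe `α, Y, Z` of `exists_coframe`, an orthonormal basis has an orthogonal coefficient
matrix, and `α ∧ dα = α ∧ Z ∧ Y` is minus its determinant. -/
theorem isRiemannianVolume_liouvilleVolume (c : ℝ) :
    IsRiemannianVolume (modelBundle c) (sasaki c) liouvilleVolume := fun φ => by
  refine ⟨fun x hx => (contDiffAt_chart_form φ hx).contDiffWithinAt, fun x hx e he => ?_⟩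
  obtain ⟨Y, Z, h⟩ := exists_coframe (φ.mem hx)
  have ht : ∀ i, fderiv ℝ φ.toFun x (e i) ∈ tangentVectors (modelBundle c) (φ.toFun x) := fun i =>
    φ.fderiv_toFun_mem hx _
  set t := fun i => fderiv ℝ φ.toFun x (e i) with ht_def
  set M : Matrix (Fin 3) (Fin 3) ℝ :=
    Matrix.of fun i => ![(φ.toFun x).2 (t i).1, Y (t i), Z (t i)] with hM
  have h1 : M * M.transpose = 1 := by
    ext i j
    have h2 := he i j
    rw [chart_metric_apply, ((h _ (ht i)).2 _ (ht j)).1] at h2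
    rw [Matrix.mul_apply, Fin.sum_univ_three, Matrix.one_apply, ← h2]
    rfl
  have h2 : M.det * M.det = 1 := by
    have := congrArg Matrix.det h1
    rwa [Matrix.det_mul, Matrix.det_transpose, Matrix.det_one] at this
  have h3 : φ.form liouvilleVolume x e = -M.det := by
    rw [Chart.form, ContinuousAlternatingMap.compContinuousLinearMap_apply, liouvilleVolume,
      wedge_apply, Matrix.det_fin_three]
    change pairing (φ.toFun x) (t 0) * antisymmetrize pairing ![t 1, t 2] -
      pairing (φ.toFun x) (t 1) * antisymmetrize pairing ![t 0, t 2] +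
      pairing (φ.toFun x) (t 2) * antisymmetrize pairing ![t 0, t 1] = _
    rw [((h _ (ht 1)).2 _ (ht 2)).2, ((h _ (ht 0)).2 _ (ht 2)).2, ((h _ (ht 0)).2 _ (ht 1)).2]
    simp only [hM, Matrix.of_apply, pairing_apply]
    simp
    ring
  rw [h3, abs_neg, ← sq_eq_sq₀ (abs_nonneg _) zero_le_one, sq_abs, sq, h2, one_pow]

theorem fderiv_chart_field (hx : x ∈ φ.source) :
    fderiv ℝ φ.toFun x (φ.field (geodesicField c) x) = geodesicField c (φ.toFun x) :=
  φ.fderiv_field hx (geodesicField_mem (φ.mem hx))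

theorem chart_metric_field (hx : x ∈ φ.source) :
    φ.metric (sasaki c) x (φ.field (geodesicField c) x) =
      (pairing (φ.toFun x)).comp (fderiv ℝ φ.toFun x) := by
  refine ContinuousLinearMap.ext fun a => ?_
  rw [chart_metric_apply, fderiv_chart_field φ hx,
    sasaki_geodesicField (φ.mem hx) (φ.fderiv_toFun_mem hx a)]
  rfl

theorem hasFDerivAt_chart_liouville (hx : x ∈ φ.source) (a b : Coord 3) :
    ∃ α' : Coord 3 →L[ℝ] Coord 3 →L[ℝ] ℝ, HasFDerivAt
      (fun y => (pairing (φ.toFun y)).comp (fderiv ℝ φ.toFun y)) α' x ∧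
      α' a b - α' b a = pairing (fderiv ℝ φ.toFun x a) (fderiv ℝ φ.toFun x b) -
        pairing (fderiv ℝ φ.toFun x b) (fderiv ℝ φ.toFun x a) := by
  have h1 := (pairing.hasFDerivAt.comp x (φ.hasFDerivAt_toFun hx)).clm_comp
    ((contDiffAt_chart_fderiv φ hx).differentiableAt (by simp)).hasFDerivAt
  refine ⟨_, h1, ?_⟩
  have h2 : fderiv ℝ (fderiv ℝ φ.toFun) x a b = fderiv ℝ (fderiv ℝ φ.toFun) x b a :=
    ((φ.contDiffAt_toFun hx).isSymmSndFDerivAt minSmoothness_two_le) a b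
  simp [h2]

/-- Exterior differentiation commutes with pullback: the second derivative of the chart is symmetric
and drops out of the antisymmetrization. -/
theorem fderiv_chart_liouville (hx : x ∈ φ.source) (a b : Coord 3) :
    fderiv ℝ (fun y => (pairing (φ.toFun y)).comp (fderiv ℝ φ.toFun y)) x a b -
      fderiv ℝ (fun y => (pairing (φ.toFun y)).comp (fderiv ℝ φ.toFun y)) x b a =
      pairing (fderiv ℝ φ.toFun x a) (fderiv ℝ φ.toFun x b) -
        pairing (fderiv ℝ φ.toFun x b) (fderiv ℝ φ.toFun x a) := by
  obtain ⟨α', h1, h2⟩ := hasFDerivAt_chart_liouville φ hx a b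
  rw [h1.fderiv, h2]

/-- `ι_X(α ∧ dα) = α(X) dα - α ∧ ι_X dα = dα`, and `α` is the metric dual of `X`. -/
theorem contract_chart_form (hx : x ∈ φ.source) :
    contract (φ.field (geodesicField c)) (φ.form liouvilleVolume) x =
      extDeriv (flat (φ.metric (sasaki c)) (φ.field (geodesicField c))) x := by
  have hev : flat (φ.metric (sasaki c)) (φ.field (geodesicField c)) =ᶠ[𝓝 x] fun y =>
      ContinuousAlternatingMap.ofSubsingleton ℝ (Coord 3) ℝ (0 : Fin 1)
        ((pairing (φ.toFun y)).comp (fderiv ℝ φ.toFun y)) := by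
    filter_upwards [φ.source_mem_nhds hx] with y hy
    rw [flat, chart_metric_field φ hy]
  obtain ⟨α', hα', -⟩ := hasFDerivAt_chart_liouville φ hx 0 0
  rw [hev.extDeriv_eq, extDeriv_ofSubsingleton hα'.differentiableAt]
  ext v
  rw [antisymmetrize_apply, fderiv_chart_liouville φ hx]
  have hw := φ.mem hx
  have hX := fun a => antisymmetrize_geodesicField hw (φ.fderiv_toFun_mem hx a)
  rw [contract, ContinuousAlternatingMap.curryLeft_apply_apply, chart_form_eq, wedge_apply]
  simp only [antisymmetrize_apply, Matrix.cons_val_zero, Matrix.cons_val_one,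
    ContinuousLinearMap.comp_apply, ContinuousLinearMap.bilinearComp_apply, Matrix.cons_val_two,
    fderiv_chart_field φ hx, hX]
  simp [pairing_apply (φ.toFun x) (geodesicField c _), apply_geodesicField hw]
  rfl

/-- In Cartan's formula `ι_X μ` is exact by the curl equation, and `dμ` is a four-form in dimension
three. -/
theorem isDivergenceFree_geodesicField (c : ℝ) :
    IsDivergenceFree (modelBundle c) liouvilleVolume (geodesicField c) := fun φ x hx => by
  have h1 : contract (φ.field (geodesicField c)) (φ.form liouvilleVolume) =ᶠ[𝓝 x]
      extDeriv (flat (φ.metric (sasaki c)) (φ.field (geodesicField c))) := by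
    filter_upwards [φ.source_mem_nhds hx] with y hy using contract_chart_form φ hy
  have h2 : ContDiffAt ℝ ∞ (flat (φ.metric (sasaki c)) (φ.field (geodesicField c))) x := by
    have h3 : ContDiffAt ℝ ∞ (fun x => (pairing (φ.toFun x)).comp (fderiv ℝ φ.toFun x)) x :=
      (pairing.contDiff.contDiffAt.comp x (φ.contDiffAt_toFun hx)).clm_comp
        (contDiffAt_chart_fderiv φ hx)
    have h4 := (ContinuousAlternatingMap.ofSubsingletonLIE (𝕜 := ℝ) (E := Coord 3)
      (F := ℝ) (0 : Fin 1)).toContinuousLinearEquiv.contDiff.contDiffAt.comp x h3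
    refine h4.congr_of_eventuallyEq ?_
    filter_upwards [φ.source_mem_nhds hx] with y hy
    rw [flat, chart_metric_field φ hy]
    rfl
  rw [lieDeriv, h1.extDeriv_eq, extDeriv_extDeriv_apply h2 minSmoothness_two_le, zero_add,
    contract, eq_zero_of_finrank_lt (extDeriv (φ.form liouvilleVolume) x)
      (by rw [finrank_euclideanSpace_fin]; norm_num)]
  simp

theorem isBeltrami_geodesicField (c : ℝ) :
    IsBeltrami (modelBundle c) (sasaki c) liouvilleVolume (geodesicField c) (fun _ => 1) := by
  refine ⟨isDivergenceFree_geodesicField c, fun φ x hx => ?_⟩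
  simp only [one_smul]
  exact contract_chart_form φ hx

/-- The flow lines of the geodesic field are geodesics of the lifted metric. -/
theorem covariantDeriv_chart_field (hx : x ∈ φ.source) :
    covariantDeriv (φ.metric (sasaki c)) (φ.field (geodesicField c)) (φ.field (geodesicField c)) x =
      0 := by
  set g := φ.metric (sasaki c) with hg
  set Y := φ.field (geodesicField c) with hY
  have hgd : HasFDerivAt g (fderiv ℝ g x) x :=
    ((contDiffAt_chart_metric φ hx).differentiableAt (by simp)).hasFDerivAt
  have hYs : ContDiffAt ℝ ∞ Y x := by
    have h1 : ContDiffAt ℝ ∞ (fderiv ℝ φ.invFun) (φ.toFun x) :=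
      (φ.contDiffAt_invFun (φ.mem_target hx)).fderiv_right (by simp)
    exact (h1.comp x (φ.contDiffAt_toFun hx)).clm_apply
      ((contDiff_geodesicField c).contDiffAt.comp x (φ.contDiffAt_toFun hx))
  have hYd : HasFDerivAt Y (fderiv ℝ Y x) x := (hYs.differentiableAt (by simp)).hasFDerivAt
  have hgY := hgd.clm_apply hYd
  have hw := φ.mem hx
  apply chart_metric_injective φ hx
  refine ContinuousLinearMap.ext fun d => ?_
  have h1 : fderiv ℝ (fun y => g y (Y y)) x =
      fderiv ℝ (fun y => (pairing (φ.toFun y)).comp (fderiv ℝ φ.toFun y)) x := by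
    refine Filter.EventuallyEq.fderiv_eq ?_
    filter_upwards [φ.source_mem_nhds hx] with y hy using chart_metric_field φ hy
  -- The Koszul formula gives `g(∇_Y Y, d) = dY^♭(Y, d) + (1/2) ∂_d g(Y, Y)`. Here `h2` is the
  -- vanishing of the first term and `h5`, below, that of the second.
  have h2 := fderiv_chart_liouville φ hx (Y x) d
  rw [← h1, hgY.fderiv, hY, fderiv_chart_field φ hx,
    antisymmetrize_geodesicField hw (φ.fderiv_toFun_mem hx d)] at h2
  have h3 : HasFDerivAt (fun y => g y (Y y) (Y y)) _ x := hgY.clm_apply hYd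
  have h4 : (fun y => g y (Y y) (Y y)) =ᶠ[𝓝 x] fun _ => 1 := by
    filter_upwards [φ.source_mem_nhds hx] with y hy
    rw [hg, hY, chart_metric_field φ hy, ContinuousLinearMap.comp_apply, fderiv_chart_field φ hy]
    exact apply_geodesicField (φ.mem hy)
  have h5 := DFunLike.congr_fun
    (h3.unique ((hasFDerivAt_const (1 : ℝ) x).congr_of_eventuallyEq h4)) d
  rw [← hg, covariantDeriv, christoffel_apply, map_add, map_smul,
    apply_inverse_self (chart_metric_injective φ hx)]
  have hc : g x (fderiv ℝ Y x d) (Y x) = g x (Y x) (fderiv ℝ Y x d) := chart_metric_comm φ x _ _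
  rw [← hY] at h2
  simp [hc] at h2 h5 ⊢
  linarith

theorem isStationaryEuler_geodesicField (c : ℝ) :
    IsStationaryEuler (modelBundle c) (sasaki c) liouvilleVolume (geodesicField c) := by
  refine ⟨isDivergenceFree_geodesicField c, fun _ => 0, contDiff_const.smoothOn,
    fun φ x hx => ?_⟩
  rw [covariantDeriv_chart_field φ hx, grad]
  have : fderiv ℝ ((fun _ : Phase => (0 : ℝ)) ∘ φ.toFun) x = 0 := by
    simp [Function.comp_def]
  rw [this, map_zero, neg_zero]

end Charts

end Bundle

end KeplerEuler

end

noncomputable section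

namespace KeplerEuler

/-! ### Stereographic projection -/

section Stereo

variable {c : ℝ}

/-- Half the conformal denominator of `stereo c`. -/
def conformal (c : ℝ) (x : Plane) : ℝ := (‖x‖ ^ 2 - 2 * c) / 2

theorem conformal_pos {x : Plane} : 0 < conformal c x ↔ 2 * c < ‖x‖ ^ 2 := by
  unfold conformal
  constructor <;> intro h <;> linarith

theorem norm_sq_eq (c : ℝ) (x : Plane) : ‖x‖ ^ 2 = 2 * conformal c x + 2 * c := by
  unfold conformal; ring

theorem conformal_neg (c : ℝ) (x : Plane) : conformal c (-x) = conformal c x := by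
  unfold conformal; rw [norm_neg]

theorem contDiff_conformal (c : ℝ) : ContDiff ℝ ∞ (conformal c) :=
  ((contDiff_norm_sq ℝ).sub contDiff_const).div_const 2

theorem hasFDerivAt_conformal (c : ℝ) (x : Plane) :
    HasFDerivAt (conformal c) (innerSL ℝ x) x := by
  have h := ((hasStrictFDerivAt_norm_sq x).hasFDerivAt.sub_const (2 * c)).mul_const (2⁻¹ : ℝ)
  refine h.congr_fderiv ?_
  refine ContinuousLinearMap.ext fun u => ?_
  simp

theorem stereo_eq (c : ℝ) (x : Plane) :
    stereo c x = pole c + (conformal c x)⁻¹ • ((x, slope c) : Space) := by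
  unfold stereo conformal slope
  congr 2
  rw [inv_div]

theorem hasFDerivAt_stereo {x : Plane} (hx : conformal c x ≠ 0) :
    HasFDerivAt (stereo c) ((conformal c x)⁻¹ • ContinuousLinearMap.inl ℝ Plane ℝ -
      (innerSL ℝ x).smulRight (((conformal c x) ^ 2)⁻¹ • ((x, slope c) : Space))) x := by
  have h1 := (hasDerivAt_inv hx).comp_hasFDerivAt x (hasFDerivAt_conformal c x)
  have h2 : HasFDerivAt (fun y : Plane => ((y, slope c) : Space))
      (ContinuousLinearMap.inl ℝ Plane ℝ) x := hasFDerivAt_prodMk_left x (slope c)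
  have h3 := (h1.smul h2).const_add (pole c)
  have h4 : stereo c = fun y => pole c + ((fun y : ℝ => y⁻¹) ∘ conformal c) y •
      ((y, slope c) : Space) := funext fun y => stereo_eq c y
  rw [h4]
  refine h3.congr_fderiv ?_
  refine ContinuousLinearMap.ext fun u => ?_
  change (conformal c x)⁻¹ • ((u, 0) : Space) + ((-((conformal c x) ^ 2)⁻¹) * ⟪x, u⟫) • _ =
    (conformal c x)⁻¹ • ((u, 0) : Space) - ⟪x, u⟫ • (((conformal c x) ^ 2)⁻¹ • _)
  rw [smul_smul, neg_mul, neg_smul, mul_comm, sub_eq_add_neg]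

theorem fderiv_stereo {x : Plane} (hx : conformal c x ≠ 0) (u : Plane) :
    fderiv ℝ (stereo c) x u = (conformal c x)⁻¹ • ((u, 0) : Space) -
      (⟪x, u⟫ * ((conformal c x) ^ 2)⁻¹) • ((x, slope c) : Space) := by
  rw [(hasFDerivAt_stereo hx).fderiv]
  simp only [sub_apply, smul_apply, ContinuousLinearMap.smulRight_apply, smul_smul]
  rfl

/-- The map `stereo c` is conformal. -/
theorem stereo_conformal {x : Plane} (hx : conformal c x ≠ 0) (u u' : Plane) :
    ambientForm c (fderiv ℝ (stereo c) x u) (fderiv ℝ (stereo c) x u') =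
      ((conformal c x) ^ 2)⁻¹ * ⟪u, u'⟫ := by
  rw [fderiv_stereo hx, fderiv_stereo hx]
  have h1 := norm_sq_eq c x
  have h2 := signature_mul_slope c
  have h3 : ∀ a b : Space, ambientForm c a b = ⟪a.1, b.1⟫ + signature c * (a.2 * b.2) :=
    ambientForm_eq c
  rw [h3]
  simp only [Prod.fst_sub, Prod.snd_sub, Prod.smul_fst, Prod.smul_snd, inner_sub_left,
    inner_sub_right, real_inner_smul_left, real_inner_smul_right, smul_eq_mul,
    real_inner_self_eq_norm_sq, real_inner_comm x u, h1]
  set r := conformal c x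
  field_simp
  linear_combination (⟪x, u⟫ * ⟪x, u'⟫) * h2

/-- The squared chord from the pole determines the conformal denominator, so the denominator can be
read off the image point; this makes `stereo` explicitly invertible through `chordal`. -/
theorem ambientForm_stereo {x : Plane} (hx : conformal c x ≠ 0) :
    ambientForm c (stereo c x - pole c) (stereo c x - pole c) = 2 / conformal c x := by
  have h1 := norm_sq_eq c x
  have h2 := signature_mul_slope c
  rw [stereo_eq, add_sub_cancel_left, ambientForm_eq]
  simp only [Prod.smul_fst, Prod.smul_snd, real_inner_smul_left, real_inner_smul_right,
    smul_eq_mul]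
  rw [real_inner_self_eq_norm_sq, h1]
  field_simp
  linear_combination h2

theorem slope_pos (hc : 0 < c) : 0 < slope c := by
  have := pole_pos hc.ne'
  rw [← two_mul_pole c]; positivity

theorem stereo_mem {x : Plane} (hx : 0 < conformal c x) :
    stereo c x ∈ modelSurface c \ {pole c} := by
  have h1 := ambientForm_stereo hx.ne'
  refine ⟨(mem_modelSurface_iff c _).2 ⟨?_, fun hc => ?_⟩, fun h => ?_⟩
  · rw [defect, h1, stereo_eq, add_sub_cancel_left]
    simp only [Prod.smul_snd, smul_eq_mul]
    field_simp
    ring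
  · rw [stereo_eq]
    simp only [Prod.snd_add, Prod.smul_snd, smul_eq_mul]
    have := pole_pos hc.ne'
    have := slope_pos hc
    positivity
  · rw [mem_singleton_iff] at h
    rw [h, sub_self, map_zero] at h1
    exact (div_pos two_pos hx).ne h1

theorem slope_mul_pole (hc : 0 < c) : slope c * (pole c).2 = 1 := by
  have h2 := signature_mul_slope c
  rw [signature, if_pos hc] at h2
  apply mul_left_cancel₀ (slope_pos hc).ne'
  linear_combination two_mul_pole c - (pole c).2 * h2

/-- Chords from the pole are spacelike. -/
theorem ambientForm_chord_pos {m : Space} (hm : m ∈ modelSurface c) (h0 : m ≠ pole c) :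
    0 < ambientForm c (m - pole c) (m - pole c) := by
  have hm' := (mem_modelSurface_iff c m).1 hm
  have hk : m - pole c ≠ 0 := sub_ne_zero.2 h0
  have hd := hm'.1
  unfold defect at hd
  rcases lt_or_ge 0 c with hc | hc
  · have hs := slope_pos hc
    have hsig : signature c = -1 := by simp [signature, hc]
    have hm2 := hm'.2 hc
    have hB := ambientForm_eq c (m - pole c) (m - pole c)
    have hnn := sq_nonneg ‖(m - pole c).1‖
    have hz : ‖(m - pole c).1‖ ^ 2 = 0 → (m - pole c).2 ≠ 0 := fun h1 h2 =>
      hk (Prod.ext (norm_eq_zero.1 (pow_eq_zero_iff two_ne_zero |>.1 h1)) h2)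
    rw [hsig, real_inner_self_eq_norm_sq] at hB
    set b := ambientForm c (m - pole c) (m - pole c)
    set y := (m - pole c).2 with hy
    have hym : y = m.2 - (pole c).2 := rfl
    set N := ‖(m - pole c).1‖ ^ 2
    have h4 := slope_mul_pole hc
    -- Suppose the squared chord `b` is not positive. The surface equation gives `y ≤ 0`, and on the
    -- upper sheet `slope c * y > -1`. Then `slope c * N = y (slope c * y + 2)` has a nonnegative
    -- left and a nonpositive right side, which forces `y = 0` and `N = 0`, so the chord vanishes.
    by_contra hb
    push Not at hb
    have hy0 : y ≤ 0 := by nlinarith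
    have h5 : 0 < slope c * y + 2 := by
      have : 0 < slope c * m.2 := by positivity
      nlinarith
    have h6 : slope c * N = y * (slope c * y + 2) := by
      linear_combination -slope c * hB - 2 * hd
    have h7 : 0 ≤ slope c * N := by positivity
    have h8 : y = 0 := by
      by_contra h
      have : y < 0 := lt_of_le_of_ne hy0 h
      nlinarith [mul_pos_of_neg_of_neg this (neg_neg_of_pos h5)]
    rw [h8, zero_mul] at h6
    exact hz ((mul_eq_zero.1 h6).resolve_left hs.ne') h8
  · have hsig : signature c = 1 := by simp [signature, hc.not_gt]
    rw [ambientForm_eq, hsig, real_inner_self_eq_norm_sq]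
    by_cases h1 : (m - pole c).1 = 0
    · have h2 : (m - pole c).2 ≠ 0 := fun h2 => hk (Prod.ext h1 h2)
      have := mul_self_pos.2 h2
      have := sq_nonneg ‖(m - pole c).1‖
      linarith
    · have h2 : 0 < ‖(m - pole c).1‖ ^ 2 := by
        have := norm_pos_iff.2 h1
        positivity
      have := mul_self_nonneg (m - pole c).2
      linarith

/-- The conformal denominator as a function on the model surface. -/
def chordal (c : ℝ) (m : Space) : ℝ := 2 / ambientForm c (m - pole c) (m - pole c)

theorem chordal_stereo {x : Plane} (hx : conformal c x ≠ 0) :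
    chordal c (stereo c x) = conformal c x := by
  rw [chordal, ambientForm_stereo hx]; field_simp

/-- With `b` the squared chord, the surface equation makes the chord's height `slope c * b / 2`,
hence its horizontal part has square `b + c b² / 2`; rescaling by `2 / b` yields the denominator `2
/ b`. -/
theorem conformal_chordal {m : Space} (hm : m ∈ modelSurface c) (h0 : m ≠ pole c) :
    conformal c (chordal c m • (m - pole c).1) = chordal c m := by
  have h1 := ambientForm_chord_pos hm h0
  have h2 := ((mem_modelSurface_iff c m).1 hm).1
  have h3 := signature_mul_slope c
  have h4 := ambientForm_eq c (m - pole c) (m - pole c)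
  rw [real_inner_self_eq_norm_sq] at h4
  unfold defect at h2
  unfold conformal chordal
  rw [norm_smul, mul_pow, Real.norm_eq_abs, sq_abs]
  set b := ambientForm c (m - pole c) (m - pole c)
  have h5 : b ≠ 0 := h1.ne'
  field_simp
  have h6 : (m - pole c).2 = slope c / 2 * b := by linarith
  rw [h6] at h4
  linear_combination (-2) * h4 - b ^ 2 / 2 * h3

theorem stereo_chordal {m : Space} (hm : m ∈ modelSurface c) (h0 : m ≠ pole c) :
    stereo c (chordal c m • (m - pole c).1) = m := by
  have h1 := ambientForm_chord_pos hm h0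
  have h2 := ((mem_modelSurface_iff c m).1 hm).1
  have h3 : chordal c m ≠ 0 := (div_pos two_pos h1).ne'
  rw [stereo_eq, conformal_chordal hm h0]
  have h4 : (chordal c m)⁻¹ • ((chordal c m • (m - pole c).1, slope c) : Space) = m - pole c := by
    refine Prod.ext ?_ ?_
    · simp only [Prod.smul_fst]
      rw [inv_smul_smul₀ h3]
    · simp only [Prod.smul_snd, smul_eq_mul, chordal, inv_div]
      unfold defect at h2
      linarith
  rw [h4, add_sub_cancel]

theorem bijOn_stereo (c : ℝ) :
    BijOn (stereo c) {x | 2 * c < ‖x‖ ^ 2} (modelSurface c \ {pole c}) := by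
  refine ⟨fun x hx => stereo_mem (conformal_pos.2 hx), fun x hx y hy h => ?_, fun m hm => ?_⟩
  · have hx' := (conformal_pos.2 hx).ne'
    have hy' := (conformal_pos.2 hy).ne'
    have h1 := chordal_stereo hx'
    rw [h, chordal_stereo hy'] at h1
    rw [stereo_eq, stereo_eq, h1, add_right_inj] at h
    have := congrArg Prod.fst h
    exact smul_right_injective _ (inv_ne_zero hx') this
  · refine ⟨chordal c m • (m - pole c).1, ?_, stereo_chordal hm.1 hm.2⟩
    rw [mem_ofPred_eq, ← conformal_pos, conformal_chordal hm.1 hm.2]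
    exact div_pos two_pos (ambientForm_chord_pos hm.1 hm.2)

end Stereo

/-! ### The regularization map -/

section Regularization

variable {c : ℝ}

/-- The velocity of the geodesic that corresponds to the state `(q, p)`. -/
def regVelocity (c : ℝ) (z : Plane × Plane) : Space :=
  (conformal c z.2 • z.1 - ⟪z.2, z.1⟫ • z.2, slope c * ⟪z.2, z.1⟫)

/-- By conformality, raising the index of `⟪q, ·⟫` is multiplication of `q` by the squared
denominator; the formula is the image of that vector under the derivative of `stereo`. -/
theorem regMap_eq {z : Plane × Plane} (hz : 0 < conformal c z.2) :
    regMap c z = (stereo c (-z.2), ambientForm c (regVelocity c z)) := by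
  have hz' : conformal c (-z.2) ≠ 0 := by rw [conformal_neg]; exact hz.ne'
  set g := (ambientForm c).bilinearComp (fderiv ℝ (stereo c) (-z.2)) (fderiv ℝ (stereo c) (-z.2))
    with hg
  have hgi : ∀ u u', g u u' = ((conformal c (-z.2)) ^ 2)⁻¹ * ⟪u, u'⟫ := fun u u' =>
    stereo_conformal hz' u u'
  have h1 : Function.Injective g := by
    rw [injective_iff_map_eq_zero]
    intro a ha
    have := hgi a a
    rw [ha] at this
    have h2 := (mul_eq_zero.1 this.symm).resolve_left (inv_ne_zero (pow_ne_zero 2 hz'))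
    exact inner_self_eq_zero.1 h2
  have h2 : g ((conformal c (-z.2)) ^ 2 • z.1) = innerSL ℝ z.1 := by
    refine ContinuousLinearMap.ext fun u => ?_
    rw [hgi, real_inner_smul_left, ← mul_assoc, inv_mul_cancel₀ (pow_ne_zero 2 hz'), one_mul]
    rfl
  rw [regMap, cotangentLift]
  simp only
  rw [← hg, ← h2, inverse_apply_self h1]
  congr 2
  rw [fderiv_stereo hz', regVelocity, conformal_neg]
  have h3 : conformal c z.2 ≠ 0 := hz.ne'
  refine Prod.ext ?_ ?_
  · simp only [Prod.fst_sub, Prod.smul_fst, smul_smul, real_inner_smul_right, inner_neg_left,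
      smul_neg]
    congr 1
    · congr 1; field_simp
    · rw [← neg_smul]; congr 1; field_simp
  · simp only [Prod.snd_sub, Prod.smul_snd, smul_eq_mul, real_inner_smul_right, inner_neg_left]
    field_simp
    ring

theorem contDiffAt_stereo {x : Plane} (hx : conformal c x ≠ 0) : ContDiffAt ℝ ∞ (stereo c) x := by
  have h : stereo c = fun y => pole c + (conformal c y)⁻¹ • ((y, slope c) : Space) :=
    funext (stereo_eq c)
  rw [h]
  exact contDiffAt_const.add (((contDiff_conformal c).contDiffAt.inv hx).smul
    (contDiffAt_id.prodMk contDiffAt_const))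

theorem contDiff_regVelocity (c : ℝ) : ContDiff ℝ ∞ (regVelocity c) := by
  have h1 : ContDiff ℝ ∞ (fun z : Plane × Plane => ⟪z.2, z.1⟫) := contDiff_snd.inner ℝ contDiff_fst
  exact ((((contDiff_conformal c).comp contDiff_snd).smul contDiff_fst).sub
    (h1.smul contDiff_snd)).prodMk (contDiff_const.mul h1)

theorem isOpen_conformal_pos (c : ℝ) : IsOpen {z : Plane × Plane | 0 < conformal c z.2} :=
  isOpen_lt continuous_const ((contDiff_conformal c).continuous.comp continuous_snd)

theorem regMap_eventuallyEq {z : Plane × Plane} (hz : 0 < conformal c z.2) :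
    regMap c =ᶠ[𝓝 z] fun z => (stereo c (-z.2), ambientForm c (regVelocity c z)) := by
  filter_upwards [(isOpen_conformal_pos c).mem_nhds hz] with y hy using regMap_eq hy

theorem contDiffAt_regMap {z : Plane × Plane} (hz : 0 < conformal c z.2) :
    ContDiffAt ℝ ∞ (regMap c) z := by
  have hz' : conformal c (-z.2) ≠ 0 := by rw [conformal_neg]; exact hz.ne'
  have h1 : ContDiffAt ℝ ∞ (fun z : Plane × Plane => stereo c (-z.2)) z :=
    ContDiffAt.comp (g := stereo c) (f := fun z : Plane × Plane => -z.2) z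
      (contDiffAt_stereo hz') contDiffAt_snd.neg
  exact (h1.prodMk ((ambientForm c).contDiff.contDiffAt.comp z
    (contDiff_regVelocity c).contDiffAt)).congr_of_eventuallyEq (regMap_eventuallyEq hz)

/-- On the energy level the conformal denominator is the inverse distance to the centre. -/
theorem mem_energyLevel_iff (z : Plane × Plane) :
    z ∈ energyLevel c ↔ z.1 ≠ 0 ∧ ‖z.1‖ * conformal c z.2 = 1 := by
  refine and_congr_right fun h => ?_
  have h1 : ‖z.1‖ ≠ 0 := norm_ne_zero_iff.2 h
  unfold keplerH conformal
  constructor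
  · intro h2
    field_simp at h2 ⊢
    linarith
  · intro h2
    field_simp at h2 ⊢
    linarith

theorem conformal_pos_of_mem {z : Plane × Plane} (hz : z ∈ energyLevel c) :
    0 < conformal c z.2 := by
  obtain ⟨h1, h2⟩ := (mem_energyLevel_iff z).1 hz
  have h3 := norm_pos_iff.2 h1
  by_contra h
  have := mul_nonpos_of_nonneg_of_nonpos h3.le (not_lt.1 h)
  linarith

/-- The quantity `⟪p, q⟫` is visible on the surface as the pairing of chord and velocity. This
yields both the tangency of the velocity and the term needed to invert the map. -/
theorem chord_regVelocity {z : Plane × Plane} (hz : 0 < conformal c z.2) :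
    ambientForm c (stereo c (-z.2) - pole c) (regVelocity c z) = ⟪z.2, z.1⟫ := by
  have h1 := norm_sq_eq c z.2
  have h2 := signature_mul_slope c
  rw [stereo_eq, add_sub_cancel_left, ambientForm_eq, conformal_neg, regVelocity]
  simp only [Prod.smul_fst, Prod.smul_snd, real_inner_smul_left, inner_neg_left, inner_sub_right,
    real_inner_smul_right, smul_eq_mul, real_inner_self_eq_norm_sq, h1]
  field_simp
  linear_combination ⟪z.2, z.1⟫ * h2

/-- The right side is `2 K_c`: the regularized Hamiltonian is the kinetic energy of the geodesic
flow. -/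
theorem regVelocity_self (z : Plane × Plane) :
    ambientForm c (regVelocity c z) (regVelocity c z) = (‖z.1‖ * conformal c z.2) ^ 2 := by
  have h1 := norm_sq_eq c z.2
  have h2 := signature_mul_slope c
  rw [ambientForm_eq, regVelocity]
  simp only [inner_sub_left, inner_sub_right, real_inner_smul_left, real_inner_smul_right]
  rw [real_inner_self_eq_norm_sq, real_inner_self_eq_norm_sq, h1, real_inner_comm z.2 z.1]
  linear_combination ⟪z.2, z.1⟫ ^ 2 * h2

/-- The inverse of the regularization map. -/
def regInv (c : ℝ) (w : Phase) : Plane × Plane :=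
  ((chordal c w.1)⁻¹ • (((lower c).symm w.2).1 -
    (w.2 (w.1 - pole c) * chordal c w.1) • (w.1 - pole c).1), -(chordal c w.1 • (w.1 - pole c).1))

theorem regInv_regMap {z : Plane × Plane} (hz : 0 < conformal c z.2) :
    regInv c (regMap c z) = z := by
  have hz' : conformal c (-z.2) ≠ 0 := by rw [conformal_neg]; exact hz.ne'
  have h0 := hz.ne'
  rw [regMap_eq hz, regInv]
  simp only
  rw [chordal_stereo hz', lower_symm_ambientForm, ambientForm_comm, chord_regVelocity hz,
    stereo_eq, add_sub_cancel_left, conformal_neg, regVelocity]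
  simp only [Prod.smul_fst, smul_neg, smul_smul, mul_inv_cancel_right₀ h0, mul_inv_cancel₀ h0,
    one_smul, sub_neg_eq_add, sub_add_cancel, neg_neg, inv_mul_cancel₀ h0]

theorem bijOn_regMap (c : ℝ) : BijOn (regMap c) (energyLevel c) (collisionFree c) := by
  refine ⟨fun z hz => ?_, fun z hz z' hz' h => ?_, fun w hw => ?_⟩
  · have h1 := conformal_pos_of_mem hz
    have h2 := stereo_mem (c := c) (x := -z.2) (by rwa [conformal_neg])
    rw [regMap_eq h1]
    refine ⟨(mk_mem_modelBundle_iff _ _).2 ⟨h2.1, ?_, ?_⟩, h2.2⟩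
    · rw [ambientForm_normal, chord_regVelocity h1, regVelocity, sub_self]
    · rw [regVelocity_self, ((mem_energyLevel_iff z).1 hz).2, one_pow]
  · rw [← regInv_regMap (conformal_pos_of_mem hz), h, regInv_regMap (conformal_pos_of_mem hz')]
  · obtain ⟨hw, h0⟩ := hw
    obtain ⟨m, ξ⟩ := w
    obtain ⟨v, hv, hν, hvv⟩ := exists_dual hw
    have hm := ((mem_modelBundle_iff _).1 hw).1
    simp only at hv hν hm h0
    subst hv
    have h3 := div_pos two_pos (ambientForm_chord_pos hm h0)
    have h4 := conformal_chordal hm h0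
    have h5 := stereo_chordal hm h0
    have h6 := ((mem_modelSurface_iff c m).1 hm).1
    change 0 < chordal c m at h3
    have h7 : chordal c m * (m - pole c).2 = slope c := by
      unfold defect at h6
      have h8 := (ambientForm_chord_pos hm h0).ne'
      unfold chordal
      field_simp
      linarith
    set r := chordal c m with hr
    set k := m - pole c with hk
    set δ := ambientForm c v k with hδ
    have hδ' : ambientForm c k v = δ := ambientForm_comm _ _ _
    rw [ambientForm_normal, hδ'] at hν
    set z : Plane × Plane := regInv c (m, ambientForm c v) with hz
    have hz2 : z.2 = -(r • k.1) := rfl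
    have hz1 : z.1 = r⁻¹ • (v.1 - (δ * r) • k.1) := by
      rw [hz, regInv]
      simp only [lower_symm_ambientForm]
      rfl
    have hc : conformal c z.2 = r := by rw [hz2, conformal_neg, h4]
    -- The heights of `v` and of the chord are known from tangency and from the surface equation, so
    -- the pairing `δ` determines the horizontal inner product; `e2` supplies the length of the
    -- rescaled chord.
    have hin : ⟪z.2, z.1⟫ = δ := by
      have e1 : ⟪v.1, k.1⟫ + signature c * (v.2 * k.2) = δ := rfl
      have e2 : ‖r • k.1‖ ^ 2 = 2 * r + 2 * c := by rw [norm_sq_eq c, h4]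
      rw [norm_smul, mul_pow, Real.norm_eq_abs, sq_abs] at e2
      have e3 := signature_mul_slope c
      have e4 : v.2 = slope c * δ := by linarith
      rw [hz1, hz2]
      simp only [inner_neg_left, real_inner_smul_left, real_inner_smul_right, inner_sub_right,
        real_inner_self_eq_norm_sq, real_inner_comm v.1 k.1]
      have hri : r * r⁻¹ = 1 := mul_inv_cancel₀ h3.ne'
      rw [e4] at e1
      apply mul_left_cancel₀ h3.ne'
      linear_combination (-r) * e1 + δ * e2 + signature c * slope c * δ * h7 + δ * e3 -
        (r * ⟪v.1, k.1⟫ - r ^ 2 * δ * ‖k.1‖ ^ 2) * hri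
    have hvel : regVelocity c z = v := by
      rw [regVelocity, hc, hin]
      refine Prod.ext ?_ ?_
      · simp only [hz1, hz2, smul_inv_smul₀ h3.ne', smul_neg, smul_smul, sub_neg_eq_add,
          sub_add_cancel]
      · simp only; linarith
    have hcp : 0 < conformal c z.2 := by rw [hc]; exact h3
    refine ⟨z, (mem_energyLevel_iff z).2 ?_, ?_⟩
    · have h8 := regVelocity_self (c := c) z
      rw [hvel, hvv] at h8
      have h9 : ‖z.1‖ * conformal c z.2 = 1 := by
        have : 0 ≤ ‖z.1‖ * conformal c z.2 := by positivity
        rwa [eq_comm, pow_eq_one_iff_of_nonneg this two_ne_zero] at h8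
      refine ⟨fun h => ?_, h9⟩
      rw [h, norm_zero, zero_mul] at h9
      exact zero_ne_one h9
    · rw [regMap_eq hcp, hvel, hz2, neg_neg, h5]

theorem contDiffOn_regInv (c : ℝ) : ContDiffOn ℝ ∞ (regInv c)
    {w | 0 < ambientForm c (w.1 - pole c) (w.1 - pole c)} := by
  intro w hw
  have h1 : ContDiffAt ℝ ∞ (fun w : Phase => w.1 - pole c) w := contDiffAt_fst.sub contDiffAt_const
  have h2 : ContDiffAt ℝ ∞ (fun w : Phase => ambientForm c (w.1 - pole c) (w.1 - pole c)) w :=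
    ((ambientForm c).contDiff.contDiffAt.comp w h1).clm_apply h1
  have h3 : ContDiffAt ℝ ∞ (fun w : Phase => chordal c w.1) w := contDiffAt_const.div h2 hw.ne'
  have h4 : chordal c w.1 ≠ 0 := (div_pos two_pos hw).ne'
  have h5 : ContDiffAt ℝ ∞ (fun w : Phase => ((lower c).symm w.2).1) w :=
    ((lower c).symm.contDiff.contDiffAt.comp w contDiffAt_snd).fst
  exact (((h3.inv h4).smul (h5.sub (((contDiffAt_snd.clm_apply h1).mul h3).smul h1.fst))).prodMk
    (h3.smul h1.fst).neg).contDiffWithinAt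

/-! ### The Hamiltonian fields and their image under the regularization map. -/

theorem gradient_eq {f : Plane → ℝ} {f' : Plane →L[ℝ] ℝ} {x g : Plane} (h : HasFDerivAt f f' x)
    (hg : ∀ u, f' u = ⟪g, u⟫) : gradient f x = g := by
  refine HasGradientAt.gradient (hasGradientAt_iff_hasFDerivAt.2 (h.congr_fderiv ?_))
  refine ContinuousLinearMap.ext fun u => ?_
  rw [hg, InnerProductSpace.toDual_apply_apply]

theorem hamiltonianField_regularizedK (c : ℝ) (z : Plane × Plane) :
    hamiltonianField (regularizedK c) z =
      ((‖z.1‖ ^ 2 * conformal c z.2) • z.2, -((conformal c z.2) ^ 2 • z.1)) := by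
  refine Prod.ext ?_ ?_
  · have h := ((hasFDerivAt_conformal c z.2).pow 2).const_mul (‖z.1‖ ^ 2 / 2)
    refine gradient_eq (f := fun p => regularizedK c (z.1, p)) h fun u => ?_
    simp [real_inner_smul_left]
    ring
  · have h := ((hasStrictFDerivAt_norm_sq z.1).hasFDerivAt.mul_const (2⁻¹ : ℝ)).mul_const
      ((conformal c z.2) ^ 2)
    refine congrArg Neg.neg (gradient_eq (f := fun q => regularizedK c (q, z.2)) h fun u => ?_)
    simp [real_inner_smul_left]

theorem hamiltonianField_keplerH {z : Plane × Plane} (hz : z.1 ≠ 0) :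
    hamiltonianField keplerH z = (z.2, -((‖z.1‖ ^ 3)⁻¹ • z.1)) := by
  have h0 : ‖z.1‖ ≠ 0 := norm_ne_zero_iff.2 hz
  refine Prod.ext ?_ ?_
  · have h := ((hasStrictFDerivAt_norm_sq z.2).hasFDerivAt.mul_const (2⁻¹ : ℝ)).sub_const
      (1 / ‖z.1‖)
    refine gradient_eq (f := fun p => keplerH (z.1, p)) h fun u => ?_
    simp
  · have h1 := (hasStrictFDerivAt_norm_sq z.1).hasFDerivAt.sqrt (pow_ne_zero 2 h0)
    have h2 : (fun q : Plane => √(‖q‖ ^ 2)) = fun q => ‖q‖ :=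
      funext fun q => Real.sqrt_sq (norm_nonneg q)
    rw [h2, Real.sqrt_sq (norm_nonneg _)] at h1
    have h := ((hasDerivAt_inv h0).comp_hasFDerivAt z.1 h1).const_sub (‖z.2‖ ^ 2 / 2)
    have h3 : (fun q : Plane => ‖z.2‖ ^ 2 / 2 - ((fun y : ℝ => y⁻¹) ∘ fun q : Plane => ‖q‖) q) =
      fun q => keplerH (q, z.2) := by
      funext q; simp [keplerH]
    rw [h3] at h
    refine congrArg Neg.neg (gradient_eq (f := fun q => keplerH (q, z.2)) h fun u => ?_)
    simp [real_inner_smul_left]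
    field_simp

/-- The time change between the Kepler problem and its regularization. -/
theorem hamiltonianField_regularizedK_eq {z : Plane × Plane} (hz : z ∈ energyLevel c) :
    hamiltonianField (regularizedK c) z = ‖z.1‖ • hamiltonianField keplerH z := by
  obtain ⟨h1, h2⟩ := (mem_energyLevel_iff z).1 hz
  have h0 : ‖z.1‖ ≠ 0 := norm_ne_zero_iff.2 h1
  have h3 : conformal c z.2 = ‖z.1‖⁻¹ := by
    exact eq_inv_of_mul_eq_one_right h2
  rw [hamiltonianField_regularizedK, hamiltonianField_keplerH h1, h3]
  refine Prod.ext ?_ ?_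
  · simp only [Prod.smul_fst]
    congr 1; field_simp
  · simp only [Prod.smul_snd, smul_neg, smul_smul]
    congr 2; field_simp

/-- The regularized Kepler field is carried to the geodesic field. -/
theorem fderiv_regMap_hamiltonianField {z : Plane × Plane} (hz : z ∈ energyLevel c) :
    fderiv ℝ (regMap c) z (hamiltonianField (regularizedK c) z) = geodesicField c (regMap c z) := by
  have hp := conformal_pos_of_mem hz
  have h0 := hp.ne'
  have hz' : conformal c (-z.2) ≠ 0 := by rw [conformal_neg]; exact h0
  have hE : ‖z.1‖ ^ 2 * conformal c z.2 ^ 2 = 1 := by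
    rw [← mul_pow, ((mem_energyLevel_iff z).1 hz).2, one_pow]
  have hN := norm_sq_eq c z.2
  have hfst := hasFDerivAt_fst (𝕜 := ℝ) (p := z)
  have hsnd := hasFDerivAt_snd (𝕜 := ℝ) (p := z)
  have h1 := (hasFDerivAt_stereo hz').comp z hsnd.neg
  have h2 := (hasFDerivAt_conformal c z.2).comp z hsnd
  have h3 := hsnd.inner ℝ hfst
  have h4 := ((h2.smul hfst).sub (h3.smul hsnd)).prodMk (h3.const_mul (slope c))
  have h5 : HasFDerivAt (fun z => (stereo c (-z.2), ambientForm c (regVelocity c z))) _ z :=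
    h1.prodMk ((ambientForm c).hasFDerivAt.comp z h4)
  rw [(regMap_eventuallyEq hp).fderiv_eq, h5.fderiv, regMap_eq hp, geodesicField,
    hamiltonianField_regularizedK]
  simp only [lower_symm_ambientForm]
  -- This is the derivative of `⟪p, q⟫` along the regularized flow, simplified by `|q|` times the
  -- conformal denominator being one. Times `slope c`, it must match `2c` times the height of the
  -- image point.
  have hδ : ⟪z.2, (‖z.1‖ ^ 2 * conformal c z.2) • z.2⟫ + ⟪-(conformal c z.2 ^ 2 • z.1), z.1⟫ =
      1 + 2 * c * (conformal c z.2)⁻¹ := by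
    rw [inner_neg_left, real_inner_smul_left, real_inner_smul_right, real_inner_self_eq_norm_sq,
      real_inner_self_eq_norm_sq, hN]
    field_simp
    linear_combination (conformal c z.2 + 2 * c) * hE
  refine Prod.ext ?_ ?_
  · change (conformal c (-z.2))⁻¹ • ((-(-(conformal c z.2 ^ 2 • z.1)), 0) : Space) -
      ⟪-z.2, -(-(conformal c z.2 ^ 2 • z.1))⟫ •
        ((conformal c (-z.2) ^ 2)⁻¹ • ((-z.2, slope c) : Space)) = _
    rw [regVelocity, conformal_neg]
    refine Prod.ext ?_ ?_
    · simp only [Prod.fst_sub, Prod.smul_fst, neg_neg, inner_neg_left, real_inner_smul_right,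
        smul_smul, smul_neg]
      congr 1
      · congr 1; field_simp
      · field_simp
        rw [neg_smul, neg_neg]
    · simp only [Prod.snd_sub, Prod.smul_snd, neg_neg, inner_neg_left, real_inner_smul_right,
        smul_eq_mul]
      field_simp
      ring
  · change ambientForm c (conformal c z.2 • ((‖z.1‖ ^ 2 * conformal c z.2) • z.2) +
        ⟪z.2, -(conformal c z.2 ^ 2 • z.1)⟫ • z.1 -
        (⟪z.2, z.1⟫ • -(conformal c z.2 ^ 2 • z.1) +
          (⟪z.2, (‖z.1‖ ^ 2 * conformal c z.2) • z.2⟫ + ⟪-(conformal c z.2 ^ 2 • z.1), z.1⟫) • z.2),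
        slope c * (⟪z.2, (‖z.1‖ ^ 2 * conformal c z.2) • z.2⟫ +
          ⟪-(conformal c z.2 ^ 2 • z.1), z.1⟫)) = _
    rw [hδ, ← map_smul]
    congr 1
    have hE' : conformal c z.2 * (‖z.1‖ ^ 2 * conformal c z.2) = 1 := by linarith
    rw [stereo_eq, conformal_neg]
    refine Prod.ext ?_ ?_
    · simp only [smul_smul, hE', inner_neg_right, real_inner_smul_right, Prod.smul_fst,
        Prod.fst_add, pole_fst, zero_add, smul_neg, neg_smul, add_smul, one_smul]
      rw [mul_comm (conformal c z.2 ^ 2)]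
      abel
    · simp only [Prod.smul_snd, Prod.snd_add, smul_eq_mul]
      linear_combination -two_mul_pole c

theorem isRegularizedField_geodesicField (c : ℝ) : IsRegularizedField c (geodesicField c) := by
  refine ⟨bijOn_stereo c, bijOn_regMap c, fun z hz =>
    (contDiffAt_regMap (conformal_pos.2 hz)).contDiffWithinAt,
    ⟨{w | 0 < ambientForm c (w.1 - pole c) (w.1 - pole c)}, regInv c, ?_, fun w hw => ?_,
      contDiffOn_regInv c, fun z hz => regInv_regMap (conformal_pos_of_mem hz)⟩,
    fun z hz => fderiv_regMap_hamiltonianField hz⟩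
  · refine isOpen_lt continuous_const ?_
    have h1 : Continuous (fun w : Phase => w.1 - pole c) := continuous_fst.sub continuous_const
    exact ((ambientForm c).continuous.comp h1).clm_apply h1
  · exact ambientForm_chord_pos ((mem_modelBundle_iff w).1 hw.1).1 hw.2

end Regularization

end KeplerEuler

end

noncomputable section

namespace KeplerEuler

/-! ### Completeness of the geodesic field -/

section Flow

variable {c : ℝ}

/-- Generalized trigonometric functions. -/
theorem exists_trig (c : ℝ) : ∃ C S D : ℝ → ℝ, (∀ t, HasDerivAt S (C t) t) ∧
    (∀ t, HasDerivAt D (S t) t) ∧ (∀ t, C t = 1 + 2 * c * D t) ∧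
    (∀ t, S t ^ 2 = 2 * D t + 2 * c * D t ^ 2) ∧ S 0 = 0 ∧ D 0 = 0 := by
  rcases lt_trichotomy c 0 with hc | rfl | hc
  · set a := √(-2 * c)
    have ha : a * a = -2 * c := Real.mul_self_sqrt (by linarith)
    have ha0 : a ≠ 0 := (Real.sqrt_pos.2 (by linarith)).ne'
    have h2c : 2 * c = -(a * a) := by linarith
    have hid : ∀ t : ℝ, HasDerivAt (fun t => a * t) a t := fun t => by
      simpa using (hasDerivAt_id t).const_mul a
    refine ⟨fun t => Real.cos (a * t), fun t => Real.sin (a * t) / a,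
      fun t => (1 - Real.cos (a * t)) / (a * a), fun t => ?_, fun t => ?_, fun t => ?_,
      fun t => ?_, by simp, by simp⟩
    · exact ((hid t).sin.div_const a).congr_deriv (by field_simp)
    · exact (((hid t).cos.const_sub 1).div_const (a * a)).congr_deriv (by field_simp)
    · simp only [h2c]; field_simp; ring
    · have := Real.sin_sq_add_cos_sq (a * t)
      simp only [h2c]; field_simp
      linear_combination this
  · refine ⟨fun _ => 1, fun t => t, fun t => t ^ 2 / 2, hasDerivAt_id, fun t => ?_, by simp,
      fun t => by ring, rfl, by simp⟩
    exact ((hasDerivAt_pow 2 t).div_const 2).congr_deriv (by norm_num)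
  · set a := √(2 * c)
    have ha : a * a = 2 * c := Real.mul_self_sqrt (by linarith)
    have ha0 : a ≠ 0 := (Real.sqrt_pos.2 (by linarith)).ne'
    have hid : ∀ t : ℝ, HasDerivAt (fun t => a * t) a t := fun t => by
      simpa using (hasDerivAt_id t).const_mul a
    refine ⟨fun t => Real.cosh (a * t), fun t => Real.sinh (a * t) / a,
      fun t => (Real.cosh (a * t) - 1) / (a * a), fun t => ?_, fun t => ?_, fun t => ?_,
      fun t => ?_, by simp, by simp⟩
    · exact ((hid t).sinh.div_const a).congr_deriv (by field_simp)
    · exact (((hid t).cosh.sub_const 1).div_const (a * a)).congr_deriv (by field_simp)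
    · simp only [← ha]; field_simp; ring
    · have := Real.cosh_sq (a * t)
      simp only [← ha]; field_simp
      linear_combination -this

/-- The zero set of `defect` contains both sheets of the hyperboloid. At height zero `defect` is at
most minus half the height of the pole, so the plane between the sheets is never met and a
continuous curve in the zero set stays on its sheet. -/
theorem region_of_defect {m : Space} (hc : 0 < c) (hm : defect c m = 0) : m.2 ≠ 0 := by
  intro h
  have h1 := slope_mul_pole hc
  have h2 := slope_pos hc
  have h3 := pole_pos hc.ne'
  rw [defect, ambientForm_eq, signature, if_pos hc, real_inner_self_eq_norm_sq] at hm
  simp only [Prod.snd_sub, h, zero_sub] at hm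
  have h4 : 0 ≤ slope c / 2 * ‖(m - pole c).1‖ ^ 2 := by positivity
  have h5 : slope c / 2 * ((pole c).2 * (pole c).2) = (pole c).2 / 2 := by
    linear_combination (pole c).2 / 2 * h1
  linarith

theorem isCompleteField_geodesicField (c : ℝ) : IsCompleteField c (geodesicField c) := by
  intro w₀ hw₀
  obtain ⟨v, hv, hν, hvv⟩ := exists_dual hw₀
  obtain ⟨m, ξ⟩ := w₀
  simp only at hv hν
  subst hv
  have hm := ((mem_modelBundle_iff _).1 hw₀).1
  simp only at hm
  obtain ⟨C, S, D, hS, hD, hC, hSD, hS0, hD0⟩ := exists_trig c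
  have hs := signature_mul_self c
  have hss := signature_mul_slope c
  have hνν := ambientForm_normal_self hm
  have hν' : ambientForm c v (normal c m) = 0 := by rw [ambientForm_comm, hν]
  set N := normal c m with hN
  -- By `signature_smul_normal` this is `C t • m + S t • v`. It is written with the normal because
  -- the inner products of `N` and `v` are known for every `c`, whereas those of `m` are not
  -- available at `c = 0`.
  set M : ℝ → Space := fun t => m + ((D t * (signature c * slope c)) • N + S t • v) with hM
  set U : ℝ → Space := fun t => (S t * (signature c * slope c)) • N + C t • v with hU
  have hCd : ∀ t, HasDerivAt C (2 * c * S t) t := fun t => by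
    rw [show C = fun t => 1 + 2 * c * D t from funext hC]
    exact ((hD t).const_mul (2 * c)).const_add 1
  have hMd : ∀ t, HasDerivAt M (U t) t := fun t =>
    ((((hD t).mul_const (signature c * slope c)).smul_const N).add
      ((hS t).smul_const v)).const_add m
  have hUd : ∀ t, HasDerivAt U ((C t * (signature c * slope c)) • N + (2 * c * S t) • v) t :=
    fun t => (((hS t).mul_const (signature c * slope c)).smul_const N).add ((hCd t).smul_const v)
  have hnormal : ∀ t, normal c (M t) = C t • N - (slope c * S t) • v := fun t => by
    have h1 : ∀ d, normal c (m + d) = normal c m - slope c • d := fun d => by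
      simp only [normal]
      module
    rw [hM, h1, ← hN, hC]
    have h2 : slope c * (D t * (signature c * slope c)) = -(2 * c * D t) := by
      linear_combination D t * hss
    rw [smul_add, smul_smul, smul_smul, h2]
    module
  have hX : ∀ t, (C t * (signature c * slope c)) • N + (2 * c * S t) • v = (2 * c) • M t :=
    fun t => by
      rw [← signature_smul_normal, hnormal, smul_sub, smul_smul, smul_smul,
        show signature c * slope c * (slope c * S t) = -(2 * c * S t) by
          linear_combination S t * hss, neg_smul, sub_neg_eq_add,
        mul_comm (signature c * slope c)]
  have hdef : ∀ t, defect c (M t) = 0 := fun t => by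
    have h1 := ((mem_modelSurface_iff c m).1 hm).1
    have h2 : ∀ d, defect c (m + d) = defect c m + ambientForm c N d -
        slope c / 2 * ambientForm c d d := fun d => by
      rw [hN, ambientForm_normal, defect, defect, add_sub_right_comm]
      simp only [map_add, add_apply, Prod.snd_add, ambientForm_comm c d]
      ring
    rw [hM]
    simp only [h2, h1, map_add, map_smul, add_apply, smul_apply, hν, hν', hνν, hvv, smul_eq_mul]
    linear_combination (D t * slope c - slope c ^ 3 * signature c * D t ^ 2 / 2) * hs -
      slope c / 2 * hSD t - slope c / 2 * D t ^ 2 * hss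
  have hcont : Continuous M := continuous_iff_continuousAt.2 fun t => (hMd t).continuousAt
  have hM0 : M 0 = m := by simp [hM, hS0, hD0]
  have hmem : ∀ t, M t ∈ modelSurface c := fun t => by
    refine (mem_modelSurface_iff c _).2 ⟨hdef t, fun hc => ?_⟩
    by_contra hle
    have h0 : 0 < (M 0).2 := by rw [hM0]; exact ((mem_modelSurface_iff c m).1 hm).2 hc
    obtain ⟨s, -, hs'⟩ := intermediate_value_uIcc (a := t) (b := 0) (f := fun t => (M t).2)
      (continuous_snd.comp hcont).continuousOn
      (mem_uIcc_of_le (not_lt.1 hle) h0.le : (0 : ℝ) ∈ uIcc (M t).2 (M 0).2)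
    exact region_of_defect hc (hdef s) hs'
  refine ⟨fun t => (M t, ambientForm c (U t)), ?_, fun t => ?_, fun t _ => ?_⟩
  · simp only [hM0, hU, hS0, hC, hD0]
    simp
  · refine (mk_mem_modelBundle_iff _ _).2 ⟨hmem t, ?_, ?_⟩
    · rw [hnormal, hU]
      simp only [map_sub, map_add, map_smul, sub_apply, smul_apply, hν, hν', hνν, hvv, smul_eq_mul]
      linear_combination (C t * S t * slope c) * hs
    · simp only [hU, map_add, map_smul, add_apply, smul_apply, hν, hν', hνν, hvv, smul_eq_mul]
      have h1 := hSD t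
      have h2 := hC t
      rw [h2]
      linear_combination (S t ^ 2 * slope c ^ 2 * signature c) * hs + S t ^ 2 * hss - 2 * c * h1
  · have h1 := (ambientForm c).hasFDerivAt.comp_hasDerivAt t (hUd t)
    have h2 := (hMd t).prodMk h1
    refine h2.congr_deriv ?_
    simp only [geodesicField, lower_symm_ambientForm]
    rw [hX, map_smul]

/-! ### Flow lines and geodesics -/

/-- A covector in the cotangent bundle is determined by its restriction to the tangent plane. -/
theorem eq_of_isDual {w : Phase} (hw : w ∈ modelBundle c) {v : Space}
    (h : IsDual (ambientForm c) (modelSurface c) w.1 w.2 v) : w.2 = ambientForm c v := by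
  obtain ⟨hm, h1, h2⟩ := (mem_modelBundle_iff w).1 hw
  have hv := (mem_tangentVectors_modelSurface hm).1 h.1
  refine ContinuousLinearMap.ext fun p => ?_
  have h5 := h.2 _ ((mem_tangentVectors_modelSurface hm).2 (ambientForm_normal_sub hm p))
  rw [map_sub, map_smul, h1, map_sub, map_smul, ambientForm_comm c v (normal c w.1), hv] at h5
  simpa using h5

theorem _root_.ContDiffAt.hasDerivAt_deriv {F : Type*} [NormedAddCommGroup F] [NormedSpace ℝ F]
    {m : ℝ → F} {t : ℝ} (hm : ContDiffAt ℝ 2 m t) : HasDerivAt (deriv m) (deriv (deriv m) t) t := by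
  have h : ContDiffAt ℝ 1 (fun s => fderiv ℝ m s 1) t :=
    (hm.fderiv_right (m := 1) one_add_one_eq_two.le).clm_apply contDiffAt_const
  have h' : DifferentiableAt ℝ (deriv m) t := h.differentiableAt one_ne_zero
  exact h'.hasDerivAt

theorem two_le_infty : (2 : WithTop ℕ∞) ≤ ∞ := WithTop.coe_le_coe.2 (le_top : (2 : ℕ∞) ≤ ⊤)

/-- The velocity of a curve on the surface, expressed in a chart. -/
theorem deriv_eventuallyEq_fderiv_toFun {m : ℝ → Space} {t : ℝ} (hm : ContDiffAt ℝ 2 m t)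
    (hS : ∀ᶠ s in 𝓝 t, m s ∈ modelSurface c) (φ : Chart (modelSurface c) 2)
    (ht : m t ∈ φ.target) : deriv m =ᶠ[𝓝 t] fun s =>
      fderiv ℝ φ.toFun (φ.invFun (m s)) (deriv (φ.invFun ∘ m) s) := by
  have hev := φ.eventually_right_inv hm.continuousAt hS ht
  have h2 : ∀ᶠ s in 𝓝 t, ContDiffAt ℝ 2 m s := hm.eventually (by simp)
  filter_upwards [hev.eventually_nhds, h2] with s hs hs2
  have h4 : HasDerivAt (φ.invFun ∘ m) (deriv (φ.invFun ∘ m) s) s :=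
    ((((φ.contDiffAt_invFun hs.self_of_nhds.1).of_le two_le_infty).comp s hs2).differentiableAt
      (by simp)).hasDerivAt
  have h5 := (φ.hasFDerivAt_toFun hs.self_of_nhds.2.1).comp_hasDerivAt s h4
  have h6 : m =ᶠ[𝓝 s] φ.toFun ∘ (φ.invFun ∘ m) := by
    filter_upwards [hs] with r hr using hr.2.2.symm
  exact (h5.congr_of_eventuallyEq h6).deriv

/-- The acceleration of a curve given in a parametrization. -/
theorem IsParametrization.hasDerivAt_fderiv_curve {h : Coord 2 → Space} {U : Set (Coord 2)}
    (hp : IsParametrization c h U) {y : ℝ → Coord 2} {t : ℝ} (hy : ContDiffAt ℝ 2 y t)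
    (hx : y t ∈ U) : HasDerivAt (fun s => fderiv ℝ h (y s) (deriv y s))
      (fderiv ℝ h (y t) (deriv (deriv y) t + christoffel (inducedMetric c h) (y t)
        (deriv y t) (deriv y t)) +
      (signature c * slope c * inducedMetric c h (y t) (deriv y t) (deriv y t)) • normal c (h (y t)))
      t := by
  have h7 : HasDerivAt y (deriv y t) t := (hy.differentiableAt (by simp)).hasDerivAt
  refine (((hp.hasFDerivAt_fderiv hx).comp_hasDerivAt t h7).clm_apply
    hy.hasDerivAt_deriv).congr_deriv ?_
  rw [hp.gauss_formula hx, map_add]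
  simp only [Function.comp_apply]
  abel

/-- The acceleration of a curve on the model surface. -/
theorem deriv_deriv_eq {m : ℝ → Space} {t : ℝ} (hm : ContDiffAt ℝ 2 m t)
    (hS : ∀ᶠ s in 𝓝 t, m s ∈ modelSurface c) (φ : Chart (modelSurface c) 2)
    (ht : m t ∈ φ.target) : deriv (deriv m) t = fderiv ℝ φ.toFun (φ.invFun (m t))
      (deriv (deriv (φ.invFun ∘ m)) t +
        christoffel (φ.metric fun _ => ambientForm c) (φ.invFun (m t))
          (deriv (φ.invFun ∘ m) t) (deriv (φ.invFun ∘ m) t)) +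
      (signature c * slope c * ambientForm c (deriv m t) (deriv m t)) • normal c (m t) := by
  obtain ⟨-, hx, hxm⟩ := (φ.eventually_right_inv hm.continuousAt hS ht).self_of_nhds
  have h3 := deriv_eventuallyEq_fderiv_toFun hm hS φ ht
  have h9 := φ.isParametrization.hasDerivAt_fderiv_curve
    (((φ.contDiffAt_invFun ht).of_le two_le_infty).comp t hm) hx
  rw [h3.deriv_eq, h3.self_of_nhds]
  refine h9.deriv.trans ?_
  rw [inducedMetric_apply, φ.metric_eq, Function.comp_apply, hxm]

/-- An integral curve of the geodesic field is smooth. -/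
theorem IntegralOn.contDiffOn {γ : ℝ → Phase} {J : Set ℝ} (hJ : IsOpen J)
    (h : IntegralOn (geodesicField c) γ J) : ContDiffOn ℝ 2 γ J := by
  have h0 : ContDiffOn ℝ 0 γ J := contDiffOn_zero.2 fun t ht => (h t ht).continuousAt.continuousWithinAt
  -- Bootstrapping: the derivative of `γ` is a smooth function of `γ`, so each step gains one
  -- derivative.
  have step : ∀ k : ℕ, ContDiffOn ℝ k γ J → ContDiffOn ℝ (k + 1) γ J := fun k hk => by
    rw [contDiffOn_succ_iff_deriv_of_isOpen hJ]
    refine ⟨fun t ht => (h t ht).differentiableAt.differentiableWithinAt, by simp, ?_⟩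
    have h1 : ContDiff ℝ k (geodesicField c) := (contDiff_geodesicField c).of_le (by
      exact_mod_cast WithTop.coe_le_coe.2 (le_top : (k : ℕ∞) ≤ ⊤))
    exact (h1.comp_contDiffOn hk).congr fun t ht => (h t ht).deriv
  have h1 := step 0 (by exact_mod_cast h0)
  have h2 := step 1 (by exact_mod_cast h1)
  exact_mod_cast h2

/-- At unit speed the normal acceleration of a curve on the surface is `2c m`, so the geodesic
equation is equivalent to `m'' = 2c m`. With the covector dual to `m'`, this is the integral curve
equation of the linear field. -/
theorem flowLinesAreLiftedGeodesics (c : ℝ) :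
    FlowLinesAreLiftedGeodesics c (geodesicField c) := by
  intro J γ hJ hγ
  constructor
  · intro h
    have h1 : ∀ t ∈ J, HasDerivAt (fun s => (γ s).1) ((lower c).symm (γ t).2) t := fun t ht =>
      (h t ht).fst
    have h2 : ∀ t ∈ J, HasDerivAt (fun s => (γ s).2) ((2 * c) • ambientForm c (γ t).1) t :=
      fun t ht => (h t ht).snd
    refine ⟨⟨(IntegralOn.contDiffOn hJ h).fst, fun t ht => ((mem_modelBundle_iff _).1 (hγ t ht)).1,
      fun φ t ht hφ => ?_⟩, fun t ht => ?_⟩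
    · have hw := (mem_modelBundle_iff _).1 (hγ t ht)
      have hx : φ.invFun (γ t).1 ∈ φ.source := φ.invFun_mem _ ⟨hw.1, hφ⟩
      have hS : ∀ᶠ s in 𝓝 t, (γ s).1 ∈ modelSurface c := by
        filter_upwards [hJ.mem_nhds ht] with s hs using ((mem_modelBundle_iff _).1 (hγ s hs)).1
      have h3 := deriv_deriv_eq
        ((IntegralOn.contDiffOn hJ h).fst.contDiffAt (hJ.mem_nhds ht)) hS φ hφ
      have h4 : deriv (fun s => (γ s).1) =ᶠ[𝓝 t] fun s => (lower c).symm (γ s).2 := by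
        filter_upwards [hJ.mem_nhds ht] with s hs using (h1 s hs).deriv
      have h5 := (((lower c).symm : (Space →L[ℝ] ℝ) →L[ℝ] Space).hasFDerivAt.comp_hasDerivAt t
        (h2 t ht)).deriv
      have h6 : deriv (deriv (fun s => (γ s).1)) t = (2 * c) • (γ t).1 := by
        rw [h4.deriv_eq]
        refine h5.trans ?_
        change (lower c).symm ((2 * c) • ambientForm c (γ t).1) = _
        rw [← map_smul, lower_symm_ambientForm]
      rw [h6, h4.self_of_nhds, ambientForm_lower_symm, hw.2.2, mul_one, signature_smul_normal,
        right_eq_add] at h3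
      exact φ.fderiv_toFun_injective hx (h3.trans (map_zero _).symm)
    · rw [(h1 t ht).deriv]
      refine ⟨?_, fun u _ => by rw [ambientForm_lower_symm]⟩
      have hw := (mem_modelBundle_iff _).1 (hγ t ht)
      rw [mem_tangentVectors_modelSurface hw.1, ambientForm_comm, ambientForm_lower_symm, hw.2.1]
  · rintro ⟨⟨h1, h2, h3⟩, h4⟩ t ht
    have h5 : ∀ s ∈ J, (γ s).2 = ambientForm c (deriv (fun s => (γ s).1) s) := fun s hs =>
      eq_of_isDual (hγ s hs) (h4 s hs)
    have h1t := h1.contDiffAt (hJ.mem_nhds ht)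
    obtain ⟨φ, hφ⟩ := isSubmanifold_modelSurface c _ (h2 t ht)
    have hS : ∀ᶠ s in 𝓝 t, (γ s).1 ∈ modelSurface c := by
      filter_upwards [hJ.mem_nhds ht] with s hs using h2 s hs
    have h6 := deriv_deriv_eq h1t hS φ hφ
    have hw := (mem_modelBundle_iff _).1 (hγ t ht)
    have h7 : ambientForm c (deriv (fun s => (γ s).1) t) (deriv (fun s => (γ s).1) t) = 1 := by
      have := hw.2.2
      rwa [h5 t ht, lower_symm_ambientForm] at this
    have h3' := h3 φ t ht hφ
    simp only at h3'
    rw [h3', map_zero, zero_add, h7, mul_one, signature_smul_normal] at h6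
    have h8 : HasDerivAt (fun s => (γ s).1) (deriv (fun s => (γ s).1) t) t :=
      (h1t.differentiableAt (by simp)).hasDerivAt
    have h9 : HasDerivAt (deriv (fun s => (γ s).1)) ((2 * c) • (γ t).1) t := by
      rw [← h6]
      exact h1t.hasDerivAt_deriv
    have h10 := h8.prodMk ((ambientForm c).hasFDerivAt.comp_hasDerivAt t h9)
    have h11 : γ =ᶠ[𝓝 t] fun s => ((γ s).1, ambientForm c (deriv (fun s => (γ s).1) s)) := by
      filter_upwards [hJ.mem_nhds ht] with s hs
      exact Prod.ext rfl (h5 s hs)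
    refine (h10.congr_of_eventuallyEq h11).congr_deriv ?_
    rw [geodesicField, h5 t ht, lower_symm_ambientForm, map_smul]

/-! ### The time change -/

/-- Integration of a positive speed yields a change of the time parameter. -/
theorem exists_timeChange {J : Set ℝ} (hJ : IsOpen J) (hJc : J.OrdConnected) {f : ℝ → ℝ}
    (hf : ContinuousOn f J) (hpos : ∀ t ∈ J, 0 < f t) : ∃ (I : Set ℝ) (T R : ℝ → ℝ),
      IsOpen I ∧ I.OrdConnected ∧ BijOn T J I ∧ BijOn R I J ∧ LeftInvOn R T J ∧ LeftInvOn T R I ∧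
      (∀ t ∈ J, HasDerivAt T (f t) t) ∧ ∀ s ∈ I, HasDerivAt R (f (R s))⁻¹ s := by
  obtain ⟨T, hT⟩ : ∃ T : ℝ → ℝ, ∀ t ∈ J, HasDerivAt T (f t) t := by
    rcases J.eq_empty_or_nonempty with rfl | ⟨a, ha⟩
    · exact ⟨id, fun t ht => absurd ht (notMem_empty t)⟩
    · refine ⟨fun t => ∫ s in a..t, f s, fun t ht => ?_⟩
      refine intervalIntegral.integral_hasDerivAt_right
        (hf.mono (hJc.uIcc_subset ha ht)).intervalIntegrable
        (hf.stronglyMeasurableAtFilter hJ t ht) (hf.continuousAt (hJ.mem_nhds ht))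
  have hmono : StrictMonoOn T J := by
    refine strictMonoOn_of_deriv_pos hJc.convex
      (fun t ht => (hT t ht).continuousAt.continuousWithinAt) fun t ht => ?_
    rw [(hT t (interior_subset ht)).deriv]
    exact hpos t (interior_subset ht)
  -- Continuity of `f` upgrades the derivative to a strict one, which gives openness of the image
  -- and the derivative of the inverse.
  have hstrict : ∀ t ∈ J, HasStrictDerivAt T (f t) t := fun t ht =>
    hasStrictDerivAt_of_hasDerivAt_of_continuousAt
      (by filter_upwards [hJ.mem_nhds ht] with s hs using hT s hs)
      (hf.continuousAt (hJ.mem_nhds ht))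
  have hbij : BijOn T J (T '' J) := hmono.injOn.bijOn_image
  set R := Function.invFunOn T J with hR
  have hinv := hbij.invOn_invFunOn
  refine ⟨T '' J, T, R, ?_, ?_, hbij, hinv.symm.bijOn hbij.surjOn.mapsTo_invFunOn hbij.mapsTo, hinv.1, hinv.2,
    hT, ?_⟩
  · rw [isOpen_iff_mem_nhds]
    rintro _ ⟨t, ht, rfl⟩
    rw [← (hstrict t ht).map_nhds_eq (hpos t ht).ne']
    exact Filter.image_mem_map (hJ.mem_nhds ht)
  · exact (hJc.isPreconnected.image T
      fun t ht => (hT t ht).continuousAt.continuousWithinAt).ordConnected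
  · rintro _ ⟨t, ht, rfl⟩
    rw [show R (T t) = t from hinv.1 ht]
    exact ((hstrict t ht).to_local_left_inverse (hpos t ht).ne'
      (by filter_upwards [hJ.mem_nhds ht] with s hs using hinv.1 hs)).hasDerivAt

theorem recoversKepler_geodesicField (c : ℝ) : RecoversKepler c (geodesicField c) := by
  constructor
  · intro I z hI hIc hz h
    -- The regularized time is the integral of `1/|q|` over Kepler time; the required `T` is its
    -- inverse, of derivative `|q|`. In the other direction below, `T` is itself the integral of
    -- `|q|`.
    have hcont : ContinuousOn (fun t => ‖(z t).1‖⁻¹) I := fun t ht =>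
      ((h t ht).continuousAt.fst.norm.inv₀ (norm_ne_zero_iff.2 (hz t ht).1)).continuousWithinAt
    obtain ⟨J, R, T, hJ, hJc, -, hTb, -, -, -, hTd⟩ := exists_timeChange hI hIc hcont
      fun t ht => inv_pos.2 (norm_pos_iff.2 (hz t ht).1)
    simp only [inv_inv] at hTd
    refine ⟨J, T, hJ, hJc, hTb, hTd, fun τ hτ => ?_⟩
    have hT := hTb.mapsTo hτ
    have h1 := (h _ hT).scomp τ (hTd τ hτ)
    have h2 : HasFDerivAt (regMap c) (fderiv ℝ (regMap c) (z (T τ))) (z (T τ)) :=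
      ((contDiffAt_regMap (conformal_pos_of_mem (hz _ hT))).differentiableAt (by simp)).hasFDerivAt
    have h3 := h2.comp_hasDerivAt τ h1
    rw [← hamiltonianField_regularizedK_eq (hz _ hT), fderiv_regMap_hamiltonianField (hz _ hT)] at h3
    exact h3
  · intro J w hJ hJc hw h
    have hz : ∀ τ ∈ J, regInv c (w τ) ∈ energyLevel c ∧ regMap c (regInv c (w τ)) = w τ :=
      fun τ hτ => by
        obtain ⟨z, hz, hzw⟩ := (bijOn_regMap c).surjOn (hw τ hτ)
        rw [← hzw, regInv_regMap (conformal_pos_of_mem hz)]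
        exact ⟨hz, rfl⟩
    have hd : ∀ τ ∈ J, HasDerivAt (fun τ => regInv c (w τ))
        (‖(regInv c (w τ)).1‖ • hamiltonianField keplerH (regInv c (w τ))) τ := fun τ hτ => by
      obtain ⟨hz1, hz2⟩ := hz τ hτ
      set z := regInv c (w τ) with hzdef
      have hpos := conformal_pos_of_mem hz1
      have h1 : HasFDerivAt (regInv c) (fderiv ℝ (regInv c) (w τ)) (w τ) := by
        have ho : IsOpen {w : Phase | 0 < ambientForm c (w.1 - pole c) (w.1 - pole c)} := by
          refine isOpen_lt continuous_const ?_
          have h1 : Continuous (fun w : Phase => w.1 - pole c) :=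
            continuous_fst.sub continuous_const
          exact ((ambientForm c).continuous.comp h1).clm_apply h1
        exact (((contDiffOn_regInv c).contDiffAt (ho.mem_nhds (ambientForm_chord_pos
          ((mem_modelBundle_iff _).1 (hw τ hτ).1).1 (hw τ hτ).2))).differentiableAt
            (by simp)).hasFDerivAt
      have h2 : HasFDerivAt (regMap c) (fderiv ℝ (regMap c) z) z :=
        ((contDiffAt_regMap hpos).differentiableAt (by simp)).hasFDerivAt
      have h3 : HasFDerivAt (regInv c ∘ regMap c)
          ((fderiv ℝ (regInv c) (w τ)).comp (fderiv ℝ (regMap c) z)) z := by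
        rw [← hz2] at h1
        have := h1.comp z h2
        rwa [hz2] at this
      have h4 : regInv c ∘ regMap c =ᶠ[𝓝 z] id := by
        filter_upwards [(isOpen_conformal_pos c).mem_nhds hpos] with y hy using regInv_regMap hy
      -- `regInv` is a left inverse of `regMap` on an open set, so its derivative takes the geodesic
      -- field back to the field of `K_c`.
      have h5 := DFunLike.congr_fun
        (h3.unique ((hasFDerivAt_id z).congr_of_eventuallyEq h4)) (hamiltonianField (regularizedK c) z)
      have h6 := h1.comp_hasDerivAt τ (h τ hτ)
      refine h6.congr_deriv ?_
      rw [← hamiltonianField_regularizedK_eq hz1]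
      rw [ContinuousLinearMap.comp_apply, fderiv_regMap_hamiltonianField hz1, hz2] at h5
      exact h5
    have hcont : ContinuousOn (fun τ => ‖(regInv c (w τ)).1‖) J := fun τ hτ =>
      (hd τ hτ).continuousAt.fst.norm.continuousWithinAt
    obtain ⟨I, T, R, hI, hIc, hTb, hRb, hRT, hTR, hTd, hRd⟩ := exists_timeChange hJ hJc hcont
      fun τ hτ => norm_pos_iff.2 (hz τ hτ).1.1
    refine ⟨I, T, fun t => regInv c (w (R t)), hI, hIc, hTb,
      fun t ht => (hz _ (hRb.mapsTo ht)).1, fun t ht => ?_, fun τ hτ => ?_, fun τ hτ => ?_⟩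
    · have hR := hRb.mapsTo ht
      have h1 := (hd _ hR).scomp t (hRd t ht)
      refine h1.congr_deriv ?_
      rw [inv_smul_smul₀ (norm_ne_zero_iff.2 (hz _ hR).1.1)]
    · simp only [hRT hτ]
      exact hTd τ hτ
    · simp only [hRT hτ]
      exact (hz τ hτ).2.symm

end Flow

end KeplerEuler

end

noncomputable section

namespace KeplerEuler

variable {c : ℝ}

/-! ### Maps of the surface that preserve the metric -/

/-- The map `f` of the model surface preserves the metric. -/
def PreservesForm (c : ℝ) (f : Space → Space) : Prop :=
  ∀ m ∈ modelSurface c, ∀ u ∈ tangentVectors (modelSurface c) m,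
    ∀ v ∈ tangentVectors (modelSurface c) m,
      ambientForm c (derivOn (modelSurface c) 2 f m u) (derivOn (modelSurface c) 2 f m v) =
        ambientForm c u v

theorem isIsometry_iff {f : Space → Space} (hf : IsDiffeo (modelSurface c) 2 f) :
    IsIsometry (modelSurface c) 2 (fun _ => ambientForm c) f ↔ PreservesForm c f := by
  have hfs : SmoothOn (modelSurface c) 2 f := by
    obtain ⟨f', -, -, -, -, h, -⟩ := hf
    exact h
  refine ⟨fun h m hm u hu v hv => ?_, fun h => ⟨hf, fun φ x hx a b => ?_⟩⟩
  · obtain ⟨φ, hφ⟩ := isSubmanifold_modelSurface c m hm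
    have hx := φ.invFun_mem m ⟨hm, hφ⟩
    have hxm := φ.right_inv m ⟨hm, hφ⟩
    rw [← hxm, φ.tangentVectors_eq_range hx] at hu hv
    obtain ⟨a, rfl⟩ := hu
    obtain ⟨b, rfl⟩ := hv
    have h1 := h.2 φ _ hx a b
    rw [fderiv_comp_toFun hfs (isSubmanifold_modelSurface c) φ hx,
      fderiv_comp_toFun hfs (isSubmanifold_modelSurface c) φ hx, hxm] at h1
    exact h1
  · rw [fderiv_comp_toFun hfs (isSubmanifold_modelSurface c) φ hx,
      fderiv_comp_toFun hfs (isSubmanifold_modelSurface c) φ hx]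
    exact h _ (φ.mem hx) _ (φ.fderiv_toFun_mem hx a) _ (φ.fderiv_toFun_mem hx b)

/-- A map of the surface whose derivative preserves unit tangent vectors preserves the metric. -/
theorem preservesForm_of_unit {f : Space → Space}
    (h : ∀ m ∈ modelSurface c, ∀ v ∈ tangentVectors (modelSurface c) m, ambientForm c v v = 1 →
      ambientForm c (derivOn (modelSurface c) 2 f m v) (derivOn (modelSurface c) 2 f m v) = 1) :
    PreservesForm c f := by
  intro m hm
  set D := derivOn (modelSurface c) 2 f m
  have h1 : ∀ v ∈ tangentVectors (modelSurface c) m,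
      ambientForm c (D v) (D v) = ambientForm c v v := fun v hv => by
    rcases eq_or_ne v 0 with rfl | h0
    · simp
    have hv' := (mem_tangentVectors_modelSurface hm).1 hv
    have hr := ambientForm_pos hm hv' h0
    set r := ambientForm c v v with hr_def
    have hs : (√r)⁻¹ * ((√r)⁻¹ * r) = 1 := by
      have := Real.sqrt_pos.2 hr
      field_simp
      rw [Real.sq_sqrt hr.le]
    -- Rescaling to unit length extends the hypothesis to all tangent vectors.
    have h2 := h m hm ((√r)⁻¹ • v) ((mem_tangentVectors_modelSurface hm).2 (by
      rw [map_smul, hv', smul_zero])) (by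
      simp only [map_smul, smul_apply, smul_eq_mul, ← hr_def]
      exact hs)
    change ambientForm c (D _) (D _) = 1 at h2
    simp only [map_smul, smul_apply, smul_eq_mul] at h2
    have hp : (√r)⁻¹ ≠ 0 := (inv_pos.2 (Real.sqrt_pos.2 hr)).ne'
    exact mul_left_cancel₀ hp (mul_left_cancel₀ hp (h2.trans hs.symm))
  intro u hu v hv
  -- Polarization passes from lengths to inner products.
  have h2 := h1 (u + v) ((mem_tangentVectors_modelSurface hm).2 (by
    rw [map_add, (mem_tangentVectors_modelSurface hm).1 hu,
      (mem_tangentVectors_modelSurface hm).1 hv, add_zero]))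
  simp only [map_add, add_apply] at h2
  rw [h1 u hu, h1 v hv, ambientForm_comm c (D v) (D u), ambientForm_comm c v u] at h2
  linarith

theorem christoffel_congr {E : Type*} [NormedAddCommGroup E] [NormedSpace ℝ E]
    {g g' : E → E →L[ℝ] E →L[ℝ] ℝ} {x : E} (h : g =ᶠ[𝓝 x] g') :
    christoffel g x = christoffel g' x := by
  unfold christoffel
  rw [h.self_of_nhds, h.fderiv_eq]

section Composition

variable {f : Space → Space} {h : Coord 2 → Space} {U : Set (Coord 2)} {x : Coord 2}

theorem IsParametrization.fderiv_comp (hp : IsParametrization c h U)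
    (hf : SmoothOn (modelSurface c) 2 f) (hx : x ∈ U) (a : Coord 2) :
    fderiv ℝ (f ∘ h) x a = derivOn (modelSurface c) 2 f (h x) (fderiv ℝ h x a) := by
  have := hf.hasFDerivAt_comp (isSubmanifold_modelSurface c) (hp.hasFDerivAt hx)
    (by filter_upwards [hp.isOpen.mem_nhds hx] with y hy using hp.mem y hy)
  rw [this.fderiv]; rfl

theorem IsParametrization.inducedMetric_comp (hp : IsParametrization c h U)
    (hf : SmoothOn (modelSurface c) 2 f) (hpf : PreservesForm c f) (hx : x ∈ U) :
    inducedMetric c (f ∘ h) x = inducedMetric c h x := by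
  refine ContinuousLinearMap.ext fun a => ContinuousLinearMap.ext fun b => ?_
  rw [inducedMetric_apply, inducedMetric_apply, hp.fderiv_comp hf hx, hp.fderiv_comp hf hx]
  have hm := hp.mem x hx
  exact hpf _ hm _ ((mem_tangentVectors_modelSurface hm).2 (hp.ambientForm_normal_fderiv hx a)) _
    ((mem_tangentVectors_modelSurface hm).2 (hp.ambientForm_normal_fderiv hx b))

theorem IsParametrization.comp (hp : IsParametrization c h U)
    (hf : SmoothOn (modelSurface c) 2 f) (hfm : MapsTo f (modelSurface c) (modelSurface c))
    (hpf : PreservesForm c f) : IsParametrization c (f ∘ h) U where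
  isOpen := hp.isOpen
  contDiffOn x hx := (hf.contDiffAt_comp (isSubmanifold_modelSurface c) (hp.contDiffAt hx)
    (by filter_upwards [hp.isOpen.mem_nhds hx] with y hy using hp.mem y hy)).contDiffWithinAt
  mem x hx := hfm (hp.mem x hx)
  injective x hx := by
    rw [injective_iff_map_eq_zero]
    intro a ha
    by_contra h0
    have h1 := hp.inducedMetric_pos hx h0
    rw [← hp.inducedMetric_comp hf hpf hx, inducedMetric_apply, ha, map_zero] at h1
    exact h1.false

/-- The induced metrics agree on an open set, so their first derivatives agree as well. -/
theorem IsParametrization.christoffel_comp (hp : IsParametrization c h U)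
    (hf : SmoothOn (modelSurface c) 2 f) (hpf : PreservesForm c f) (hx : x ∈ U) :
    christoffel (inducedMetric c (f ∘ h)) x = christoffel (inducedMetric c h) x :=
  christoffel_congr (by
    filter_upwards [hp.isOpen.mem_nhds hx] with y hy using hp.inducedMetric_comp hf hpf hy)

/-- The base component determines `a`; once `a = 0`, the connection and normal terms vanish and the
fibre component determines `b`. In `preservesField_bundleMap` this recovers the coordinates of the
geodesic field. -/
theorem IsParametrization.fderiv_tangentLift_injective (hp : IsParametrization c h U)
    {z : Coord 2 × Coord 2} (hz : z.1 ∈ U) : Function.Injective (fderiv ℝ (tangentLift c h) z) := by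
  rw [injective_iff_map_eq_zero]
  rintro ⟨a, b⟩ hab
  rw [hp.fderiv_tangentLift hz, Prod.mk_eq_zero] at hab
  have ha : a = 0 := hp.injective _ hz (hab.1.trans (map_zero _).symm)
  have h2 := hab.2
  subst ha
  simp only [map_zero, zero_apply, add_zero, mul_zero, zero_smul] at h2
  have h3 := congrArg (lower c).symm h2
  rw [lower_symm_ambientForm, map_zero] at h3
  exact Prod.ext rfl (hp.injective _ hz (h3.trans (map_zero _).symm))

end Composition

/-! ### The induced map of the unit cotangent bundle -/

/-- The map of covectors induced by a map `f` of the surface, acting on the dual vectors by the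
derivative of `f`. -/
def bundleMap (c : ℝ) (f : Space → Space) (w : Phase) : Phase :=
  (f w.1, ambientForm c (derivOn (modelSurface c) 2 f w.1 ((lower c).symm w.2)))

theorem lower_symm_mem {w : Phase} (hw : w ∈ modelBundle c) :
    (lower c).symm w.2 ∈ tangentVectors (modelSurface c) w.1 := by
  have h := (mem_modelBundle_iff w).1 hw
  rw [mem_tangentVectors_modelSurface h.1, ambientForm_comm, ambientForm_lower_symm, h.2.1]

theorem ambientForm_lower_symm_self {w : Phase} (hw : w ∈ modelBundle c) :
    ambientForm c ((lower c).symm w.2) ((lower c).symm w.2) = 1 := by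
  rw [ambientForm_lower_symm, ((mem_modelBundle_iff w).1 hw).2.2]

theorem mk_mem_modelBundle {m v : Space} (hm : m ∈ modelSurface c)
    (hv : v ∈ tangentVectors (modelSurface c) m) (h1 : ambientForm c v v = 1) :
    (m, ambientForm c v) ∈ modelBundle c :=
  (mk_mem_modelBundle_iff m v).2 ⟨hm, (mem_tangentVectors_modelSurface hm).1 hv, h1⟩

theorem bundleMap_tangentLift {f : Space → Space} {h : Coord 2 → Space} {U : Set (Coord 2)}
    (hp : IsParametrization c h U) (hf : SmoothOn (modelSurface c) 2 f) {z : Coord 2 × Coord 2}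
    (hz : z.1 ∈ U) : bundleMap c f (tangentLift c h z) = tangentLift c (f ∘ h) z := by
  simp only [bundleMap, tangentLift, lower_symm_ambientForm, hp.fderiv_comp hf hz,
    Function.comp_apply]

/-- A map into the unit cotangent bundle factors locally through the tangent lift of a chart of the
surface. -/
theorem exists_tangentLift_eq {E : Type*} [NormedAddCommGroup E] [NormedSpace ℝ E] {g : E → Phase}
    {x : E} (hg : ContDiffAt ℝ ∞ g x) (hm : ∀ᶠ y in 𝓝 x, g y ∈ modelBundle c) :
    ∃ (φ : Chart (modelSurface c) 2) (κ : E → Coord 2 × Coord 2), ContDiffAt ℝ ∞ κ x ∧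
      ∀ᶠ y in 𝓝 x, (κ y).1 ∈ φ.source ∧ g y = tangentLift c φ.toFun (κ y) := by
  obtain ⟨φ, hφ⟩ := isSubmanifold_modelSurface c _ ((mem_modelBundle_iff _).1 hm.self_of_nhds).1
  have hg1 : ContDiffAt ℝ ∞ (fun y => (g y).1) x := hg.fst
  refine ⟨φ, fun y => (φ.invFun (g y).1, fderiv ℝ φ.invFun (g y).1 ((lower c).symm (g y).2)),
    ?_, ?_⟩
  · refine ((φ.contDiffAt_invFun hφ).comp x hg1).prodMk (ContDiffAt.clm_apply ?_ ?_)
    · exact ((φ.contDiffAt_invFun hφ).fderiv_right (m := ∞) (by simp)).comp x hg1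
    · exact (lower c).symm.contDiff.contDiffAt.comp x hg.snd
  · have h1 : ∀ᶠ y in 𝓝 x, (g y).1 ∈ modelSurface c := by
      filter_upwards [hm] with y hy using ((mem_modelBundle_iff _).1 hy).1
    filter_upwards [hm, φ.eventually_right_inv hg1.continuousAt h1 hφ] with y hy hy'
    obtain ⟨h2, h3, h4⟩ := hy'
    refine ⟨h3, Prod.ext h4.symm ?_⟩
    have h5 := φ.fderiv_toFun_fderiv_invFun h3 (v := (lower c).symm (g y).2)
      (by rw [h4]; exact lower_symm_mem hy)
    rw [h4] at h5
    simp only [tangentLift]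
    rw [h5, ambientForm_lower_symm]

section Lift

variable {f : Space → Space}

theorem mapsTo_bundleMap (hf : SmoothOn (modelSurface c) 2 f)
    (hfm : MapsTo f (modelSurface c) (modelSurface c)) (hpf : PreservesForm c f) :
    MapsTo (bundleMap c f) (modelBundle c) (modelBundle c) := fun w hw => by
  have hm := ((mem_modelBundle_iff w).1 hw).1
  have hv := lower_symm_mem hw
  refine mk_mem_modelBundle (hfm hm)
    (derivOn_mem hf (isSubmanifold_modelSurface c) hfm hv) ?_
  rw [hpf _ hm _ hv _ hv, ambientForm_lower_symm_self hw]

/-- In a chart of the bundle, the identity and a map induced by an isometry `f` are the tangent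
lifts of parametrizations that differ by `f`. -/
theorem exists_bundleMap_eq (hf : SmoothOn (modelSurface c) 2 f) {F : Phase → Phase}
    (hF : EqOn F (bundleMap c f) (modelBundle c)) (ψ : Chart (modelBundle c) 3)
    {x : Coord 3} (hx : x ∈ ψ.source) :
    ∃ (φ : Chart (modelSurface c) 2) (κ : Coord 3 → Coord 2 × Coord 2), ContDiffAt ℝ ∞ κ x ∧
      (κ x).1 ∈ φ.source ∧ ψ.toFun =ᶠ[𝓝 x] tangentLift c φ.toFun ∘ κ ∧
      F ∘ ψ.toFun =ᶠ[𝓝 x] tangentLift c (f ∘ φ.toFun) ∘ κ := by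
  have hm : ∀ᶠ y in 𝓝 x, ψ.toFun y ∈ modelBundle c := by
    filter_upwards [ψ.source_mem_nhds hx] with y hy using ψ.mem hy
  obtain ⟨φ, κ, hκ, hev⟩ := exists_tangentLift_eq (ψ.contDiffAt_toFun hx) hm
  refine ⟨φ, κ, hκ, hev.self_of_nhds.1, ?_, ?_⟩
  · filter_upwards [hev] with y hy using hy.2
  · filter_upwards [hev, hm] with y hy hy'
    rw [Function.comp_apply, hF hy', hy.2, bundleMap_tangentLift φ.isParametrization hf hy.1]
    rfl

theorem smoothOn_bundleMap (hf : SmoothOn (modelSurface c) 2 f)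
    (hfm : MapsTo f (modelSurface c) (modelSurface c)) (hpf : PreservesForm c f) :
    SmoothOn (modelBundle c) 3 (bundleMap c f) := fun ψ x hx => by
  obtain ⟨φ, κ, hκ, hs, -, h2⟩ := exists_bundleMap_eq hf (fun _ _ => rfl) ψ hx
  exact ((((φ.isParametrization.comp hf hfm hpf).contDiffAt_tangentLift hs).comp x
    hκ).congr_of_eventuallyEq h2).contDiffWithinAt

theorem fderiv_of_eventuallyEq_tangentLift {g : Coord 3 → Phase} {h : Coord 2 → Space}
    {U : Set (Coord 2)} (hp : IsParametrization c h U) {κ : Coord 3 → Coord 2 × Coord 2}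
    {x : Coord 3} (hκ : ContDiffAt ℝ ∞ κ x) (hs : (κ x).1 ∈ U)
    (hg : g =ᶠ[𝓝 x] tangentLift c h ∘ κ) (a : Coord 3) :
    fderiv ℝ g x a = fderiv ℝ (tangentLift c h) (κ x) (fderiv ℝ κ x a) := by
  have h1 := ((hp.contDiffAt_tangentLift hs).differentiableAt (by simp)).hasFDerivAt.comp x
    (hκ.differentiableAt (by simp)).hasFDerivAt
  rw [(h1.congr_of_eventuallyEq hg).fderiv]; rfl

/-- A map induced by an isometry of the surface is an isometry of the unit cotangent bundle. -/
theorem sasaki_bundleMap (hf : SmoothOn (modelSurface c) 2 f)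
    (hfm : MapsTo f (modelSurface c) (modelSurface c)) (hpf : PreservesForm c f)
    {F : Phase → Phase} (hF : EqOn F (bundleMap c f) (modelBundle c)) (ψ : Chart (modelBundle c) 3)
    {x : Coord 3} (hx : x ∈ ψ.source) (a b : Coord 3) :
    sasaki c (F (ψ.toFun x)) (fderiv ℝ (F ∘ ψ.toFun) x a) (fderiv ℝ (F ∘ ψ.toFun) x b) =
      ψ.metric (sasaki c) x a b := by
  obtain ⟨φ, κ, hκ, hs, h1, h2⟩ := exists_bundleMap_eq hf hF ψ hx
  have hp := φ.isParametrization
  have hp' := hp.comp hf hfm hpf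
  change _ = sasaki c (ψ.toFun x) (fderiv ℝ ψ.toFun x a) (fderiv ℝ ψ.toFun x b)
  have h3 : F (ψ.toFun x) = tangentLift c (f ∘ φ.toFun) (κ x) := h2.self_of_nhds
  have h4 : ψ.toFun x = tangentLift c φ.toFun (κ x) := h1.self_of_nhds
  -- Both sides become the same expression in the induced metric and its Christoffel symbols, with
  -- the same coordinate map `κ`.
  rw [h3, h4, fderiv_of_eventuallyEq_tangentLift hp' hκ hs h2,
    fderiv_of_eventuallyEq_tangentLift hp' hκ hs h2, fderiv_of_eventuallyEq_tangentLift hp hκ hs h1,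
    fderiv_of_eventuallyEq_tangentLift hp hκ hs h1, hp'.sasaki_tangentLift hs,
    hp.sasaki_tangentLift hs, hp.inducedMetric_comp hf hpf hs, hp.christoffel_comp hf hpf hs]

/-- A map induced by an isometry of the surface preserves the geodesic field. -/
theorem preservesField_bundleMap (hf : SmoothOn (modelSurface c) 2 f)
    (hfm : MapsTo f (modelSurface c) (modelSurface c)) (hpf : PreservesForm c f) :
    PreservesField (modelBundle c) 3 (geodesicField c) (bundleMap c f) := fun ψ x hx => by
  obtain ⟨φ, κ, hκ, hs, h1, h2⟩ := exists_bundleMap_eq hf (fun _ _ => rfl) ψ hx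
  have hp := φ.isParametrization
  have hp' := hp.comp hf hfm hpf
  have h3 : bundleMap c f (ψ.toFun x) = tangentLift c (f ∘ φ.toFun) (κ x) := h2.self_of_nhds
  have h4 : ψ.toFun x = tangentLift c φ.toFun (κ x) := h1.self_of_nhds
  have hu : inducedMetric c φ.toFun (κ x).1 (κ x).2 (κ x).2 = 1 := by
    have := ambientForm_lower_symm_self (ψ.mem hx)
    rw [h4] at this
    rw [inducedMetric_apply]
    simpa only [tangentLift, lower_symm_ambientForm] using this
  have h5 := ψ.fderiv_field hx (geodesicField_mem (ψ.mem hx))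
  rw [fderiv_of_eventuallyEq_tangentLift hp hκ hs h1, h4, ← hp.geodesicField_tangentLift hs hu] at h5
  rw [fderiv_of_eventuallyEq_tangentLift hp' hκ hs h2, hp.fderiv_tangentLift_injective hs h5, h3,
    ← hp'.geodesicField_tangentLift hs (by rw [hp.inducedMetric_comp hf hpf hs, hu]),
    hp.christoffel_comp hf hpf hs]

end Lift

/-! ### Symmetries -/

/-- A symmetry of the geodesic field is induced by the map of the surface that it covers. -/
theorem IsSymmetryOver.eqOn_bundleMap {F : Phase → Phase} {f : Space → Space}
    (h : IsSymmetryOver c (geodesicField c) F f) : EqOn F (bundleMap c f) (modelBundle c) := by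
  obtain ⟨⟨f', -, -, -, -, hf, -⟩, ⟨F', hFm, -, -, -, hF, -⟩, hFf, hX⟩ := h
  intro w hw
  refine Prod.ext (hFf w hw) ?_
  obtain ⟨ψ, hψ⟩ := isSubmanifold_modelBundle c w hw
  have hx := ψ.invFun_mem w ⟨hw, hψ⟩
  have hxw := ψ.right_inv w ⟨hw, hψ⟩
  set x := ψ.invFun w
  set a := ψ.field (geodesicField c) x
  have h1 : HasFDerivAt (F ∘ ψ.toFun) (fderiv ℝ (F ∘ ψ.toFun) x) x :=
    (((hF ψ).contDiffAt (ψ.source_mem_nhds hx)).differentiableAt (by simp)).hasFDerivAt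
  have h2 : HasFDerivAt (fun y => (ψ.toFun y).1) _ x := (ψ.hasFDerivAt_toFun hx).fst
  have h3 := hf.hasFDerivAt_comp (isSubmanifold_modelSurface c) h2 (by
    filter_upwards [ψ.source_mem_nhds hx] with y hy using ((mem_modelBundle_iff _).1 (ψ.mem hy)).1)
  have h4 : (fun y => ((F ∘ ψ.toFun) y).1) =ᶠ[𝓝 x] f ∘ fun y => (ψ.toFun y).1 := by
    filter_upwards [ψ.source_mem_nhds hx] with y hy using hFf _ (ψ.mem hy)
  -- Compare base components of `F_* X = X`: on the left is the derivative of `f` applied to the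
  -- vector dual to `w.2`, on the right the vector dual to `(F w).2`.
  have h5 := DFunLike.congr_fun (h1.fst.unique (h3.congr_of_eventuallyEq h4)) a
  change (fderiv ℝ (F ∘ ψ.toFun) x a).1 =
    derivOn (modelSurface c) 2 f (ψ.toFun x).1 (fderiv ℝ ψ.toFun x a).1 at h5
  rw [hX ψ x hx, ψ.fderiv_field hx (geodesicField_mem (ψ.mem hx)), hxw] at h5
  simp only [geodesicField] at h5
  simp only [bundleMap]
  rw [← h5, ambientForm_lower_symm]

/-- Every unit tangent vector is dual to a point of the bundle. Since `F` maps the bundle to itself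
and acts on dual vectors by the derivative of `f`, that derivative preserves unit length. -/
theorem IsSymmetryOver.preservesForm {F : Phase → Phase} {f : Space → Space}
    (h : IsSymmetryOver c (geodesicField c) F f) : PreservesForm c f :=
  preservesForm_of_unit fun m hm v hv h1 => by
    have h2 := mk_mem_modelBundle hm hv h1
    obtain ⟨-, ⟨F', hFm, -⟩, -⟩ := id h
    have h3 := hFm h2
    rw [h.eqOn_bundleMap h2] at h3
    simpa only [bundleMap, lower_symm_ambientForm] using ambientForm_lower_symm_self h3

theorem IsSymmetryOver.isIsometry {F : Phase → Phase} {f : Space → Space}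
    (h : IsSymmetryOver c (geodesicField c) F f) :
    IsIsometry (modelBundle c) 3 (sasaki c) F ∧
      IsIsometry (modelSurface c) 2 (fun _ => ambientForm c) f := by
  obtain ⟨hfd, hFd, -, -⟩ := id h
  obtain ⟨f', hfm, -, -, -, hf, -⟩ := id hfd
  exact ⟨⟨hFd, fun ψ x hx a b => sasaki_bundleMap hf hfm h.preservesForm h.eqOn_bundleMap ψ hx a b⟩,
    (isIsometry_iff hfd).2 h.preservesForm⟩

/-- The derivatives of mutually inverse maps of a submanifold are mutually inverse. -/
theorem derivOn_derivOn {V : Type*} [NormedAddCommGroup V] [NormedSpace ℝ V] {S : Set V} {n : ℕ}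
    (hS : IsSubmanifold S n) {f f' : V → V} (hf : SmoothOn S n f) (hf' : SmoothOn S n f')
    (hm : MapsTo f' S S) (h : LeftInvOn f f' S) {q v : V} (hv : v ∈ tangentVectors S q) :
    derivOn S n f (f' q) (derivOn S n f' q v) = v := by
  obtain ⟨γ, rfl, h1, h2⟩ := hv
  have h3 := hf.hasDerivAt_comp hS (hf'.hasDerivAt_comp hS h2 h1) (by
    filter_upwards [h1] with t ht using hm ht)
  refine h3.unique (h2.congr_of_eventuallyEq ?_)
  filter_upwards [h1] with t ht using h ht

theorem leftInvOn_bundleMap {f f' : Space → Space} (hf : SmoothOn (modelSurface c) 2 f)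
    (hf' : SmoothOn (modelSurface c) 2 f') (hm : MapsTo f' (modelSurface c) (modelSurface c))
    (h : LeftInvOn f f' (modelSurface c)) :
    LeftInvOn (bundleMap c f) (bundleMap c f') (modelBundle c) := fun w hw => by
  have h1 := derivOn_derivOn (isSubmanifold_modelSurface c) hf hf' hm h (lower_symm_mem hw)
  simp only [bundleMap, lower_symm_ambientForm, h1, ambientForm_lower_symm,
    h ((mem_modelBundle_iff w).1 hw).1]

/-- Isometries of the surface induce symmetries of the geodesic flow. -/
theorem isSymmetryOver_bundleMap {f : Space → Space} (hfd : IsDiffeo (modelSurface c) 2 f)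
    (hpf : PreservesForm c f) : IsSymmetryOver c (geodesicField c) (bundleMap c f) f := by
  obtain ⟨f', hm, hm', hl, hr, hf, hf'⟩ := id hfd
  -- The inverse also preserves the metric, as its derivative inverts that of `f`; its induced map
  -- is then the smooth inverse of `bundleMap c f`.
  have hpf' : PreservesForm c f' := fun q hq u hu v hv => by
    have h1 := fun w hw => derivOn_derivOn (v := w) (q := q) (isSubmanifold_modelSurface c) hf hf'
      hm' hr hw
    have h2 := fun w hw => derivOn_mem (v := w) hf' (isSubmanifold_modelSurface c) hm' (q := q) hw
    rw [← hpf _ (hm' hq) _ (h2 u hu) _ (h2 v hv), h1 u hu, h1 v hv]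
  exact ⟨hfd, ⟨bundleMap c f', mapsTo_bundleMap hf hm hpf, mapsTo_bundleMap hf' hm' hpf',
    leftInvOn_bundleMap hf' hf hm hl, leftInvOn_bundleMap hf hf' hm' hr,
    smoothOn_bundleMap hf hm hpf, smoothOn_bundleMap hf' hm' hpf'⟩, fun _ _ => rfl,
    preservesField_bundleMap hf hm hpf⟩

/-! ### Rotations and reflections -/

/-- The map of space that extends a linear isometry of the plane and preserves heights. -/
def horizontalMap (A : Plane ≃ₗᵢ[ℝ] Plane) : Space →L[ℝ] Space :=
  ((A : Plane ≃L[ℝ] Plane) : Plane →L[ℝ] Plane).prodMap (ContinuousLinearMap.id ℝ ℝ)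

theorem horizontalMap_apply (A : Plane ≃ₗᵢ[ℝ] Plane) (v : Space) :
    horizontalMap A v = (A v.1, v.2) := rfl

theorem ambientForm_horizontalMap (A : Plane ≃ₗᵢ[ℝ] Plane) (u v : Space) :
    ambientForm c (horizontalMap A u) (horizontalMap A v) = ambientForm c u v := by
  simp only [ambientForm_eq, horizontalMap_apply, A.inner_map_map]

theorem mapsTo_horizontalMap (A : Plane ≃ₗᵢ[ℝ] Plane) :
    MapsTo (horizontalMap A) (modelSurface c) (modelSurface c) := fun m hm => by
  have hp : horizontalMap A (pole c) = pole c := by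
    rw [horizontalMap_apply, pole_fst, map_zero, ← pole_fst c]
  rw [mem_modelSurface_iff] at hm ⊢
  refine ⟨?_, hm.2⟩
  rw [← hm.1, defect, defect, ← hp, ← map_sub, hp, ambientForm_horizontalMap]
  rfl

theorem isDiffeo_horizontalMap (A : Plane ≃ₗᵢ[ℝ] Plane) :
    IsDiffeo (modelSurface c) 2 (horizontalMap A) :=
  ⟨horizontalMap A.symm, mapsTo_horizontalMap A, mapsTo_horizontalMap A.symm,
    fun m _ => by simp only [horizontalMap_apply, A.symm_apply_apply],
    fun m _ => by simp only [horizontalMap_apply, A.apply_symm_apply],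
    (horizontalMap A).contDiff.smoothOn, (horizontalMap A.symm).contDiff.smoothOn⟩

theorem derivOn_clm {V F : Type*} [NormedAddCommGroup V] [NormedSpace ℝ V] [NormedAddCommGroup F]
    [NormedSpace ℝ F] {S : Set V} {n : ℕ} (hS : IsSubmanifold S n) (L : V →L[ℝ] F) {q v : V}
    (hv : v ∈ tangentVectors S q) : derivOn S n L q v = L v := by
  obtain ⟨γ, rfl, h1, h2⟩ := hv
  exact (((ContDiff.smoothOn L.contDiff).hasDerivAt_comp hS h2 h1).unique
    (L.hasFDerivAt.comp_hasDerivAt 0 h2))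

theorem preservesForm_horizontalMap (A : Plane ≃ₗᵢ[ℝ] Plane) :
    PreservesForm c (horizontalMap A) := fun m _ u hu v hv => by
  rw [derivOn_clm (isSubmanifold_modelSurface c) _ hu,
    derivOn_clm (isSubmanifold_modelSurface c) _ hv, ambientForm_horizontalMap]

/-- The horizontal action of `A` fixes the pole and all heights, and both the conformal denominator
and `⟪p, q⟫` are invariant, so base point and velocity are equivariant. -/
theorem bundleMap_regMap (A : Plane ≃ₗᵢ[ℝ] Plane) {z : Plane × Plane} (hz : z ∈ energyLevel c) :
    bundleMap c (horizontalMap A) (regMap c z) = regMap c (A z.1, A z.2) := by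
  have h1 := conformal_pos_of_mem hz
  have hA : ∀ x, conformal c (A x) = conformal c x := fun x => by
    simp only [conformal, A.norm_map]
  have h2 : regMap c z ∈ modelBundle c := ((bijOn_regMap c).mapsTo hz).1
  have h3 := lower_symm_mem h2
  rw [bundleMap, derivOn_clm (isSubmanifold_modelSurface c) _ h3, regMap_eq h1,
    regMap_eq (z := (A z.1, A z.2)) (by rw [hA]; exact h1)]
  simp only [lower_symm_ambientForm]
  congr 1
  · rw [← map_neg, stereo_eq, stereo_eq, hA, horizontalMap_apply]
    refine Prod.ext ?_ rfl
    simp [pole_fst]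
  · congr 1
    simp only [regVelocity, horizontalMap_apply, hA, A.inner_map_map, map_sub, map_smul]

theorem symmetriesAreIsometries (c : ℝ) :
    SymmetriesAreIsometries c (geodesicField c) (sasaki c) := by
  refine ⟨fun A => ?_, fun F f h => h.isIsometry, fun f h =>
    ⟨bundleMap c f, isSymmetryOver_bundleMap h.1 ((isIsometry_iff h.1).1 h)⟩⟩
  have h := isSymmetryOver_bundleMap (isDiffeo_horizontalMap (c := c) A)
    (preservesForm_horizontalMap A)
  exact ⟨_, _, h, h.isIsometry.1, fun z hz => bundleMap_regMap A hz⟩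

end KeplerEuler

end

theorem corollary4 (c : ℝ) :
    -- the model surface with its metric of constant curvature `-2c`
    IsSubmanifold (modelSurface c) 2 ∧
    IsRiemannian (modelSurface c) 2 (fun _ => ambientForm c) ∧
    HasConstantCurvature (modelSurface c) 2 (fun _ => ambientForm c) (-2 * c) ∧
    -- its unit cotangent bundle
    IsSubmanifold (modelBundle c) 3 ∧
    ∃ (G : Phase → Phase →L[ℝ] Phase →L[ℝ] ℝ) (μ : Phase → Phase [⋀^Fin 3]→L[ℝ] ℝ)
      (X : Phase → Phase),
      -- the Sasaki-Mok lift, its volume form and the regularized Kepler flow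
      IsRiemannian (modelBundle c) 3 G ∧
      IsSasakiMokLift (ambientForm c) (modelSurface c) G ∧
      IsRiemannianVolume (modelBundle c) G μ ∧
      IsVectorField (modelBundle c) 3 X ∧
      IsRegularizedField c X ∧
      IsCompleteField c X ∧
      -- the flow is a stationary Beltrami solution of the Euler equations, of eigenvalue 1
      IsBeltrami (modelBundle c) G μ X (fun _ => 1) ∧
      IsStationaryEuler (modelBundle c) G μ X ∧
      FlowLinesAreLiftedGeodesics c X ∧
      RecoversKepler c X ∧
      SymmetriesAreIsometries c X G :=
  ⟨isSubmanifold_modelSurface c, isRiemannian_modelSurface c, hasConstantCurvature_modelSurface c,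
    isSubmanifold_modelBundle c, sasaki c, liouvilleVolume, geodesicField c, isRiemannian_sasaki c,
    isSasakiMokLift_sasaki c, isRiemannianVolume_liouvilleVolume c, isVectorField_geodesicField c,
    isRegularizedField_geodesicField c, isCompleteField_geodesicField c,
    isBeltrami_geodesicField c, isStationaryEuler_geodesicField c, flowLinesAreLiftedGeodesics c,
    recoversKepler_geodesicField c, symmetriesAreIsometries c⟩
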